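/- Let $d\ge 1$, $J>0$ and $\delta>1$. On the half-space $\mathbb{H}_+=\mathbb{Z}^{d-1}\times\{1,2,3,\dots\}$ with nearest-neighbour edges, consider for $\lambda\ge 0$ the Ising model with external field $\widehat{\boldsymbol\lambda}=(\lambda_i)_{i\in\mathbb{H}_+}$, $\lambda_i=\lambda/i_d^{\,\delta}$: for a finite $\Lambda\subset\mathbb{H}_+$ the Hamiltonian is $$\mathcal H_\Lambda(\sigma)=-\sum_{\substack{\{i,j\}\subset\mathbb{H}_+,\ |i-j|_1=1\\ \{i,j\}\cap\Lambda\neq\emptyset}}J\sigma_i\sigma_j-\sum_{i\in\Lambda}\lambda_i\sigma_i ,\qquad \sigma\in\{-1,1\}^{\mathbb{H}_+},$$ with Boltzmann weight $e^{-\mathcal H_\Lambda(\sigma)}$. Let $\Lambda_n=[-n,n]^{d-1}\times[1,n]$, $\mathcal W_n=[-n,n]^{d-1}\times\{1\}$ and $\Delta_n=[-n,n]^{d-1}\times[1-n,n]$. Let $\mathcal Z^{\pm}_{n;\widehat{\boldsymbol\lambda}}$ and $\langle\cdot\rangle^{\pm}_{n;J,\widehat{\boldsymbol\lambda}}$ be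 the partition function and the Gibbs expectation in $\Lambda_n$ with $\pm$ boundary condition on $\mathbb{H}_+\setminus\Lambda_n$, let $Q^{\pm}_{\Delta_n;J}$ be the partition function in $\Delta_n$ of the Ising model on $\mathbb{Z}^d$ with nearest-neighbour coupling $J$, no external field and $\pm$ boundary condition, and put $$\langle f\rangle^{\pm}_{J,\widehat{\boldsymbol\lambda}}=\lim_{n\to\infty}\langle f\rangle^{\pm}_{n;J,\widehat{\boldsymbol\lambda}}\ \ (f\text{ local}),\qquad \tilde F^{\pm}(J,\widehat{\boldsymbol\lambda})=\lim_{n\to\infty}-\frac1{2|\mathcal W_n|}\ln\frac{\big(\mathcal Z^{\pm}_{n;\widehat{\boldsymbol\lambda}}\big)^2}{Q^{\pm}_{\Delta_n;J}},$$ $$\tilde\tau_w(J,\widehat{\boldsymbol\lambda})=\tilde F^-(J,\widehat{\boldsymbol\lambda})-\tilde F^+(J,\widehat{\boldsymbol\lambda}),\qquad \overline\lambda_c=\overline\lambda_c(J)=\inf\Big\{\lambda\ge 0:\ \tilde\tau_w(J,\widehat{\boldsymbol\lambda})=\max_{s\ge 0}\tilde\tau_w(J,\widehat{\boldsymbol s})\Big\}.$$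 Then for all $\lambda\ge 0$ the limits above exist, the maximum of $s\mapsto\tilde\tau_w(J,\widehat{\boldsymbol s})$ over $s\ge 0$ is attained (so $\overline\lambda_c$ is a well-defined finite number), and: (i) for every $0\le\lambda<\overline\lambda_c$ there is a phase transition: $\langle\cdot\rangle^{+}_{J,\widehat{\boldsymbol\lambda}}\neq\langle\cdot\rangle^{-}_{J,\widehat{\boldsymbol\lambda}}$; (ii) for every $\lambda>\overline\lambda_c$ the state is unique: $\langle\cdot\rangle^{+}_{J,\widehat{\boldsymbol\lambda}}=\langle\cdot\rangle^{-}_{J,\widehat{\boldsymbol\lambda}}$, and there is exactly one probability measure on $\{-1,1\}^{\mathbb{H}_+}$ that satisfies the DLR equations of the model. -/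

import Mathlib

open Filter Topology MeasureTheory

noncomputable section

namespace SemiInfIsing

/-! ### The Ising model on a locally finite graph -/

section Graph

variable {V : Type*} [DecidableEq V]

/-- The value of a spin: `true` stands for `+1` and `false` for `-1`. -/
def spin (b : Bool) : ℝ := if b then 1 else -1

/-- The configuration equal to `ω` inside `Λ` and to the boundary condition `η` outside `Λ`. -/
def glue (Λ : Finset V) (η : V → Bool) (ω : Λ → Bool) : V → Bool :=
  fun i => if hi : i ∈ Λ then ω ⟨i, hi⟩ else η i

/-- The edges of `G` with at least one endpoint in `Λ`. -/
def touchingEdges (G : SimpleGraph V) [G.LocallyFinite] (Λ : Finset V) : Finset (Sym2 V) :=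
  Λ.biUnion fun i => G.incidenceFinset i

/-- The Hamiltonian in `Λ`,
`H_Λ(σ) = - ∑_{i ∼ j, {i,j} ∩ Λ ≠ ∅} J σ_i σ_j - ∑_{i ∈ Λ} h_i σ_i`,
where every unordered pair of neighbours is counted once. -/
def energy (G : SimpleGraph V) [G.LocallyFinite] (J : ℝ) (h : V → ℝ) (Λ : Finset V)
    (σ : V → Bool) : ℝ :=
  -(∑ e ∈ touchingEdges G Λ, J * (e.map fun i => spin (σ i)).mul)
    - ∑ i ∈ Λ, h i * spin (σ i)

/-- The partition function in `Λ` with boundary condition `η` (the inverse temperature is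
absorbed in `J` and `h`). -/
def partitionFn (G : SimpleGraph V) [G.LocallyFinite] (J : ℝ) (h : V → ℝ) (Λ : Finset V)
    (η : V → Bool) : ℝ :=
  ∑ ω : Λ → Bool, Real.exp (-energy G J h Λ (glue Λ η ω))

/-- The expectation of `f` in the finite-volume Gibbs measure in `Λ` with boundary
condition `η`. -/
def expect (G : SimpleGraph V) [G.LocallyFinite] (J : ℝ) (h : V → ℝ) (Λ : Finset V)
    (η : V → Bool) (f : (V → Bool) → ℝ) : ℝ :=
  (∑ ω : Λ → Bool, f (glue Λ η ω) * Real.exp (-energy G J h Λ (glue Λ η ω)))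
    / partitionFn G J h Λ η

end Graph

/-- Local observables: real functions of the spins at finitely many sites. -/
def LocalObs (V : Type*) : Type _ :=
  {f : (V → Bool) → ℝ // ∃ A : Finset V, DependsOn f (A : Set V)}

/-- Infinite-volume Gibbs measures, through the DLR equations. -/
def IsGibbs {V : Type*} [DecidableEq V] (G : SimpleGraph V) [G.LocallyFinite] (J : ℝ)
    (h : V → ℝ) (μ : ProbabilityMeasure (V → Bool)) : Prop :=
  ∀ (Λ : Finset V) (f : LocalObs V),
    ∫ σ, f.1 σ ∂(μ : Measure (V → Bool))
      = ∫ η, expect G J h Λ η f.1 ∂(μ : Measure (V → Bool))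

/-! ### The lattice and the half-space -/

/-- The sites of `ℤ^d`, written as `ℤ^{d-1} × ℤ` (for `d ≥ 1`); the second component is the
last coordinate. -/
abbrev Lattice (d : ℕ) : Type := (Fin (d - 1) → ℤ) × ℤ

/-- The `ℓ¹` distance on `ℤ^d`. -/
def dist1 {d : ℕ} (x y : Lattice d) : ℤ := (∑ j, |x.1 j - y.1 j|) + |x.2 - y.2|

/-- The nearest-neighbour graph of `ℤ^d`. -/
def latticeGraph (d : ℕ) : SimpleGraph (Lattice d) where
  Adj x y := dist1 x y = 1
  symm := ⟨fun x y hxy => by simpa only [dist1, abs_sub_comm] using hxy⟩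
  loopless := ⟨fun x hx => by simp [dist1] at hx⟩

/-- The half-space `ℤ^{d-1} × {1, 2, 3, …}`. -/
abbrev HalfSpace (d : ℕ) : Type := {x : Lattice d // 1 ≤ x.2}

/-- The nearest-neighbour graph of the half-space. -/
def halfGraph (d : ℕ) : SimpleGraph (HalfSpace d) :=
  (latticeGraph d).comap Subtype.val

theorem latticeGraph_neighborSet_finite {d : ℕ} (x : Lattice d) :
    ((latticeGraph d).neighborSet x).Finite := by
  classical
  refine (Set.finite_Icc (x - 1) (x + 1)).subset fun y hy => ?_
  have hy1 : (∑ j, |x.1 j - y.1 j|) + |x.2 - y.2| = 1 := hy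
  have h0 : 0 ≤ ∑ j, |x.1 j - y.1 j| := Finset.sum_nonneg fun j _ => abs_nonneg _
  have h2 : |x.2 - y.2| ≤ 1 := by linarith
  have h1 : ∀ j, |x.1 j - y.1 j| ≤ 1 := fun j => by
    have hj := Finset.single_le_sum (f := fun j => |x.1 j - y.1 j|)
      (fun i _ => abs_nonneg _) (Finset.mem_univ j)
    have := abs_nonneg (x.2 - y.2)
    linarith
  have h3 := abs_le.1 h2
  refine ⟨⟨fun j => ?_, ?_⟩, ⟨fun j => ?_, ?_⟩⟩
  · have := abs_le.1 (h1 j)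
    simp only [Prod.fst_sub, Prod.fst_one, Pi.sub_apply, Pi.one_apply]
    linarith
  · simp only [Prod.snd_sub, Prod.snd_one]
    linarith
  · have := abs_le.1 (h1 j)
    simp only [Prod.fst_add, Prod.fst_one, Pi.add_apply, Pi.one_apply]
    linarith
  · simp only [Prod.snd_add, Prod.snd_one]
    linarith

theorem halfGraph_neighborSet_finite {d : ℕ} (x : HalfSpace d) :
    ((halfGraph d).neighborSet x).Finite :=
  ((latticeGraph_neighborSet_finite x.1).preimage Subtype.val_injective.injOn).subset
    fun _ hy => hy

instance latticeGraphLocallyFinite (d : ℕ) : (latticeGraph d).LocallyFinite :=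
  fun x => (latticeGraph_neighborSet_finite x).fintype

instance halfGraphLocallyFinite (d : ℕ) : (halfGraph d).LocallyFinite :=
  fun x => (halfGraph_neighborSet_finite x).fintype

/-- The cube `[-n, n]^{d-1}`. -/
def base (d n : ℕ) : Finset (Fin (d - 1) → ℤ) :=
  Finset.Icc (fun _ => -(n : ℤ)) (fun _ => (n : ℤ))

/-- The box `Λ_n = [-n, n]^{d-1} × [1, n]` of the half-space. -/
def halfBox (d n : ℕ) : Finset (HalfSpace d) :=
  Finset.subtype (fun x : Lattice d => 1 ≤ x.2) (base d n ×ˢ Finset.Icc (1 : ℤ) n)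

/-- The box `Δ_n = [-n, n]^{d-1} × [1 - n, n]` of `ℤ^d`: the union of `Λ_n` and of its
reflection through `{i_d = 1/2}`. -/
def doubleBox (d n : ℕ) : Finset (Lattice d) :=
  base d n ×ˢ Finset.Icc (1 - (n : ℤ)) n

/-- The wall `W_n = [-n, n]^{d-1} × {1}`. -/
def wall (d n : ℕ) : Finset (Lattice d) := base d n ×ˢ {(1 : ℤ)}

/-! ### The semi-infinite model -/

/-- The external field `h_i = lam / i_d ^ δ`. -/
def decayField (d : ℕ) (δ lam : ℝ) (i : HalfSpace d) : ℝ := lam / (i.1.2 : ℝ) ^ δ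

/-- `⟨f⟩_n^±` for the semi-infinite model with external field `h`: the expectation in `Λ_n` with
the `+` (`b = true`) or `-` (`b = false`) boundary condition. -/
def boxExpect (d : ℕ) (J : ℝ) (h : HalfSpace d → ℝ) (b : Bool) (n : ℕ)
    (f : (HalfSpace d → Bool) → ℝ) : ℝ :=
  expect (halfGraph d) J h (halfBox d n) (fun _ => b) f

/-- The `+` (`b = true`) or `-` (`b = false`) state of the semi-infinite model:
`⟨f⟩^± = lim_n ⟨f⟩_n^±` for local `f`. -/
def state (d : ℕ) (J : ℝ) (h : HalfSpace d → ℝ) (b : Bool) : LocalObs (HalfSpace d) → ℝ :=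
  fun f => limUnder atTop fun n => boxExpect d J h b n f.1

/-- `-(1 / (2 |W_n|)) ln ((Z_n^±)² / Q_{Δ_n}^±)`, where `Z_n^±` is the partition function of the
semi-infinite model in `Λ_n` with field `h`, and `Q_{Δ_n}^±` that of the Ising model on `ℤ^d` in
`Δ_n` without external field. -/
def surfaceFreeEnergySeq (d : ℕ) (J : ℝ) (h : HalfSpace d → ℝ) (b : Bool) (n : ℕ) : ℝ :=
  -(1 / (2 * ((wall d n).card : ℝ))) *
    Real.log ((partitionFn (halfGraph d) J h (halfBox d n) fun _ => b) ^ 2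
      / partitionFn (latticeGraph d) J (fun _ => 0) (doubleBox d n) fun _ => b)

/-- The free surface energy `F^±`. -/
def surfaceFreeEnergy (d : ℕ) (J : ℝ) (h : HalfSpace d → ℝ) (b : Bool) : ℝ :=
  limUnder atTop (surfaceFreeEnergySeq d J h b)

/-- The modified wall free energy `F^- - F^+`. -/
def wallFreeEnergy (d : ℕ) (J : ℝ) (h : HalfSpace d → ℝ) : ℝ :=
  surfaceFreeEnergy d J h false - surfaceFreeEnergy d J h true

/-- The set of `lam ≥ 0` at which the wall free energy, as a function of `s ≥ 0` for the field
`s / i_d ^ δ`, reaches its maximum. -/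
def maxSet (d : ℕ) (J δ : ℝ) : Set ℝ :=
  {lam | 0 ≤ lam ∧
    IsMaxOn (fun s => wallFreeEnergy d J (decayField d δ s)) (Set.Ici 0) lam}

/-- The critical value. -/
def lambdaBar (d : ℕ) (J δ : ℝ) : ℝ := sInf (maxSet d J δ)

end SemiInfIsing

end

set_option linter.unusedSectionVars false

noncomputable section

namespace SemiInfIsing

/-! ### Ising models with edge-dependent couplings -/

section Framework

variable {V : Type*} [DecidableEq V]

/-! Write τ(λ) for the wall free energy. The two reference partition functions Q^± coincide by spin
flip, so τ(λ) is the limit of ln(Z_n^+ / Z_n^-) (`boxRatio`) per wall site. In finite volume its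
λ-derivative is `totalGap`: the sum over the box of i_d^{-δ} times the gap between the
magnetisations at i with + and - boundary condition. This gap is nonnegative (`gibbs_le_gibbs`) and
nonincreasing in λ ≥ 0 (`magnetization_gap_anti`, an inequality of Lebowitz type proved with four
rotated replicas). Hence τ is nondecreasing and concave on [0, ∞), and once at its maximum it stays
there.

Because δ > 1, the derivative per wall site converges to ∑ (l+1)^{-δ} m_l, where m_l is the limiting
gap at height l+1. To the right of a maximum point, concavity forces this sum to be at most 0, so
every m_l vanishes (`gapVanishes_of_lt`). Conversely, if all gaps vanish at λ, the slope there is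
zero and λ is a maximum point (`GapVanishes.mem_maxSet`). Vanishing gaps amount to equality of the +
and - states, since a large multiple of a sum of spins plus or minus a local function is increasing.
The same bound, with the DLR equations, pins down every Gibbs measure; one exists by compactness.

The limits themselves come from monotonicity in the volume together with horizontal translation
invariance. For the free energies one interpolates in s ∈ [0,1] from Q to (Z)² in the doubled box,
weakening the bonds that cross the middle hyperplane while switching on the reflected field.

The maximum of τ is attained at λ = J (`wallFreeEnergy_le`). For any λ, freeze the lowest k layers
to +: above them they act as a wall field J, and the remaining external field costs only the tail
∑_{l ≥ k} λ (l+1)^{-δ} per column, up to a constant factor. A wall field J is dominated by the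
decaying field of strength J. -/

/-- Minus the Hamiltonian in `Λ` with coupling `K e` on the edge `e` and external field `h`. -/
def ham (G : SimpleGraph V) [G.LocallyFinite] (K : Sym2 V → ℝ) (h : V → ℝ) (Λ : Finset V)
    (σ : V → Bool) : ℝ :=
  ∑ e ∈ touchingEdges G Λ, K e * (e.map fun i => spin (σ i)).mul + ∑ i ∈ Λ, h i * spin (σ i)

/-- The unnormalised expectation of `F` in `Λ` with boundary condition `η`. -/
def wsum (G : SimpleGraph V) [G.LocallyFinite] (K : Sym2 V → ℝ) (h : V → ℝ) (Λ : Finset V)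
    (η : V → Bool) (F : (V → Bool) → ℝ) : ℝ :=
  ∑ ω : Λ → Bool, F (glue Λ η ω) * Real.exp (ham G K h Λ (glue Λ η ω))

/-- The partition function with edge-dependent couplings. -/
def zfun (G : SimpleGraph V) [G.LocallyFinite] (K : Sym2 V → ℝ) (h : V → ℝ) (Λ : Finset V)
    (η : V → Bool) : ℝ :=
  wsum G K h Λ η fun _ => 1

/-- The finite-volume Gibbs expectation with edge-dependent couplings. -/
def gibbs (G : SimpleGraph V) [G.LocallyFinite] (K : Sym2 V → ℝ) (h : V → ℝ) (Λ : Finset V)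
    (η : V → Bool) (F : (V → Bool) → ℝ) : ℝ :=
  wsum G K h Λ η F / zfun G K h Λ η

theorem energy_eq_neg_ham (G : SimpleGraph V) [G.LocallyFinite] (J : ℝ) (h : V → ℝ)
    (Λ : Finset V) (σ : V → Bool) : energy G J h Λ σ = -ham G (fun _ => J) h Λ σ := by
  unfold energy ham; ring

theorem partitionFn_eq_zfun (G : SimpleGraph V) [G.LocallyFinite] (J : ℝ) (h : V → ℝ)
    (Λ : Finset V) (η : V → Bool) : partitionFn G J h Λ η = zfun G (fun _ => J) h Λ η := by
  simp [partitionFn, zfun, wsum, energy_eq_neg_ham]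

theorem expect_eq_gibbs (G : SimpleGraph V) [G.LocallyFinite] (J : ℝ) (h : V → ℝ)
    (Λ : Finset V) (η : V → Bool) (F : (V → Bool) → ℝ) :
    expect G J h Λ η F = gibbs G (fun _ => J) h Λ η F := by
  simp [expect, gibbs, wsum, energy_eq_neg_ham, partitionFn_eq_zfun]

/-! ### Spins, gluing and touching edges -/

theorem spin_not (b : Bool) : spin (!b) = -spin b := by cases b <;> simp [spin]

theorem spin_mono : Monotone spin := by
  intro a b hab
  cases a <;> cases b <;> first | (exact absurd hab (by decide)) | norm_num [spin]

theorem abs_spin (b : Bool) : |spin b| = 1 := by cases b <;> simp [spin]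

theorem glue_mem {Λ : Finset V} {i : V} (hi : i ∈ Λ) (η : V → Bool) (ω : Λ → Bool) :
    glue Λ η ω i = ω ⟨i, hi⟩ := by simp [glue, hi]

theorem glue_notMem {Λ : Finset V} {i : V} (hi : i ∉ Λ) (η : V → Bool) (ω : Λ → Bool) :
    glue Λ η ω i = η i := by simp [glue, hi]

theorem glue_restrict {Λ : Finset V} {η σ : V → Bool} (hσ : ∀ i ∉ Λ, σ i = η i) :
    glue Λ η (fun i : Λ => σ i) = σ := by
  ext i; by_cases hi : i ∈ Λ <;> simp [glue, hi, hσ]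

theorem glue_congr {Λ : Finset V} {η η' : V → Bool} (hη : ∀ i ∉ Λ, η i = η' i) (ω : Λ → Bool) :
    glue Λ η ω = glue Λ η' ω := by
  ext i; by_cases hi : i ∈ Λ <;> simp [glue, hi, hη]

theorem mem_touchingEdges {G : SimpleGraph V} [G.LocallyFinite] {Λ : Finset V} {a b : V} :
    s(a, b) ∈ touchingEdges G Λ ↔ G.Adj a b ∧ (a ∈ Λ ∨ b ∈ Λ) := by
  simp only [touchingEdges, Finset.mem_biUnion, SimpleGraph.mem_incidenceFinset,
    SimpleGraph.incidenceSet, Set.mem_sep_iff, SimpleGraph.mem_edgeSet, Sym2.mem_iff]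
  constructor
  · rintro ⟨i, hi, hab, rfl | rfl⟩ <;> simp [*]
  · rintro ⟨hab, ha | hb⟩
    · exact ⟨a, ha, hab, Or.inl rfl⟩
    · exact ⟨b, hb, hab, Or.inr rfl⟩

theorem touchingEdges_mono (G : SimpleGraph V) [G.LocallyFinite] {Λ Λ' : Finset V}
    (h : Λ ⊆ Λ') : touchingEdges G Λ ⊆ touchingEdges G Λ' :=
  Finset.biUnion_subset_biUnion_of_subset_left _ h

theorem edge_mul_congr {V : Type*} {σ τ : V → Bool} {a b : V} (ha : σ a = τ a) (hb : σ b = τ b) :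
    (s(a, b).map fun i => spin (σ i)).mul = (s(a, b).map fun i => spin (τ i)).mul := by
  simp [Sym2.mul_mk, ha, hb]

/-- The part of the interaction in `Λ` that does not involve the spins in `Λ₁`. -/
def hamRest (G : SimpleGraph V) [G.LocallyFinite] (K : Sym2 V → ℝ) (h : V → ℝ) (Λ Λ₁ : Finset V)
    (σ : V → Bool) : ℝ :=
  ∑ e ∈ touchingEdges G Λ \ touchingEdges G Λ₁, K e * (e.map fun i => spin (σ i)).mul
    + ∑ i ∈ Λ \ Λ₁, h i * spin (σ i)

theorem ham_eq_add_hamRest (G : SimpleGraph V) [G.LocallyFinite] (K : Sym2 V → ℝ) (h : V → ℝ)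
    {Λ Λ₁ : Finset V} (hΛ : Λ₁ ⊆ Λ) (σ : V → Bool) :
    ham G K h Λ σ = ham G K h Λ₁ σ + hamRest G K h Λ Λ₁ σ := by
  unfold ham hamRest
  rw [← Finset.sum_sdiff (touchingEdges_mono G hΛ), ← Finset.sum_sdiff hΛ]
  ring

theorem hamRest_congr (G : SimpleGraph V) [G.LocallyFinite] (K : Sym2 V → ℝ) (h : V → ℝ)
    {Λ Λ₁ : Finset V} {σ τ : V → Bool} (hστ : ∀ i ∉ Λ₁, σ i = τ i) :
    hamRest G K h Λ Λ₁ σ = hamRest G K h Λ Λ₁ τ := by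
  unfold hamRest
  congr 1
  · refine Finset.sum_congr rfl fun e he => ?_
    induction e with | _ a b
    simp only [Finset.mem_sdiff, mem_touchingEdges] at he
    rw [edge_mul_congr (hστ a fun h => he.2 ⟨he.1.1, Or.inl h⟩)
      (hστ b fun h => he.2 ⟨he.1.1, Or.inr h⟩)]
  · refine Finset.sum_congr rfl fun i hi => ?_
    rw [hστ i (Finset.mem_sdiff.1 hi).2]

/-! ### Elementary properties of the expectation -/

section Basic

variable (G : SimpleGraph V) [G.LocallyFinite] (K : Sym2 V → ℝ) (h : V → ℝ) (Λ : Finset V)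
  (η : V → Bool)

theorem zfun_pos : 0 < zfun G K h Λ η :=
  Finset.sum_pos (fun _ _ => by positivity) Finset.univ_nonempty

theorem zfun_eq_sum : zfun G K h Λ η = ∑ ω : Λ → Bool, Real.exp (ham G K h Λ (glue Λ η ω)) := by
  simp [zfun, wsum]

theorem wsum_add (F F' : (V → Bool) → ℝ) :
    wsum G K h Λ η (fun σ => F σ + F' σ) = wsum G K h Λ η F + wsum G K h Λ η F' := by
  simp [wsum, add_mul, Finset.sum_add_distrib]

theorem wsum_const_mul (c : ℝ) (F : (V → Bool) → ℝ) :
    wsum G K h Λ η (fun σ => c * F σ) = c * wsum G K h Λ η F := by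
  simp [wsum, mul_assoc, Finset.mul_sum]

theorem wsum_le {F F' : (V → Bool) → ℝ} (hF : ∀ σ, F σ ≤ F' σ) :
    wsum G K h Λ η F ≤ wsum G K h Λ η F' :=
  Finset.sum_le_sum fun _ _ => mul_le_mul_of_nonneg_right (hF _) (Real.exp_pos _).le

theorem gibbs_add (F F' : (V → Bool) → ℝ) :
    gibbs G K h Λ η (fun σ => F σ + F' σ) = gibbs G K h Λ η F + gibbs G K h Λ η F' := by
  simp [gibbs, wsum_add, add_div]

theorem gibbs_const_mul (c : ℝ) (F : (V → Bool) → ℝ) :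
    gibbs G K h Λ η (fun σ => c * F σ) = c * gibbs G K h Λ η F := by
  simp [gibbs, wsum_const_mul, mul_div_assoc]

theorem gibbs_neg (F : (V → Bool) → ℝ) :
    gibbs G K h Λ η (fun σ => -F σ) = -gibbs G K h Λ η F := by
  simpa using gibbs_const_mul G K h Λ η (-1) F

theorem gibbs_sub (F F' : (V → Bool) → ℝ) :
    gibbs G K h Λ η (fun σ => F σ - F' σ) = gibbs G K h Λ η F - gibbs G K h Λ η F' := by
  simp only [sub_eq_add_neg, gibbs_add, gibbs_neg]

theorem gibbs_const (c : ℝ) : gibbs G K h Λ η (fun _ => c) = c := by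
  have h1 : gibbs G K h Λ η (fun _ => 1) = 1 := div_self (zfun_pos G K h Λ η).ne'
  simpa [h1] using gibbs_const_mul G K h Λ η c fun _ => 1

theorem gibbs_sum {ι : Type*} (s : Finset ι) (F : ι → (V → Bool) → ℝ) :
    gibbs G K h Λ η (fun σ => ∑ i ∈ s, F i σ) = ∑ i ∈ s, gibbs G K h Λ η (F i) := by
  classical
  induction s using Finset.induction_on with
  | empty => simpa using gibbs_const G K h Λ η 0
  | insert a s ha ih => simp only [Finset.sum_insert ha, gibbs_add, ih]

theorem gibbs_mono {F F' : (V → Bool) → ℝ} (hF : ∀ σ, F σ ≤ F' σ) :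
    gibbs G K h Λ η F ≤ gibbs G K h Λ η F' :=
  div_le_div_of_nonneg_right (wsum_le G K h Λ η hF) (zfun_pos G K h Λ η).le

theorem abs_gibbs_le {F : (V → Bool) → ℝ} {C : ℝ} (hF : ∀ σ, |F σ| ≤ C) :
    |gibbs G K h Λ η F| ≤ C := by
  rw [abs_le]
  constructor
  · simpa [gibbs_const] using gibbs_mono G K h Λ η (F := fun _ => -C) fun σ => (abs_le.1 (hF σ)).1
  · simpa [gibbs_const] using gibbs_mono G K h Λ η (F' := fun _ => C) fun σ => (abs_le.1 (hF σ)).2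

variable {G K h Λ η}

theorem wsum_congr {F F' : (V → Bool) → ℝ}
    (hF : ∀ σ : V → Bool, (∀ i ∉ Λ, σ i = η i) → F σ = F' σ) :
    wsum G K h Λ η F = wsum G K h Λ η F' :=
  Finset.sum_congr rfl fun ω _ => by rw [hF _ fun i hi => glue_notMem hi η ω]

end Basic

/-! ### Decomposition of a volume -/

theorem sum_glue_split {Λ Λ₁ : Finset V} (hΛ : Λ₁ ⊆ Λ) (η : V → Bool) (F : (V → Bool) → ℝ) :
    ∑ ω : Λ → Bool, F (glue Λ η ω)
      = ∑ ω₂ : ↥(Λ \ Λ₁) → Bool, ∑ ω₁ : Λ₁ → Bool, F (glue Λ₁ (glue (Λ \ Λ₁) η ω₂) ω₁) := by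
  rw [← Fintype.sum_prod_type']
  symm
  have key : ∀ (ω₂ : ↥(Λ \ Λ₁) → Bool) (ω₁ : Λ₁ → Bool),
      glue Λ η (fun i : Λ => glue Λ₁ (glue (Λ \ Λ₁) η ω₂) ω₁ i)
        = glue Λ₁ (glue (Λ \ Λ₁) η ω₂) ω₁ := fun ω₂ ω₁ =>
    glue_restrict fun i hi => by
      rw [glue_notMem fun h => hi (hΛ h), glue_notMem fun h => hi (Finset.mem_sdiff.1 h).1]
  refine Finset.sum_bij'
    (fun p _ => fun i : Λ => glue Λ₁ (glue (Λ \ Λ₁) η p.1) p.2 i)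
    (fun ω _ => (fun i => glue Λ η ω i, fun i => glue Λ η ω i))
    (fun _ _ => Finset.mem_univ _) (fun _ _ => Finset.mem_univ _) ?_ ?_ ?_
  · rintro ⟨ω₂, ω₁⟩ -
    simp only [key]
    refine Prod.ext (funext fun i => ?_) (funext fun i => ?_)
    · have := Finset.mem_sdiff.1 i.2
      simp only
      rw [glue_notMem this.2, glue_mem i.2]
    · simp only
      rw [glue_mem i.2]
  · intro ω _
    ext i
    by_cases hi : (i : V) ∈ Λ₁ <;> simp [glue, hi]
  · rintro ⟨ω₂, ω₁⟩ -
    simp only [key]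

section Split

variable (G : SimpleGraph V) [G.LocallyFinite] (K : Sym2 V → ℝ) (h : V → ℝ) {Λ Λ₁ : Finset V}

theorem wsum_split (hΛ : Λ₁ ⊆ Λ) (η : V → Bool) (F : (V → Bool) → ℝ) :
    wsum G K h Λ η F = ∑ ω₂ : ↥(Λ \ Λ₁) → Bool,
      Real.exp (hamRest G K h Λ Λ₁ (glue (Λ \ Λ₁) η ω₂))
        * wsum G K h Λ₁ (glue (Λ \ Λ₁) η ω₂) F := by
  unfold wsum
  rw [sum_glue_split hΛ η fun σ => F σ * Real.exp (ham G K h Λ σ)]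
  refine Finset.sum_congr rfl fun ω₂ _ => ?_
  rw [Finset.mul_sum]
  refine Finset.sum_congr rfl fun ω₁ _ => ?_
  rw [ham_eq_add_hamRest G K h hΛ, Real.exp_add,
    hamRest_congr G K h fun i hi => glue_notMem hi (glue (Λ \ Λ₁) η ω₂) ω₁]
  ring

theorem gibbs_bc_congr (Λ : Finset V) {η η' : V → Bool} (hη : ∀ i ∉ Λ, η i = η' i)
    (F : (V → Bool) → ℝ) : gibbs G K h Λ η F = gibbs G K h Λ η' F := by
  simp only [gibbs, zfun, wsum, glue_congr hη]

/-- Consistency of the finite-volume expectations. -/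
theorem gibbs_gibbs (hΛ : Λ₁ ⊆ Λ) (η : V → Bool) (F : (V → Bool) → ℝ) :
    gibbs G K h Λ η (fun σ => gibbs G K h Λ₁ σ F) = gibbs G K h Λ η F := by
  unfold gibbs
  congr 1
  rw [wsum_split G K h hΛ, wsum_split G K h hΛ η F]
  refine Finset.sum_congr rfl fun ω₂ _ => ?_
  congr 1
  set ξ := glue (Λ \ Λ₁) η ω₂
  -- Once the spins outside `Λ₁` are fixed to `ξ`, the inner expectation is a constant, and
  -- multiplying it by the partition function restores the unnormalised sum.
  rw [wsum_congr (F' := fun _ => wsum G K h Λ₁ ξ F / zfun G K h Λ₁ ξ * 1)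
    fun σ hσ => by rw [mul_one]; exact gibbs_bc_congr G K h Λ₁ hσ F]
  rw [wsum_const_mul]
  exact div_mul_cancel₀ _ (zfun_pos G K h Λ₁ ξ).ne'

/-- Conditioning on a configuration `c` outside `Λ₁`. -/
theorem wsum_indicator (hΛ : Λ₁ ⊆ Λ) {η c : V → Bool} (hc : ∀ i ∉ Λ, c i = η i) :
    wsum G K h Λ η (fun σ => if ∀ i ∈ Λ \ Λ₁, σ i = c i then 1 else 0)
      = Real.exp (hamRest G K h Λ Λ₁ c) * zfun G K h Λ₁ c := by
  classical
  rw [wsum_split G K h hΛ, Finset.sum_eq_single (fun i : ↥(Λ \ Λ₁) => c i)]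
  · have hsplit : ∀ i ∉ Λ₁, glue (Λ \ Λ₁) η (fun i : ↥(Λ \ Λ₁) => c i) i = c i := by
      intro i hi
      by_cases hi' : i ∈ Λ \ Λ₁
      · rw [glue_mem hi']
      · rw [glue_notMem hi', hc i fun h => hi' (Finset.mem_sdiff.2 ⟨h, hi⟩)]
    rw [hamRest_congr G K h hsplit]
    congr 1
    simp only [wsum, zfun, glue_congr hsplit]
    refine Finset.sum_congr rfl fun ω _ => ?_
    rw [if_pos]
    intro i hi
    rw [glue_notMem (Finset.mem_sdiff.1 hi).2]
  · intro ω₂ _ hne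
    refine mul_eq_zero_of_right _ (Finset.sum_eq_zero fun ω _ => ?_)
    beta_reduce
    rw [if_neg, zero_mul]
    intro hall
    refine hne (funext fun i => ?_)
    have := hall i i.2
    rw [glue_notMem (Finset.mem_sdiff.1 i.2).2, glue_mem i.2] at this
    exact this
  · simp

/-- The partition function factorises over two volumes that do not interact. -/
theorem zfun_union {Λ₁ Λ₂ : Finset V} (hd : Disjoint Λ₁ Λ₂)
    (hK : ∀ a ∈ Λ₁, ∀ b ∈ Λ₂, K s(a, b) = 0) (η : V → Bool) :
    zfun G K h (Λ₁ ∪ Λ₂) η = zfun G K h Λ₁ η * zfun G K h Λ₂ η := by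
  have hsd : (Λ₁ ∪ Λ₂) \ Λ₁ = Λ₂ := by
    rw [Finset.union_sdiff_left, Finset.sdiff_eq_self_of_disjoint hd.symm]
  -- Every edge joining the two volumes has zero coupling, so the spins in `Λ₂` are invisible from
  -- `Λ₁`.
  have hz : ∀ ω₂ : Λ₂ → Bool, zfun G K h Λ₁ (glue Λ₂ η ω₂) = zfun G K h Λ₁ η := by
    intro ω₂
    simp only [zfun_eq_sum]
    refine Finset.sum_congr rfl fun ω _ => ?_
    have hval : ∀ i ∉ Λ₂, glue Λ₁ (glue Λ₂ η ω₂) ω i = glue Λ₁ η ω i := by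
      intro i hi
      by_cases h1 : i ∈ Λ₁
      · rw [glue_mem h1, glue_mem h1]
      · rw [glue_notMem h1, glue_notMem h1, glue_notMem hi]
    congr 1
    unfold ham
    congr 1
    · refine Finset.sum_congr rfl fun e he => ?_
      induction e with | _ a b
      rw [mem_touchingEdges] at he
      by_cases ha : a ∈ Λ₂
      · have hb : b ∈ Λ₁ := he.2.resolve_left fun h => (Finset.disjoint_left.1 hd h ha)
        rw [Sym2.eq_swap, hK b hb a ha]; simp
      · by_cases hb : b ∈ Λ₂
        · have ha : a ∈ Λ₁ := he.2.resolve_right fun h => (Finset.disjoint_left.1 hd h hb)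
          rw [hK a ha b hb]; simp
        · rw [edge_mul_congr (hval a ha) (hval b hb)]
    · refine Finset.sum_congr rfl fun i hi => ?_
      rw [hval i fun h => Finset.disjoint_left.1 hd hi h]
  have hr : ∀ σ, hamRest G K h (Λ₁ ∪ Λ₂) Λ₁ σ = ham G K h Λ₂ σ := by
    intro σ
    unfold hamRest ham
    rw [hsd]
    congr 1
    refine Finset.sum_subset (fun e he => ?_) fun e he hne => ?_
    · induction e with | _ a b
      simp only [Finset.mem_sdiff, mem_touchingEdges, Finset.mem_union] at he ⊢
      tauto
    · induction e with | _ a b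
      simp only [Finset.mem_sdiff, mem_touchingEdges, Finset.mem_union] at he hne
      have : K s(a, b) = 0 := by
        rcases he.2 with ha | hb
        · have : b ∈ Λ₁ := by
            by_contra hb
            exact hne ⟨⟨he.1, Or.inl (Or.inr ha)⟩,
              fun h => h.2.elim (fun h => Finset.disjoint_left.1 hd h ha) hb⟩
          rw [Sym2.eq_swap]; exact hK b this a ha
        · have : a ∈ Λ₁ := by
            by_contra ha
            exact hne ⟨⟨he.1, Or.inr (Or.inr hb)⟩,
              fun h => h.2.elim ha fun h => Finset.disjoint_left.1 hd h hb⟩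
          exact hK a this b hb
      rw [this, zero_mul]
  have h1 := wsum_split G K h (Finset.subset_union_left : Λ₁ ⊆ Λ₁ ∪ Λ₂) η fun _ => 1
  simp only [hr] at h1
  rw [hsd] at h1
  unfold zfun at hz ⊢
  rw [h1]
  simp only [hz]
  rw [mul_comm, ← Finset.sum_mul]
  simp [wsum]

end Split

/-! ### Spin flip -/

section Flip

variable (G : SimpleGraph V) [G.LocallyFinite] (K : Sym2 V → ℝ) (h : V → ℝ) (Λ : Finset V)

theorem ham_flip (σ : V → Bool) : ham G K h Λ (fun i => !σ i) = ham G K (fun i => -h i) Λ σ := by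
  unfold ham
  congr 1
  · refine Finset.sum_congr rfl fun e _ => ?_
    induction e with | _ a b
    simp [Sym2.mul_mk, spin_not]
  · simp [spin_not]

theorem wsum_flip (η : V → Bool) (F : (V → Bool) → ℝ) :
    wsum G K h Λ (fun i => !η i) F = wsum G K (fun i => -h i) Λ η fun σ => F fun i => !σ i := by
  unfold wsum
  refine Finset.sum_bij' (fun ω _ => fun i => !ω i) (fun ω _ => fun i => !ω i) (by simp) (by simp)
    (by simp) (by simp) fun ω _ => ?_
  have : glue Λ (fun i => !η i) ω = fun i => !glue Λ η (fun i => !ω i) i := by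
    ext i; by_cases hi : i ∈ Λ <;> simp [glue, hi]
  rw [this, ham_flip]

theorem zfun_flip (η : V → Bool) :
    zfun G K h Λ (fun i => !η i) = zfun G K (fun i => -h i) Λ η :=
  wsum_flip G K h Λ η _

theorem gibbs_flip (η : V → Bool) (F : (V → Bool) → ℝ) :
    gibbs G K h Λ (fun i => !η i) F = gibbs G K (fun i => -h i) Λ η fun σ => F fun i => !σ i := by
  unfold gibbs; rw [wsum_flip, zfun_flip]

end Flip

end Framework

/-! ### Holley's inequality and its consequences -/

section Holley

/-- This is the Ahlswede–Daykin four functions theorem for `f μ`, `ν`, `μ`, `f ν`: its pointwise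
hypothesis follows from Holley's condition and `f a ≤ f (a ⊔ b)`. -/
theorem sum_mul_sum_le_of_holley {α : Type*} [DistribLattice α] [Fintype α] {μ ν f : α → ℝ}
    (hμ : ∀ a, 0 ≤ μ a) (hν : ∀ a, 0 ≤ ν a) (hf₀ : ∀ a, 0 ≤ f a) (hf : Monotone f)
    (h : ∀ a b, μ a * ν b ≤ μ (a ⊓ b) * ν (a ⊔ b)) :
    (∑ a, f a * μ a) * ∑ a, ν a ≤ (∑ a, μ a) * ∑ a, f a * ν a := by
  refine four_functions_theorem_univ (fun a => f a * μ a) ν μ (fun a => f a * ν a)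
    (fun a => mul_nonneg (hf₀ a) (hμ a)) hν hμ (fun a => mul_nonneg (hf₀ a) (hν a)) fun a b => ?_
  calc f a * μ a * ν b = f a * (μ a * ν b) := by ring
    _ ≤ f (a ⊔ b) * (μ (a ⊓ b) * ν (a ⊔ b)) :=
        mul_le_mul (hf le_sup_left) (h a b) (mul_nonneg (hμ a) (hν b)) (hf₀ _)
    _ = μ (a ⊓ b) * (f (a ⊔ b) * ν (a ⊔ b)) := by ring

variable {V : Type*} [DecidableEq V]

theorem spin_mul_add_le (a b c d : Bool) :
    spin a * spin b + spin c * spin d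
      ≤ spin (a ⊓ c) * spin (b ⊓ d) + spin (a ⊔ c) * spin (b ⊔ d) := by
  cases a <;> cases b <;> cases c <;> cases d <;> norm_num [spin]

theorem mul_spin_add_le {x y : ℝ} (hxy : x ≤ y) (a b : Bool) :
    x * spin a + y * spin b ≤ x * spin (a ⊓ b) + y * spin (a ⊔ b) := by
  cases a <;> cases b <;> norm_num [spin]
  linarith

/-- Holley's condition in logarithmic form. Ferromagnetic pair terms are supermodular, and the
larger field is the one paired with the supremum. -/
theorem ham_add_le (G : SimpleGraph V) [G.LocallyFinite] {K : Sym2 V → ℝ} (hK : ∀ e, 0 ≤ K e)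
    {h h' : V → ℝ} {Λ : Finset V} (hh : ∀ i ∈ Λ, h i ≤ h' i) (σ τ : V → Bool) :
    ham G K h Λ σ + ham G K h' Λ τ ≤ ham G K h Λ (σ ⊓ τ) + ham G K h' Λ (σ ⊔ τ) := by
  have h1 : ∑ e ∈ touchingEdges G Λ, K e * (e.map fun i => spin (σ i)).mul
        + ∑ e ∈ touchingEdges G Λ, K e * (e.map fun i => spin (τ i)).mul
      ≤ ∑ e ∈ touchingEdges G Λ, K e * (e.map fun i => spin ((σ ⊓ τ) i)).mul
        + ∑ e ∈ touchingEdges G Λ, K e * (e.map fun i => spin ((σ ⊔ τ) i)).mul := by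
    rw [← Finset.sum_add_distrib, ← Finset.sum_add_distrib]
    refine Finset.sum_le_sum fun e _ => ?_
    rw [← mul_add, ← mul_add]
    refine mul_le_mul_of_nonneg_left ?_ (hK e)
    induction e with | _ a b
    exact spin_mul_add_le _ _ _ _
  have h2 : ∑ i ∈ Λ, h i * spin (σ i) + ∑ i ∈ Λ, h' i * spin (τ i)
      ≤ ∑ i ∈ Λ, h i * spin ((σ ⊓ τ) i) + ∑ i ∈ Λ, h' i * spin ((σ ⊔ τ) i) := by
    rw [← Finset.sum_add_distrib, ← Finset.sum_add_distrib]
    exact Finset.sum_le_sum fun i hi => mul_spin_add_le (hh i hi) _ _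
  unfold ham
  linarith

theorem glue_inf {Λ : Finset V} {η η' : V → Bool} (hη : ∀ i ∉ Λ, η i ≤ η' i) (a b : Λ → Bool) :
    glue Λ η (a ⊓ b) = glue Λ η a ⊓ glue Λ η' b := by
  ext i; by_cases hi : i ∈ Λ
  · simp [glue, hi]
  · simp only [glue, hi, dif_neg, Pi.inf_apply, not_false_eq_true]; rw [inf_eq_left.2 (hη i hi)]

theorem glue_sup {Λ : Finset V} {η η' : V → Bool} (hη : ∀ i ∉ Λ, η i ≤ η' i) (a b : Λ → Bool) :
    glue Λ η' (a ⊔ b) = glue Λ η a ⊔ glue Λ η' b := by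
  ext i; by_cases hi : i ∈ Λ
  · simp [glue, hi]
  · simp only [glue, hi, dif_neg, Pi.sup_apply, not_false_eq_true]; rw [sup_eq_right.2 (hη i hi)]

theorem glue_mono {Λ : Finset V} {η η' : V → Bool} (hη : ∀ i ∉ Λ, η i ≤ η' i) (ω : Λ → Bool) :
    glue Λ η ω ≤ glue Λ η' ω := by
  intro i; by_cases hi : i ∈ Λ
  · simp [glue, hi]
  · simpa [glue, hi] using hη i hi

theorem glue_mono_left {Λ : Finset V} (η : V → Bool) : Monotone (glue Λ η) := by
  intro ω ω' hω i; by_cases hi : i ∈ Λ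
  · simpa [glue, hi] using hω ⟨i, hi⟩
  · simp [glue, hi]

variable (G : SimpleGraph V) [G.LocallyFinite] {K : Sym2 V → ℝ} (hK : ∀ e, 0 ≤ K e)

include hK

/-- Expectations of increasing functions increase with the external field and with the
boundary condition. -/
theorem gibbs_le_gibbs {h h' : V → ℝ} {Λ : Finset V} (hh : ∀ i ∈ Λ, h i ≤ h' i)
    {η η' : V → Bool} (hη : ∀ i ∉ Λ, η i ≤ η' i) {F : (V → Bool) → ℝ} (hF : Monotone F) :
    gibbs G K h Λ η F ≤ gibbs G K h' Λ η' F := by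
  -- Subtracting the minimum `F ⊥` makes the function nonnegative, as the four functions theorem
  -- requires.
  suffices H : ∀ F' : (V → Bool) → ℝ, Monotone F' → (∀ σ, 0 ≤ F' σ) →
      gibbs G K h Λ η F' ≤ gibbs G K h' Λ η' F' by
    have := H (fun σ => F σ - F ⊥) (fun a b hab => sub_le_sub_right (hF hab) _)
      fun σ => sub_nonneg.2 (hF bot_le)
    simpa [gibbs_sub, gibbs_const] using this
  intro F' hF' hF₀
  unfold gibbs
  rw [div_le_div_iff₀ (zfun_pos G K h Λ η) (zfun_pos G K h' Λ η'), mul_comm (wsum G K h' Λ η' F')]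
  -- Evaluating `F'` at the boundary condition `η'` on both sides leaves a single increasing
  -- function on `Λ → Bool`.
  have h1 : wsum G K h Λ η F' ≤ ∑ ω : Λ → Bool, F' (glue Λ η' ω) *
      Real.exp (ham G K h Λ (glue Λ η ω)) :=
    Finset.sum_le_sum fun ω _ =>
      mul_le_mul_of_nonneg_right (hF' (glue_mono hη ω)) (Real.exp_pos _).le
  refine (mul_le_mul_of_nonneg_right h1 (zfun_pos G K h' Λ η').le).trans ?_
  rw [zfun_eq_sum, zfun_eq_sum]
  refine sum_mul_sum_le_of_holley (fun _ => (Real.exp_pos _).le) (fun _ => (Real.exp_pos _).le)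
    (fun _ => hF₀ _) (hF'.comp (glue_mono_left η')) fun a b => ?_
  rw [← Real.exp_add, ← Real.exp_add, Real.exp_le_exp, glue_inf hη, glue_sup hη]
  exact ham_add_le G hK hh _ _

/-- With `+` boundary condition, expectations of increasing functions decrease with the volume. -/
theorem gibbs_true_anti {h : V → ℝ} {Λ Λ' : Finset V} (hΛ : Λ ⊆ Λ') {F : (V → Bool) → ℝ}
    (hF : Monotone F) :
    gibbs G K h Λ' (fun _ => true) F ≤ gibbs G K h Λ (fun _ => true) F := by
  rw [← gibbs_gibbs G K h hΛ]
  refine (gibbs_mono _ _ _ _ _ fun σ => ?_).trans (gibbs_const _ _ _ _ _ _).le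
  exact gibbs_le_gibbs G hK (fun _ _ => le_rfl) (fun _ _ => Bool.le_true _) hF

end Holley

/-! ### Positivity of correlations of rotated replicas -/

section Positivity

variable {ι Ω : Type*} [Fintype ι] [Fintype Ω]

/-- All the sums of `F` against monomials in the variables `X i` are nonnegative. -/
def CorrPos (X : ι → Ω → ℝ) (F : Ω → ℝ) : Prop :=
  ∀ n : ι → ℕ, 0 ≤ ∑ ω, (∏ i, X i ω ^ n i) * F ω

/-- Multiplication by `g` preserves `CorrPos`. -/
def CorrPosMul (X : ι → Ω → ℝ) (g : Ω → ℝ) : Prop :=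
  ∀ F, CorrPos X F → CorrPos X fun ω => g ω * F ω

variable {X : ι → Ω → ℝ}

theorem CorrPosMul.var (i : ι) : CorrPosMul X (X i) := by
  classical
  intro F hF n
  have := hF (n + Pi.single i 1)
  refine this.trans_eq (Finset.sum_congr rfl fun ω _ => ?_)
  have h1 : ∏ j, X j ω ^ (Pi.single i 1 : ι → ℕ) j = X i ω := by
    rw [Finset.prod_eq_single i (fun j _ hj => by rw [Pi.single_eq_of_ne hj, pow_zero])
      fun h => absurd (Finset.mem_univ i) h, Pi.single_eq_same, pow_one]
  simp only [Pi.add_apply, pow_add, Finset.prod_mul_distrib]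
  rw [h1, mul_assoc]

theorem CorrPosMul.const {c : ℝ} (hc : 0 ≤ c) : CorrPosMul X fun _ => c := by
  intro F hF n
  have := mul_nonneg hc (hF n)
  rw [Finset.mul_sum] at this
  exact this.trans_eq (Finset.sum_congr rfl fun ω _ => by ring)

theorem CorrPosMul.add {g g' : Ω → ℝ} (hg : CorrPosMul X g) (hg' : CorrPosMul X g') :
    CorrPosMul X fun ω => g ω + g' ω := by
  intro F hF n
  have := add_nonneg (hg F hF n) (hg' F hF n)
  rw [← Finset.sum_add_distrib] at this
  exact this.trans_eq (Finset.sum_congr rfl fun ω _ => by ring)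

theorem CorrPosMul.mul {g g' : Ω → ℝ} (hg : CorrPosMul X g) (hg' : CorrPosMul X g') :
    CorrPosMul X fun ω => g ω * g' ω := by
  intro F hF
  simpa only [mul_assoc] using hg _ (hg' F hF)

theorem CorrPosMul.sum {κ : Type*} (s : Finset κ) {g : κ → Ω → ℝ}
    (hg : ∀ k ∈ s, CorrPosMul X (g k)) : CorrPosMul X fun ω => ∑ k ∈ s, g k ω := by
  classical
  induction s using Finset.induction_on with
  | empty => simpa using CorrPosMul.const (X := X) le_rfl
  | insert a s ha ih =>
    simp only [Finset.sum_insert ha]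
    exact (hg a (by simp)).add (ih fun k hk => hg k (by simp [hk]))

theorem CorrPosMul.pow {g : Ω → ℝ} (hg : CorrPosMul X g) (k : ℕ) :
    CorrPosMul X fun ω => g ω ^ k := by
  induction k with
  | zero => simpa using CorrPosMul.const (X := X) zero_le_one
  | succ k ih => simpa only [pow_succ] using ih.mul hg

/-- The Taylor polynomials of the exponential have nonnegative coefficients, and nonnegativity of
the finitely many sums survives the limit. -/
theorem CorrPosMul.exp {g : Ω → ℝ} (hg : CorrPosMul X g) :
    CorrPosMul X fun ω => Real.exp (g ω) := by
  intro F hF n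
  have hN : ∀ N : ℕ, 0 ≤ ∑ ω, (∏ i, X i ω ^ n i) *
      ((∑ k ∈ Finset.range N, ((k.factorial : ℝ)⁻¹ * g ω ^ k)) * F ω) := fun N =>
    CorrPosMul.sum (Finset.range N)
      (fun k _ => (CorrPosMul.const (by positivity)).mul (hg.pow k)) F hF n
  refine ge_of_tendsto' (x := atTop) ?_ hN
  refine tendsto_finsetSum _ fun ω _ => Tendsto.const_mul _ (Tendsto.mul_const _ ?_)
  have := (NormedSpace.expSeries_div_hasSum_exp (g ω)).tendsto_sum_nat
  rw [← Real.exp_eq_exp_ℝ] at this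
  simpa only [div_eq_inv_mul] using this

end Positivity

/-! ### Four rotated replicas and the Lebowitz inequality for the magnetisation gap -/

section Lebowitz

/-- An orthogonal change of variables in `ℝ⁴`. -/
def rot (s : Fin 4 → ℝ) : Fin 4 → ℝ :=
  ![(s 0 + s 1 + s 2 + s 3) / 2, (s 0 - s 1 + s 2 - s 3) / 2, (s 0 - s 1 - s 2 + s 3) / 2,
    (-s 0 - s 1 + s 2 + s 3) / 2]

theorem sum_mul_eq_sum_rot_mul_rot (s t : Fin 4 → ℝ) :
    ∑ r, s r * t r = ∑ a, rot s a * rot t a := by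
  simp only [rot, Fin.sum_univ_four, Matrix.cons_val]
  ring

/-- Quadruples of spins as a product. -/
def fourEquiv : (Fin 4 → Bool) ≃ Bool × Bool × Bool × Bool where
  toFun τ := (τ 0, τ 1, τ 2, τ 3)
  invFun p := ![p.1, p.2.1, p.2.2.1, p.2.2.2]
  left_inv τ := by ext i; fin_cases i <;> rfl
  right_inv p := rfl

theorem sum_fin_four_bool (f : (Fin 4 → Bool) → ℝ) :
    ∑ τ, f τ = ∑ a, ∑ b, ∑ c, ∑ d, f ![a, b, c, d] := by
  rw [← fourEquiv.symm.sum_comp]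
  simp only [Fintype.sum_prod_type]
  rfl

/-- The rotation sends the eight spin quadruples with an even number of minus signs to ±2 times the
basis vectors, and the other eight onto the sign vectors whose product is 1. Moments of the first
set are visibly nonnegative; those of the second are character sums over a group, hence 0 or 8. The
case split on parities checks this. -/
theorem single_site_moment_nonneg (n : Fin 4 → ℕ) :
    0 ≤ ∑ τ : Fin 4 → Bool, ∏ a, rot (fun r => spin (τ r)) a ^ n a := by
  rw [sum_fin_four_bool]
  simp only [Fintype.sum_bool, rot, spin,
    Fin.prod_univ_four, Matrix.cons_val]
  norm_num
  rcases Nat.even_or_odd (n 0) with h0 | h0 <;> rcases Nat.even_or_odd (n 1) with h1 | h1 <;>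
  rcases Nat.even_or_odd (n 2) with h2 | h2 <;> rcases Nat.even_or_odd (n 3) with h3 | h3 <;>
  · simp only [h0.neg_pow, h1.neg_pow, h2.neg_pow, h3.neg_pow, one_pow]
    have e0 : (0 : ℝ) ≤ 2 ^ n 0 := by positivity
    have e1 : (0 : ℝ) ≤ 2 ^ n 1 := by positivity
    have e2 : (0 : ℝ) ≤ 2 ^ n 2 := by positivity
    have e3 : (0 : ℝ) ≤ 2 ^ n 3 := by positivity
    have z0 : (0 : ℝ) ≤ 0 ^ n 0 := by positivity
    have z1 : (0 : ℝ) ≤ 0 ^ n 1 := by positivity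
    have z2 : (0 : ℝ) ≤ 0 ^ n 2 := by positivity
    have z3 : (0 : ℝ) ≤ 0 ^ n 3 := by positivity
    ring_nf
    positivity

variable {V : Type*} [DecidableEq V]

/-- Without interaction the sites are independent, so the sum is a product of single-site moments.
-/
theorem moment_nonneg (Λ : Finset V) :
    CorrPos (fun (p : Λ × Fin 4) (ω : Fin 4 → Λ → Bool) => rot (fun r => spin (ω r p.1)) p.2)
      fun _ => 1 := by
  intro n
  rw [← (Equiv.piComm fun (_ : Λ) (_ : Fin 4) => Bool).sum_comp]
  simp only [mul_one, Fintype.prod_prod_type, Equiv.piComm_apply, Function.swap]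
  have := Finset.prod_univ_sum (fun _ : Λ => (Finset.univ : Finset (Fin 4 → Bool)))
    fun i τ => ∏ a, rot (fun r => spin (τ r)) a ^ n (i, a)
  rw [Fintype.piFinset_univ] at this
  rw [← this]
  exact Finset.prod_nonneg fun i _ => single_site_moment_nonneg fun a => n (i, a)

/-- The boundary conditions of the four replicas. -/
def replicaBC : Fin 4 → Bool := ![true, false, true, false]

/-- Inside `Λ` a rotated spin is one of the variables. Outside it is an entry of the rotated
boundary vector (0, 2, 0, 0), whose nonnegativity is the reason for the choice of `replicaBC`. -/
theorem corrPosMul_rot_glue (Λ : Finset V) (j : V) (a : Fin 4) :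
    CorrPosMul (fun (p : Λ × Fin 4) (ω : Fin 4 → Λ → Bool) => rot (fun r => spin (ω r p.1)) p.2)
      fun ω => rot (fun r => spin (glue Λ (fun _ => replicaBC r) (ω r) j)) a := by
  by_cases hj : j ∈ Λ
  · simp only [glue_mem hj]
    exact CorrPosMul.var (X := fun (p : Λ × Fin 4) (ω : Fin 4 → Λ → Bool) =>
      rot (fun r => spin (ω r p.1)) p.2) ((⟨j, hj⟩, a) : Λ × Fin 4)
  · simp only [glue_notMem hj]
    refine CorrPosMul.const ?_
    fin_cases a <;> simp [rot, replicaBC, spin, Matrix.cons_val]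
    norm_num

theorem prod_wsum_eq {G : SimpleGraph V} [G.LocallyFinite] {K : Sym2 V → ℝ} {Λ : Finset V}
    (h : Fin 4 → V → ℝ) (η : Fin 4 → V → Bool) (F : Fin 4 → (V → Bool) → ℝ) :
    ∏ r, wsum G K (h r) Λ (η r) (F r) = ∑ ω : Fin 4 → Λ → Bool,
      (∏ r, F r (glue Λ (η r) (ω r))) * Real.exp (∑ r, ham G K (h r) Λ (glue Λ (η r) (ω r))) := by
  unfold wsum
  rw [Finset.prod_univ_sum, Fintype.piFinset_univ]
  refine Finset.sum_congr rfl fun ω _ => ?_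
  rw [Finset.prod_mul_distrib, Real.exp_sum]

/-- The difference of the magnetisations with `+` and `-` boundary condition is a nonincreasing
function of a nonnegative external field. -/
theorem magnetization_gap_anti (G : SimpleGraph V) [G.LocallyFinite] {K : Sym2 V → ℝ}
    (hK : ∀ e, 0 ≤ K e) {h h' : V → ℝ} {Λ : Finset V} (h0 : ∀ i ∈ Λ, 0 ≤ h i)
    (hh : ∀ i ∈ Λ, h i ≤ h' i) (i : V) :
    gibbs G K h' Λ (fun _ => true) (fun σ => spin (σ i))
        - gibbs G K h' Λ (fun _ => false) (fun σ => spin (σ i))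
      ≤ gibbs G K h Λ (fun _ => true) (fun σ => spin (σ i))
        - gibbs G K h Λ (fun _ => false) (fun σ => spin (σ i)) := by
  set H : Fin 4 → V → ℝ := ![h, h, h', h'] with hH
  set η : Fin 4 → V → Bool := fun r _ => replicaBC r with hη
  set X := fun (p : Λ × Fin 4) (ω : Fin 4 → Λ → Bool) => rot (fun r => spin (ω r p.1)) p.2
  set R : V → Fin 4 → (Fin 4 → Λ → Bool) → ℝ :=
    fun j a ω => rot (fun r => spin (glue Λ (η r) (ω r) j)) a with hR
  have hRpos : ∀ j a, CorrPosMul X (R j a) := corrPosMul_rot_glue Λ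
  -- Orthogonality keeps the pair interactions diagonal in the rotated spins. The fields become `h +
  -- h'` on component 0 and `h' - h` on component 3, both nonnegative; this is where `0 ≤ h ≤ h'`
  -- enters.
  have hham : CorrPosMul X fun ω => ∑ r, ham G K (H r) Λ (glue Λ (η r) (ω r)) := by
    have heq : (fun ω : Fin 4 → Λ → Bool => ∑ r, ham G K (H r) Λ (glue Λ (η r) (ω r)))
        = fun ω => ∑ e ∈ touchingEdges G Λ,
            K e * ∑ r, (e.map fun j => spin (glue Λ (η r) (ω r) j)).mul
          + ∑ j ∈ Λ, ((h j + h' j) * R j 0 ω + (h' j - h j) * R j 3 ω) := by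
      funext ω
      simp only [ham, Finset.sum_add_distrib (s := (Finset.univ : Finset (Fin 4)))]
      congr 1
      · rw [Finset.sum_comm]
        simp only [Finset.mul_sum]
      · rw [Finset.sum_comm]
        refine Finset.sum_congr rfl fun j _ => ?_
        simp only [hH, hR, rot, Fin.sum_univ_four, Matrix.cons_val]
        ring
    rw [heq]
    refine CorrPosMul.add (CorrPosMul.sum _ fun e _ => ?_) (CorrPosMul.sum _ fun j hj => ?_)
    · refine (CorrPosMul.const (hK e)).mul ?_
      induction e with | _ a b
      simp only [Sym2.map_mk, Sym2.mul_mk]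
      have : (fun ω : Fin 4 → Λ → Bool => ∑ r, spin (glue Λ (η r) (ω r) a) *
          spin (glue Λ (η r) (ω r) b)) = fun ω => ∑ c, R a c ω * R b c ω :=
        funext fun ω => sum_mul_eq_sum_rot_mul_rot _ _
      rw [this]
      exact CorrPosMul.sum _ fun c _ => (hRpos a c).mul (hRpos b c)
    · have h1 := h0 j hj
      have h2 := hh j hj
      exact ((CorrPosMul.const (by linarith)).mul (hRpos j 0)).add
        ((CorrPosMul.const (by linarith)).mul (hRpos j 3))
  -- Component 2 is half of (+ minus -) at field `h` minus (+ minus -) at field `h'`, so the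
  -- positivity of its unnormalised mean is the claim, after clearing the four partition functions.
  have hpos := (hRpos i 2).mul hham.exp _ (moment_nonneg Λ) 0
  simp only [Pi.zero_apply, pow_zero, Finset.prod_const_one, one_mul, mul_one] at hpos
  have hprod : ∀ r : Fin 4, ∑ ω : Fin 4 → Λ → Bool, spin (glue Λ (η r) (ω r) i) *
      Real.exp (∑ r, ham G K (H r) Λ (glue Λ (η r) (ω r)))
      = ∏ q, wsum G K (H q) Λ (η q) (if q = r then fun σ => spin (σ i) else fun _ => 1) := by
    intro r
    rw [prod_wsum_eq]
    refine Finset.sum_congr rfl fun ω _ => ?_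
    congr 1
    rw [Finset.prod_eq_single r (fun q _ hq => by simp [hq]) (by simp)]
    simp
  have hexp : ∑ ω, R i 2 ω * Real.exp (∑ r, ham G K (H r) Λ (glue Λ (η r) (ω r)))
      = ((∏ q, wsum G K (H q) Λ (η q) (if q = 0 then fun σ => spin (σ i) else fun _ => 1))
        - (∏ q, wsum G K (H q) Λ (η q) (if q = 1 then fun σ => spin (σ i) else fun _ => 1))
        - (∏ q, wsum G K (H q) Λ (η q) (if q = 2 then fun σ => spin (σ i) else fun _ => 1))
        + ∏ q, wsum G K (H q) Λ (η q) (if q = 3 then fun σ => spin (σ i) else fun _ => 1)) / 2 := by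
    simp only [← hprod]
    rw [← Finset.sum_sub_distrib, ← Finset.sum_sub_distrib, ← Finset.sum_add_distrib,
      Finset.sum_div]
    refine Finset.sum_congr rfl fun ω _ => ?_
    simp only [hR, rot, Matrix.cons_val]
    ring
  rw [hexp] at hpos
  simp only [Fin.prod_univ_four, hH, hη, replicaBC, Matrix.cons_val] at hpos
  simp only [Fin.isValue, Fin.reduceEq, reduceIte] at hpos
  simp only [gibbs]
  have p1 := zfun_pos G K h Λ fun _ => true
  have p2 := zfun_pos G K h Λ fun _ => false
  have p3 := zfun_pos G K h' Λ fun _ => true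
  have p4 := zfun_pos G K h' Λ fun _ => false
  unfold zfun at *
  rw [div_sub_div _ _ p3.ne' p4.ne', div_sub_div _ _ p1.ne' p2.ne',
    div_le_div_iff₀ (by positivity) (by positivity)]
  linarith

end Lebowitz

/-! ### Embeddings of graphs -/

section Embedding

variable {V V' : Type*} [DecidableEq V] [DecidableEq V'] {G : SimpleGraph V} [G.LocallyFinite]
  {G' : SimpleGraph V'} [G'.LocallyFinite] {φ : V ↪ V'}

-- Edges touching the image either come from edges of `G` or leave the range of `φ`. An edge of the
-- second kind has exactly one endpoint in the range, so summing over that endpoint counts it once.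
open Classical in
theorem sum_touchingEdges_map (hadj : ∀ a b, G'.Adj (φ a) (φ b) ↔ G.Adj a b) (Λ : Finset V)
    (f : Sym2 V' → ℝ) :
    ∑ e ∈ touchingEdges G' (Λ.map φ), f e = ∑ e ∈ touchingEdges G Λ, f (e.map φ)
      + ∑ i ∈ Λ, ∑ j ∈ G'.neighborFinset (φ i) with j ∉ Set.range φ, f s(φ i, j) := by
  have hmem : ∀ a, φ a ∈ Λ.map φ ↔ a ∈ Λ := fun a => Finset.mem_map' φ
  rw [← Finset.sum_filter_add_sum_filter_not (touchingEdges G' (Λ.map φ))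
    fun e => ∃ e₀ : Sym2 V, e₀.map φ = e]
  congr 1
  · symm
    refine Finset.sum_bij (fun e _ => e.map φ) (fun e he => ?_)
      (fun e _ e' _ h => Sym2.map.injective φ.injective h) (fun e he => ?_) fun _ _ => rfl
    · induction e with | _ a b
      rw [Finset.mem_filter]
      refine ⟨?_, _, rfl⟩
      rw [Sym2.map_mk, mem_touchingEdges, hadj, hmem, hmem]
      exact mem_touchingEdges.1 he
    · rw [Finset.mem_filter] at he
      obtain ⟨he, e₀, rfl⟩ := he
      refine ⟨e₀, ?_, rfl⟩
      induction e₀ with | _ a b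
      rw [Sym2.map_mk, mem_touchingEdges, hadj, hmem, hmem] at he
      exact mem_touchingEdges.2 he
  · rw [Finset.sum_sigma']
    symm
    refine Finset.sum_bij (fun p _ => s(φ p.1, p.2)) ?_ ?_ ?_ fun _ _ => rfl
    · rintro ⟨i, j⟩ hp
      simp only [Finset.mem_sigma, Finset.mem_filter, SimpleGraph.mem_neighborFinset] at hp ⊢
      refine ⟨mem_touchingEdges.2 ⟨hp.2.1, Or.inl ((hmem i).2 hp.1)⟩, ?_⟩
      rintro ⟨e₀, he₀⟩
      have : j ∈ Sym2.map φ e₀ := he₀ ▸ Sym2.mem_mk_right _ _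
      obtain ⟨a, -, ha⟩ := Sym2.mem_map.1 this
      exact hp.2.2 ⟨a, ha⟩
    · rintro ⟨i, j⟩ hp ⟨i', j'⟩ hp' h
      simp only [Finset.mem_sigma, Finset.mem_filter] at hp hp'
      rcases Sym2.eq_iff.1 h with ⟨h1, h2⟩ | ⟨h1, h2⟩
      · have h3 := φ.injective h1
        simp only at h2 h3
        subst h2 h3; rfl
      · exact absurd ⟨i, h1⟩ hp'.2.2
    · intro e he
      induction e with | _ a b
      rw [Finset.mem_filter, mem_touchingEdges] at he
      obtain ⟨⟨hab, h⟩, hne⟩ := he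
      have key : ∀ x y, G'.Adj x y → x ∈ Λ.map φ → (¬∃ e₀ : Sym2 V, e₀.map φ = s(x, y)) →
          ∃ p, ∃ _ : p ∈ Λ.sigma fun i => {j ∈ G'.neighborFinset (φ i) | j ∉ Set.range φ},
            s(φ p.1, p.2) = s(x, y) := by
        intro x y hxy hx hne
        obtain ⟨i, hi, rfl⟩ := Finset.mem_map.1 hx
        refine ⟨⟨i, y⟩, ?_, rfl⟩
        simp only [Finset.mem_sigma, Finset.mem_filter, SimpleGraph.mem_neighborFinset]
        refine ⟨hi, hxy, ?_⟩
        rintro ⟨b, rfl⟩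
        exact hne ⟨s(i, b), rfl⟩
      rcases h with ha | hb
      · exact key a b hab ha hne
      · obtain ⟨p, hp, h⟩ := key b a hab.symm hb (by rwa [Sym2.eq_swap])
        exact ⟨p, hp, by rw [h, Sym2.eq_swap]⟩

open Classical in
theorem ham_map (hadj : ∀ a b, G'.Adj (φ a) (φ b) ↔ G.Adj a b) {K : Sym2 V → ℝ}
    {K' : Sym2 V' → ℝ} (hK : ∀ e, K' (e.map φ) = K e) {h : V → ℝ} {h' : V' → ℝ} {Λ : Finset V}
    {σ : V' → Bool} (hh : ∀ i ∈ Λ, h i = h' (φ i)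
      + ∑ j ∈ G'.neighborFinset (φ i) with j ∉ Set.range φ, K' s(φ i, j) * spin (σ j)) :
    ham G' K' h' (Λ.map φ) σ = ham G K h Λ fun i => σ (φ i) := by
  unfold ham
  rw [sum_touchingEdges_map hadj, Finset.sum_map, add_assoc, ← Finset.sum_add_distrib]
  congr 1
  · refine Finset.sum_congr rfl fun e _ => ?_
    rw [hK, Sym2.map_map]; rfl
  · refine Finset.sum_congr rfl fun i hi => ?_
    rw [hh i hi, add_mul, Finset.sum_mul, add_comm]
    congr 1
    refine Finset.sum_congr rfl fun j _ => ?_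
    rw [Sym2.map_mk, Sym2.mul_mk]; ring

/-- Configurations in `Λ` correspond to configurations in the image of `Λ`. -/
def mapConfig (φ : V ↪ V') (Λ : Finset V) : (↥(Λ.map φ) → Bool) ≃ (Λ → Bool) :=
  Equiv.arrowCongr (Equiv.ofBijective
    (fun i : Λ => (⟨φ i, Finset.mem_map_of_mem φ i.2⟩ : ↥(Λ.map φ)))
    ⟨fun i j hij => Subtype.ext (φ.injective (Subtype.ext_iff.1 hij)), fun j => by
      obtain ⟨i, hi, hij⟩ := Finset.mem_map.1 j.2
      exact ⟨⟨i, hi⟩, Subtype.ext hij⟩⟩).symm (Equiv.refl _)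

theorem glue_mapConfig (φ : V ↪ V') (Λ : Finset V) (η : V' → Bool) (ω : ↥(Λ.map φ) → Bool) :
    glue Λ (fun i => η (φ i)) (mapConfig φ Λ ω) = fun i => glue (Λ.map φ) η ω (φ i) := by
  ext i
  by_cases hi : i ∈ Λ
  · rw [glue_mem hi, glue_mem (Finset.mem_map_of_mem φ hi)]; rfl
  · rw [glue_notMem hi, glue_notMem (by rwa [Finset.mem_map'])]

open Classical in
/-- Embedding a model into a larger graph: the spins outside the image act as an external
field. -/
theorem wsum_map (hadj : ∀ a b, G'.Adj (φ a) (φ b) ↔ G.Adj a b) {K : Sym2 V → ℝ}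
    {K' : Sym2 V' → ℝ} (hK : ∀ e, K' (e.map φ) = K e) {h : V → ℝ} {h' : V' → ℝ} {Λ : Finset V}
    {η : V' → Bool} (hh : ∀ i ∈ Λ, h i = h' (φ i)
      + ∑ j ∈ G'.neighborFinset (φ i) with j ∉ Set.range φ, K' s(φ i, j) * spin (η j))
    (F : (V → Bool) → ℝ) :
    wsum G' K' h' (Λ.map φ) η (fun σ => F fun i => σ (φ i)) = wsum G K h Λ (fun i => η (φ i)) F := by
  unfold wsum
  refine Fintype.sum_equiv (mapConfig φ Λ) _ _ fun ω => ?_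
  rw [glue_mapConfig, ham_map hadj hK]
  intro i hi
  rw [hh i hi]
  congr 1
  refine Finset.sum_congr rfl fun j hj => ?_
  rw [glue_notMem]
  intro hj'
  obtain ⟨a, -, rfl⟩ := Finset.mem_map.1 hj'
  exact (Finset.mem_filter.1 hj).2 ⟨a, rfl⟩

theorem gibbs_map_equiv {θ : V ≃ V} (hadj : ∀ a b, G.Adj (θ a) (θ b) ↔ G.Adj a b)
    {K : Sym2 V → ℝ} (hK : ∀ e, K (e.map θ) = K e) {h : V → ℝ} (hh : ∀ i, h (θ i) = h i)
    (Λ : Finset V) (η : V → Bool) (F : (V → Bool) → ℝ) :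
    gibbs G K h (Λ.map θ.toEmbedding) η (fun σ => F fun i => σ (θ i))
      = gibbs G K h Λ (fun i => η (θ i)) F := by
  classical
  have H : ∀ F : (V → Bool) → ℝ, wsum G K h (Λ.map θ.toEmbedding) η (fun σ => F fun i => σ (θ i))
      = wsum G K h Λ (fun i => η (θ i)) F := fun F => by
    refine wsum_map (φ := θ.toEmbedding) hadj hK (fun i _ => ?_) F
    rw [Finset.filter_false_of_mem fun j _ => by simp]
    simp [hh]
  unfold gibbs
  rw [H F]
  congr 1
  exact H fun _ => 1

end Embedding

/-! ### Averages over large cubes -/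

section Averages

variable {d : ℕ}

theorem mem_base {n : ℕ} {x : Fin (d - 1) → ℤ} :
    x ∈ base d n ↔ ∀ j, -(n : ℤ) ≤ x j ∧ x j ≤ n := by
  simp only [base, Finset.mem_Icc, Pi.le_def, forall_and]

theorem zero_mem_base (n : ℕ) : (0 : Fin (d - 1) → ℤ) ∈ base d n :=
  mem_base.2 fun j => by simp

theorem base_mono {m n : ℕ} (h : m ≤ n) : base d m ⊆ base d n := fun x hx =>
  mem_base.2 fun j => by have := mem_base.1 hx j; omega

theorem card_base (n : ℕ) : (base d n).card = (2 * n + 1) ^ (d - 1) := by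
  have : ((n : ℤ) + 1 - -(n : ℤ)).toNat = 2 * n + 1 := by omega
  rw [base, Pi.card_Icc]
  simp only [Int.card_Icc, this, Finset.prod_const, Finset.card_univ, Fintype.card_fin]

theorem card_base_pos (n : ℕ) : (0 : ℝ) < (base d n).card :=
  Nat.cast_pos.2 (Finset.card_pos.2 ⟨0, zero_mem_base n⟩)

theorem tendsto_card_base_div (j : ℕ) :
    Tendsto (fun n => ((base d (n - j)).card : ℝ) / (base d n).card) atTop (𝓝 1) := by
  have h1 : Tendsto (fun n : ℕ => (1 - 2 * j / (2 * n + 1 : ℝ)) ^ (d - 1)) atTop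
      (𝓝 ((1 - 0) ^ (d - 1))) := by
    refine Tendsto.pow (Tendsto.sub tendsto_const_nhds (Tendsto.div_atTop tendsto_const_nhds ?_)) _
    exact tendsto_atTop_add_const_right _ _
      (tendsto_natCast_atTop_atTop.const_mul_atTop (by norm_num))
  rw [sub_zero, one_pow] at h1
  refine h1.congr' ?_
  filter_upwards [eventually_ge_atTop j] with n hn
  rw [card_base, card_base]
  push_cast [Nat.cast_sub hn]
  rw [← div_pow]
  congr 1
  field_simp
  ring

/-- Convergence of `a n x` to `m` away from the boundary of the cube `[-n, n]^{d-1}`. -/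
def BulkTendsto (d : ℕ) (a : ℕ → (Fin (d - 1) → ℤ) → ℝ) (m : ℝ) : Prop :=
  ∀ ε > 0, ∃ j : ℕ, ∀ n ≥ j, ∀ x ∈ base d (n - j), |a n x - m| ≤ ε

theorem BulkTendsto.tendsto {a : ℕ → (Fin (d - 1) → ℤ) → ℝ} {m : ℝ} (h : BulkTendsto d a m)
    (x : Fin (d - 1) → ℤ) : Tendsto (fun n => a n x) atTop (𝓝 m) := by
  rw [Metric.tendsto_atTop]
  intro ε hε
  obtain ⟨j, hj⟩ := h (ε / 2) (half_pos hε)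
  obtain ⟨k, hk⟩ : ∃ k : ℕ, x ∈ base d k := by
    refine ⟨∑ i, (x i).natAbs, mem_base.2 fun i => ?_⟩
    have := Finset.single_le_sum (f := fun i => (x i).natAbs) (fun _ _ => Nat.zero_le _)
      (Finset.mem_univ i)
    omega
  refine ⟨j + k, fun n hn => ?_⟩
  rw [Real.dist_eq]
  exact (hj n (by omega) x (base_mono (by omega) hk)).trans_lt (half_lt_self hε)

theorem BulkTendsto.sub {a a' : ℕ → (Fin (d - 1) → ℤ) → ℝ} {m m' : ℝ} (h : BulkTendsto d a m)
    (h' : BulkTendsto d a' m') : BulkTendsto d (fun n x => a n x - a' n x) (m - m') := by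
  intro ε hε
  obtain ⟨j, hj⟩ := h (ε / 2) (half_pos hε)
  obtain ⟨j', hj'⟩ := h' (ε / 2) (half_pos hε)
  refine ⟨max j j', fun n hn x hx => ?_⟩
  have h1 := hj n (le_trans (le_max_left _ _) hn) x (base_mono (by omega) hx)
  have h2 := hj' n (le_trans (le_max_right _ _) hn) x (base_mono (by omega) hx)
  rw [abs_le] at *
  constructor <;> linarith

/-- The sites within distance `j` of the lateral boundary form a vanishing fraction of the cube, and
on them the bound `C` suffices. -/
theorem BulkTendsto.tendsto_average {a : ℕ → (Fin (d - 1) → ℤ) → ℝ} {m C : ℝ}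
    (h : BulkTendsto d a m) (hC : ∀ n, ∀ x ∈ base d n, |a n x| ≤ C) :
    Tendsto (fun n => (∑ x ∈ base d n, a n x) / (base d n).card) atTop (𝓝 m) := by
  rw [Metric.tendsto_atTop']
  intro ε hε
  obtain ⟨j, hj⟩ := h (ε / 2) (half_pos hε)
  have hC0 : 0 ≤ C := (abs_nonneg _).trans (hC 0 0 (zero_mem_base 0))
  have hlim : Tendsto (fun n => (C + |m|) * (1 - ((base d (n - j)).card : ℝ) / (base d n).card))
      atTop (𝓝 0) := by
    simpa using ((tendsto_card_base_div j).const_sub 1).const_mul (C + |m|)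
  obtain ⟨N, hN⟩ := eventually_atTop.1 (hlim.eventually (gt_mem_nhds (half_pos hε)))
  refine ⟨max N j, fun n hn => ?_⟩
  have hsub : base d (n - j) ⊆ base d n := base_mono (Nat.sub_le _ _)
  have hpos := card_base_pos (d := d) n
  have hle : |∑ x ∈ base d n, (a n x - m)|
      ≤ ((base d n).card : ℝ) * (ε / 2)
        + (((base d n).card : ℝ) - (base d (n - j)).card) * (C + |m|) := by
    refine (Finset.abs_sum_le_sum_abs _ _).trans ?_
    rw [← Finset.sum_sdiff hsub, add_comm]
    refine add_le_add ?_ ?_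
    · refine (Finset.sum_le_card_nsmul _ _ (ε / 2) fun x hx => hj n (by omega) x hx).trans ?_
      rw [nsmul_eq_mul]
      exact mul_le_mul_of_nonneg_right (by exact_mod_cast Finset.card_le_card hsub) (half_pos hε).le
    · refine (Finset.sum_le_card_nsmul _ _ (C + |m|) fun x hx => ?_).trans ?_
      · have := hC n x (Finset.mem_sdiff.1 hx).1
        exact (abs_sub _ _).trans (by linarith)
      · rw [nsmul_eq_mul, Finset.card_sdiff_of_subset hsub, Nat.cast_sub (Finset.card_le_card hsub)]
  rw [Real.dist_eq]
  have heq : (∑ x ∈ base d n, a n x) / ((base d n).card : ℝ) - m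
      = (∑ x ∈ base d n, (a n x - m)) / (base d n).card := by
    rw [Finset.sum_sub_distrib, Finset.sum_const, nsmul_eq_mul]
    field_simp
  rw [heq, abs_div, abs_of_pos hpos, div_lt_iff₀ hpos]
  have hNn := hN n (by omega)
  have : (((base d n).card : ℝ) - (base d (n - j)).card) * (C + |m|)
      = ((C + |m|) * (1 - ((base d (n - j)).card : ℝ) / (base d n).card)) * (base d n).card := by
    field_simp
  rw [this] at hle
  have := mul_lt_mul_of_pos_right hNn hpos
  linarith

end Averages

/-! ### Local functions -/

section Local

variable {V : Type*} [DecidableEq V]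

theorem exists_abs_le_of_dependsOn {F : (V → Bool) → ℝ} {A : Finset V}
    (hF : DependsOn F (A : Set V)) : ∃ C : ℝ, ∀ σ, |F σ| ≤ C := by
  refine ⟨∑ ω : A → Bool, |F (glue A (fun _ => true) ω)|, fun σ => ?_⟩
  have h1 : F σ = F (glue A (fun _ => true) fun i : A => σ i) :=
    hF fun i hi => (glue_mem (Finset.mem_coe.1 hi) _ fun i : A => σ i).symm
  rw [h1]
  exact Finset.single_le_sum (f := fun ω : A → Bool => |F (glue A (fun _ => true) ω)|)
    (fun _ _ => abs_nonneg _) (Finset.mem_univ _)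

/-- With `C` a bound for `|F|`, raising spins changes `F` by at most `2 C`, and only if some spin of
`A` flips, in which case the sum of the spins grows by at least 2. Thus statements on increasing
functions extend to local ones by differences. -/
theorem exists_monotone_add_sub {F : (V → Bool) → ℝ} {A : Finset V}
    (hF : DependsOn F (A : Set V)) : ∃ c : ℝ, 0 ≤ c ∧
      (Monotone fun σ : V → Bool => c * ∑ i ∈ A, spin (σ i) + F σ) ∧
      Monotone fun σ : V → Bool => c * ∑ i ∈ A, spin (σ i) - F σ := by
  obtain ⟨C, hC⟩ := exists_abs_le_of_dependsOn hF
  have hC0 : 0 ≤ C := (abs_nonneg _).trans (hC fun _ => true)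
  have key : ∀ σ τ : V → Bool, σ ≤ τ →
      |F τ - F σ| ≤ C * ∑ i ∈ A, spin (τ i) - C * ∑ i ∈ A, spin (σ i) := by
    intro σ τ hστ
    rw [← mul_sub, ← Finset.sum_sub_distrib]
    have hnn : ∀ i ∈ A, 0 ≤ spin (τ i) - spin (σ i) := fun i _ => sub_nonneg.2 (spin_mono (hστ i))
    by_cases heq : ∀ i ∈ A, σ i = τ i
    · rw [hF (x := σ) (y := τ) heq, sub_self, abs_zero]
      exact mul_nonneg hC0 (Finset.sum_nonneg hnn)
    · push Not at heq
      obtain ⟨i, hi, hne⟩ := heq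
      have h2 : spin (τ i) - spin (σ i) = 2 := by
        have := hστ i
        revert hne this
        cases σ i <;> cases τ i <;> simp [spin]
        norm_num
      have h3 := Finset.single_le_sum hnn hi
      have h4 := abs_sub (F τ) (F σ)
      have h5 := hC σ
      have h6 := hC τ
      nlinarith
  refine ⟨C, hC0, fun σ τ hστ => ?_, fun σ τ hστ => ?_⟩
  · have := abs_le.1 (key σ τ hστ)
    simp only; linarith
  · have := abs_le.1 (key σ τ hστ)
    simp only; linarith

theorem dependsOn_flip {F : (V → Bool) → ℝ} {A : Set V} (hF : DependsOn F A) :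
    DependsOn (fun σ : V → Bool => F fun i => !σ i) A := fun σ τ hστ =>
  hF fun i hi => by rw [hστ i hi]

end Local

/-! ### Models with horizontal translation invariance -/

section Bulk

variable {V : Type*} [DecidableEq V] {d : ℕ}

/-- Horizontal translations `θ` act on the model with couplings `K` and field `h`, compatibly
with the volumes `B n`. -/
structure HorizontalAction (d : ℕ) (G : SimpleGraph V) (K : Sym2 V → ℝ) (h : V → ℝ)
    (B : ℕ → Finset V) (θ : (Fin (d - 1) → ℤ) → V ≃ V) : Prop where
  adj : ∀ x a b, G.Adj (θ x a) (θ x b) ↔ G.Adj a b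
  coupling : ∀ x e, K (e.map (θ x)) = K e
  field : ∀ x i, h (θ x i) = h i
  zero : ∀ i, θ 0 i = i
  inner : ∀ j n x, j ≤ n → x ∈ base d (n - j) → (B j).map (θ x).toEmbedding ⊆ B n
  outer : ∀ m n x, x ∈ base d m → B n ⊆ (B (n + m)).map (θ x).toEmbedding

variable {G : SimpleGraph V} [G.LocallyFinite] {K : Sym2 V → ℝ} {h : V → ℝ}
  {B : ℕ → Finset V} {θ : (Fin (d - 1) → ℤ) → V ≃ V}

theorem HorizontalAction.mono (H : HorizontalAction d G K h B θ) {j n : ℕ} (hjn : j ≤ n) :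
    B j ⊆ B n := by
  intro i hi
  exact H.inner j n 0 hjn (zero_mem_base _)
    (Finset.mem_map.2 ⟨i, hi, H.zero i⟩)

theorem HorizontalAction.neg (H : HorizontalAction d G K h B θ) :
    HorizontalAction d G K (fun i => -h i) B θ :=
  { H with field := fun x i => by rw [H.field] }

/-- With + boundary condition the expectations decrease with the volume. For `x` in the bulk, `B n`
lies between the translates by `x` of `B j` and of a larger box, and both give values within `ε`
above the infimum of the centred sequence; the bound is uniform in `x`. -/
theorem HorizontalAction.exists_bulk_true_of_monotone (H : HorizontalAction d G K h B θ)
    (hK : ∀ e, 0 ≤ K e) {F : (V → Bool) → ℝ} (hF : Monotone F) :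
    ∃ m, BulkTendsto d
      (fun n x => gibbs G K h (B n) (fun _ => true) fun σ => F fun i => σ (θ x i)) m := by
  set c : ℕ → ℝ := fun n => gibbs G K h (B n) (fun _ => true) F with hc
  have hanti : Antitone c := fun j n hjn => gibbs_true_anti G hK (H.mono hjn) hF
  have hbdd : BddBelow (Set.range c) := by
    refine ⟨F ⊥, ?_⟩
    rintro _ ⟨n, rfl⟩
    simpa [gibbs_const] using gibbs_mono G K h (B n) (fun _ => true)
      (F := fun _ => F ⊥) (F' := F) fun σ => hF bot_le
  have hlim := tendsto_atTop_ciInf hanti hbdd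
  have hmono : ∀ x, Monotone fun σ : V → Bool => F fun i => σ (θ x i) :=
    fun x σ τ hστ => hF fun i => hστ _
  have hmap : ∀ x n, gibbs G K h ((B n).map (θ x).toEmbedding) (fun _ => true)
      (fun σ => F fun i => σ (θ x i)) = c n := fun x n =>
    gibbs_map_equiv (H.adj x) (H.coupling x) (H.field x) (B n) _ F
  refine ⟨⨅ n, c n, fun ε hε => ?_⟩
  obtain ⟨j, hj⟩ := ((tendsto_order.1 hlim).2 _ (lt_add_of_pos_right _ hε)).exists
  refine ⟨j, fun n hn x hx => ?_⟩
  have h1 := gibbs_true_anti G hK (h := h) (H.inner j n x hn hx) (hmono x)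
  have h2 := gibbs_true_anti G hK (h := h) (H.outer (n - j) n x hx) (hmono x)
  rw [hmap] at h1 h2
  have h3 := ciInf_le hbdd (n + (n - j))
  rw [abs_le]
  constructor <;> linarith

/-- A local function is a difference of two increasing ones, and the - boundary condition reduces to
+ by a global spin flip, which negates the field. -/
theorem HorizontalAction.exists_bulk (H : HorizontalAction d G K h B θ)
    (hK : ∀ e, 0 ≤ K e) (b : Bool) {F : (V → Bool) → ℝ} {A : Finset V}
    (hF : DependsOn F (A : Set V)) :
    ∃ m, BulkTendsto d
      (fun n x => gibbs G K h (B n) (fun _ => b) fun σ => F fun i => σ (θ x i)) m := by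
  have htrue : ∀ {h : V → ℝ} {F : (V → Bool) → ℝ}, HorizontalAction d G K h B θ →
      DependsOn F (A : Set V) → ∃ m, BulkTendsto d
        (fun n x => gibbs G K h (B n) (fun _ => true) fun σ => F fun i => σ (θ x i)) m := by
    intro h F H hF
    obtain ⟨c, hc0, hc, -⟩ := exists_monotone_add_sub hF
    have hs : Monotone fun σ : V → Bool => c * ∑ i ∈ A, spin (σ i) := fun σ τ hστ =>
      mul_le_mul_of_nonneg_left (Finset.sum_le_sum fun i _ => spin_mono (hστ i)) hc0
    obtain ⟨m, hm⟩ := H.exists_bulk_true_of_monotone hK hc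
    obtain ⟨m', hm'⟩ := H.exists_bulk_true_of_monotone hK hs
    refine ⟨m - m', ?_⟩
    have := hm.sub hm'
    simpa only [← gibbs_sub, add_sub_cancel_left] using this
  cases b with
  | true => exact htrue H hF
  | false =>
    obtain ⟨m, hm⟩ := htrue H.neg (dependsOn_flip hF)
    refine ⟨m, ?_⟩
    intro ε hε
    obtain ⟨j, hj⟩ := hm ε hε
    refine ⟨j, fun n hn x hx => ?_⟩
    have h1 := gibbs_flip G K h (B n) (fun _ => true) fun σ => F fun i => σ (θ x i)
    simp only [Bool.not_true] at h1
    beta_reduce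
    rw [h1]
    exact hj n hn x hx

end Bulk

/-! ### Geometry of the lattice and of the half-space -/

section Geometry

variable {d : ℕ}

/-- Horizontal translation of the lattice. -/
def latticeShift (d : ℕ) (x : Fin (d - 1) → ℤ) : Lattice d ≃ Lattice d :=
  (Equiv.addRight x).prodCongr (Equiv.refl ℤ)

/-- Horizontal translation of the half-space. -/
def halfShift (d : ℕ) (x : Fin (d - 1) → ℤ) : HalfSpace d ≃ HalfSpace d :=
  (latticeShift d x).subtypeEquiv fun _ => Iff.rfl

@[simp] theorem latticeShift_apply (x : Fin (d - 1) → ℤ) (a : Lattice d) :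
    latticeShift d x a = (a.1 + x, a.2) := rfl

@[simp] theorem halfShift_apply (x : Fin (d - 1) → ℤ) (a : HalfSpace d) :
    halfShift d x a = ⟨(a.1.1 + x, a.1.2), a.2⟩ := rfl

theorem mem_doubleBox {n : ℕ} {a : Lattice d} :
    a ∈ doubleBox d n ↔ a.1 ∈ base d n ∧ 1 - (n : ℤ) ≤ a.2 ∧ a.2 ≤ n := by
  simp [doubleBox]

theorem mem_halfBox {n : ℕ} {a : HalfSpace d} :
    a ∈ halfBox d n ↔ a.1.1 ∈ base d n ∧ a.1.2 ≤ n := by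
  have := a.2
  simp [halfBox, this]

theorem add_mem_base {j n : ℕ} {x y : Fin (d - 1) → ℤ} (hjn : j ≤ n) (hx : x ∈ base d (n - j))
    (hy : y ∈ base d j) : y + x ∈ base d n :=
  mem_base.2 fun i => by
    have h1 := mem_base.1 hx i
    have h2 := mem_base.1 hy i
    rw [Pi.add_apply]
    omega

theorem sub_mem_base {m n : ℕ} {x y : Fin (d - 1) → ℤ} (hx : x ∈ base d m)
    (hy : y ∈ base d n) : y - x ∈ base d (n + m) :=
  mem_base.2 fun i => by
    have h1 := mem_base.1 hx i
    have h2 := mem_base.1 hy i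
    rw [Pi.sub_apply]
    omega

theorem dist1_shift (x : Fin (d - 1) → ℤ) (a b : Lattice d) :
    dist1 (latticeShift d x a) (latticeShift d x b) = dist1 a b := by
  simp [dist1]

/-- Neighbours in the lattice. -/
theorem abs_sub_le_of_adj {a b : Lattice d} (h : (latticeGraph d).Adj a b) :
    (∀ j, |a.1 j - b.1 j| ≤ 1) ∧ |a.2 - b.2| ≤ 1 ∧ (a.2 ≠ b.2 → a.1 = b.1) := by
  have hab : (∑ j, |a.1 j - b.1 j|) + |a.2 - b.2| = 1 := h
  have hs : ∀ j, |a.1 j - b.1 j| ≤ ∑ j, |a.1 j - b.1 j| := fun j =>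
    Finset.single_le_sum (f := fun j => |a.1 j - b.1 j|) (fun i _ => abs_nonneg _)
      (Finset.mem_univ j)
  have h0 : 0 ≤ ∑ j, |a.1 j - b.1 j| := Finset.sum_nonneg fun j _ => abs_nonneg _
  have h1 := abs_nonneg (a.2 - b.2)
  refine ⟨fun j => by have := hs j; omega, by omega, fun hne => funext fun j => ?_⟩
  have h2 : 0 < |a.2 - b.2| := abs_pos.2 (sub_ne_zero.2 hne)
  have h3 := hs j
  have h4 : |a.1 j - b.1 j| = 0 := le_antisymm (by omega) (abs_nonneg _)
  exact sub_eq_zero.1 (abs_eq_zero.1 h4)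

theorem adj_vertical (x : Fin (d - 1) → ℤ) {k l : ℤ} (h : |k - l| = 1) :
    (latticeGraph d).Adj (x, k) (x, l) := by
  change dist1 (x, k) (x, l) = 1
  simp [dist1, h]

theorem eq_of_adj_of_le_of_lt {a b : Lattice d} (h : (latticeGraph d).Adj a b) {k : ℤ}
    (ha : a.2 ≤ k) (hb : k < b.2) : a = (b.1, k) ∧ b = (b.1, k + 1) := by
  obtain ⟨-, h1, h2⟩ := abs_sub_le_of_adj h
  have h3 := abs_le.1 h1
  have h4 := h2 (by omega)
  refine ⟨Prod.ext h4 ?_, Prod.ext rfl ?_⟩ <;> simp only <;> omega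

theorem halfAction (J : ℝ) {h : HalfSpace d → ℝ} (hh : ∀ x i, h (halfShift d x i) = h i) :
    HorizontalAction d (halfGraph d) (fun _ => J) h (halfBox d) (halfShift d) where
  adj x a b := by
    change dist1 _ _ = 1 ↔ dist1 _ _ = 1
    rw [← dist1_shift x a.1 b.1]; rfl
  coupling _ _ := rfl
  field := hh
  zero i := by ext <;> simp
  inner j n x hjn hx a ha := by
    obtain ⟨b, hb, rfl⟩ := Finset.mem_map.1 ha
    rw [mem_halfBox] at hb
    exact mem_halfBox.2 ⟨add_mem_base hjn hx hb.1,
      hb.2.trans (by exact_mod_cast hjn)⟩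
  outer m n x hx a ha := by
    rw [mem_halfBox] at ha
    refine Finset.mem_map.2 ⟨⟨(a.1.1 - x, a.1.2), a.2⟩, mem_halfBox.2 ⟨sub_mem_base hx ha.1, ?_⟩, ?_⟩
    · have := ha.2; push_cast; omega
    · simp

/-- The indicator of the edges between the hyperplanes of height `0` and `1`. -/
def cross (d : ℕ) : Sym2 (Lattice d) → ℝ :=
  Sym2.lift ⟨fun a b => if (a.2 ≤ 0 ↔ b.2 ≤ 0) then 0 else 1, fun a b => by simp only [iff_comm]⟩

theorem cross_mk (a b : Lattice d) :
    cross d s(a, b) = if (a.2 ≤ 0 ↔ b.2 ≤ 0) then 0 else 1 := rfl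

theorem cross_nonneg (e : Sym2 (Lattice d)) : 0 ≤ cross d e := by
  induction e with | _ a b
  rw [cross_mk]; split_ifs <;> norm_num

theorem cross_le_one (e : Sym2 (Lattice d)) : cross d e ≤ 1 := by
  induction e with | _ a b
  rw [cross_mk]; split_ifs <;> norm_num

theorem cross_shift (x : Fin (d - 1) → ℤ) (e : Sym2 (Lattice d)) :
    cross d (e.map (latticeShift d x)) = cross d e := by
  induction e with | _ a b
  rfl

theorem latticeAction (f : ℝ → ℝ) {h : Lattice d → ℝ}
    (hh : ∀ x i, h (latticeShift d x i) = h i) :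
    HorizontalAction d (latticeGraph d) (fun e => f (cross d e)) h (doubleBox d)
      (latticeShift d) where
  adj x a b := by
    change dist1 _ _ = 1 ↔ dist1 _ _ = 1
    rw [dist1_shift]
  coupling x e := by rw [cross_shift]
  field := hh
  zero i := by ext <;> simp
  inner j n x hjn hx a ha := by
    obtain ⟨b, hb, rfl⟩ := Finset.mem_map.1 ha
    rw [mem_doubleBox] at hb
    refine mem_doubleBox.2 ⟨add_mem_base hjn hx hb.1, ?_⟩
    simp only [Equiv.coe_toEmbedding, latticeShift_apply]
    omega
  outer m n x hx a ha := by
    rw [mem_doubleBox] at ha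
    refine Finset.mem_map.2 ⟨(a.1 - x, a.2), mem_doubleBox.2 ⟨sub_mem_base hx ha.1, ?_⟩, ?_⟩
    · simp only; push_cast; omega
    · simp

/-- A nearest-neighbour edge on which `cross` is nonzero is vertical, between heights 0 and 1. The
bound `1 ≤ n` puts these two layers inside the box. -/
theorem sum_cross (n : ℕ) (hn : 1 ≤ n) (f : Sym2 (Lattice d) → ℝ) :
    ∑ e ∈ touchingEdges (latticeGraph d) (doubleBox d n), cross d e * f e
      = ∑ x ∈ base d n, f s((x, 0), (x, 1)) := by
  symm
  refine Finset.sum_of_injOn (fun x => s(((x, 0) : Lattice d), (x, 1))) ?_ ?_ ?_ ?_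
  · intro x _ y _ hxy
    rcases Sym2.eq_iff.1 hxy with h | h
    · exact (Prod.ext_iff.1 h.1).1
    · exact (Prod.ext_iff.1 h.1).1
  · intro x hx
    refine Finset.mem_coe.2 (mem_touchingEdges.2 ⟨adj_vertical x (by norm_num), Or.inl ?_⟩)
    exact mem_doubleBox.2 ⟨hx, by simp only; omega, by simp only; omega⟩
  · intro e he hne
    induction e with | _ a b
    rw [cross_mk]
    split_ifs with hab
    · rw [zero_mul]
    · exfalso
      obtain ⟨hadj, hin⟩ := mem_touchingEdges.1 he
      have key : ∀ a b : Lattice d, (latticeGraph d).Adj a b → (a ∈ doubleBox d n ∨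
          b ∈ doubleBox d n) → a.2 ≤ 0 → 0 < b.2 → ∃ x ∈ base d n,
          s(((x, 0) : Lattice d), (x, 1)) = s(a, b) := by
        intro a b hadj hin ha hb
        obtain ⟨h1, h2⟩ := eq_of_adj_of_le_of_lt hadj ha hb
        refine ⟨b.1, ?_, by rw [h1]; nth_rewrite 4 [h2]; simp⟩
        rcases hin with h | h
        · rw [h1] at h; exact (mem_doubleBox.1 h).1
        · exact (mem_doubleBox.1 h).1
      apply hne
      by_cases ha : a.2 ≤ 0
      · obtain ⟨x, hx, h⟩ := key a b hadj hin ha (by by_contra hb; exact hab ⟨fun _ => by omega, fun _ => ha⟩)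
        exact ⟨x, hx, h⟩
      · obtain ⟨x, hx, h⟩ := key b a hadj.symm hin.symm
          (by by_contra hb; exact hab ⟨fun h => absurd h ha, fun h => absurd h hb⟩) (by omega)
        exact ⟨x, hx, by rw [Sym2.eq_swap (a := a)]; exact h⟩
  · intro x _
    rw [cross_mk]; simp

theorem sum_Icc_double (n : ℕ) (g : ℤ → ℝ) :
    ∑ k ∈ Finset.Icc (1 - (n : ℤ)) n, g k
      = ∑ l ∈ Finset.range n, (g (l + 1) + g (-l)) := by
  induction n with
  | zero => simp
  | succ n ih =>
    rw [Finset.sum_range_succ, ← ih]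
    have : Finset.Icc (1 - ((n + 1 : ℕ) : ℤ)) ((n + 1 : ℕ) : ℤ)
        = insert (-(n : ℤ)) (insert ((n : ℤ) + 1) (Finset.Icc (1 - (n : ℤ)) n)) := by
      ext k
      simp only [Finset.mem_Icc, Finset.mem_insert]
      push_cast
      omega
    rw [this, Finset.sum_insert, Finset.sum_insert]
    · ring
    · simp
    · simp only [Finset.mem_Icc, Finset.mem_insert]; omega

theorem sum_Icc_one (n : ℕ) (g : ℤ → ℝ) :
    ∑ k ∈ Finset.Icc (1 : ℤ) n, g k = ∑ l ∈ Finset.range n, g (l + 1) := by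
  induction n with
  | zero => simp
  | succ n ih =>
    rw [Finset.sum_range_succ, ← ih]
    have : Finset.Icc (1 : ℤ) ((n + 1 : ℕ) : ℤ)
        = insert ((n : ℤ) + 1) (Finset.Icc (1 : ℤ) n) := by
      ext k
      simp only [Finset.mem_Icc, Finset.mem_insert]
      push_cast
      omega
    rw [this, Finset.sum_insert (by simp), add_comm]

theorem sum_doubleBox (n : ℕ) (g : Lattice d → ℝ) :
    ∑ i ∈ doubleBox d n, g i
      = ∑ l ∈ Finset.range n, ((∑ x ∈ base d n, g (x, (l : ℤ) + 1)) + ∑ x ∈ base d n, g (x, -l)) := by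
  rw [doubleBox, Finset.sum_product_right, sum_Icc_double]

/-- The site of the half-space above `x` at height `l + 1`. -/
def site (x : Fin (d - 1) → ℤ) (l : ℕ) : HalfSpace d := ⟨(x, (l : ℤ) + 1), by simp⟩

theorem eq_site (i : HalfSpace d) : ∃ l, i = site i.1.1 l := by
  have := i.2
  exact ⟨(i.1.2 - 1).toNat, Subtype.ext (Prod.ext rfl (by simp only [site]; omega))⟩

end Geometry

/-! ### Existence of the free surface energies -/

section Analysis

/-- Dominated convergence for series. The summability of `c` is where the assumption δ > 1 is used
later on. -/
theorem tendsto_layer_sum {c : ℕ → ℝ} (hc : Summable c) (hc0 : ∀ l, 0 ≤ c l) {A : ℕ → ℕ → ℝ}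
    {m : ℕ → ℝ} {C : ℝ} (hA : ∀ n l, |A n l| ≤ C) (hm : ∀ l, Tendsto (fun n => A n l) atTop (𝓝 (m l))) :
    Tendsto (fun n => ∑ l ∈ Finset.range n, c l * A n l) atTop (𝓝 (∑' l, c l * m l)) := by
  have h1 : ∀ n, ∑ l ∈ Finset.range n, c l * A n l
      = ∑' l, if l ∈ Finset.range n then c l * A n l else 0 := fun n => by
    rw [tsum_eq_sum (s := Finset.range n) fun l hl => if_neg hl]
    exact Finset.sum_congr rfl fun l hl => (if_pos hl).symm
  simp only [h1]
  refine tendsto_tsum_of_dominated_convergence (bound := fun l => c l * C) (hc.mul_right C)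
    (fun l => ?_) (Eventually.of_forall fun n l => ?_)
  · refine ((hm l).const_mul (c l)).congr' ?_
    filter_upwards [eventually_gt_atTop l] with n hn
    rw [if_pos (Finset.mem_range.2 hn)]
  · have hC : 0 ≤ C := (abs_nonneg _).trans (hA 0 0)
    split_ifs
    · rw [Real.norm_eq_abs, abs_mul, abs_of_nonneg (hc0 l)]
      exact mul_le_mul_of_nonneg_left (hA n l) (hc0 l)
    · simpa using mul_nonneg (hc0 l) hC

variable {ι : Type*} [Fintype ι] [Nonempty ι] (A B : ι → ℝ)

theorem sum_exp_pos (s : ℝ) : 0 < ∑ i, Real.exp (A i + s * B i) :=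
  Finset.sum_pos (fun _ _ => Real.exp_pos _) Finset.univ_nonempty

theorem hasDerivAt_log_sum_exp (s : ℝ) :
    HasDerivAt (fun s => Real.log (∑ i, Real.exp (A i + s * B i)))
      ((∑ i, B i * Real.exp (A i + s * B i)) / ∑ i, Real.exp (A i + s * B i)) s := by
  refine HasDerivAt.log (HasDerivAt.fun_sum fun i _ => ?_) (sum_exp_pos A B s).ne'
  have h1 : HasDerivAt (fun s => A i + s * B i) (B i) s := by
    simpa using ((hasDerivAt_id s).mul_const (B i)).const_add (A i)
  simpa only [mul_comm] using h1.exp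

theorem continuous_sum_exp_div :
    Continuous fun s : ℝ =>
      (∑ i, B i * Real.exp (A i + s * B i)) / ∑ i, Real.exp (A i + s * B i) :=
  Continuous.div (by fun_prop) (by fun_prop) fun s => (sum_exp_pos A B s).ne'

theorem log_sum_exp_sub :
    Real.log (∑ i, Real.exp (A i + 1 * B i)) - Real.log (∑ i, Real.exp (A i + 0 * B i))
      = ∫ s in (0 : ℝ)..1,
        (∑ i, B i * Real.exp (A i + s * B i)) / ∑ i, Real.exp (A i + s * B i) :=
  (intervalIntegral.integral_eq_sub_of_hasDerivAt (fun s _ => hasDerivAt_log_sum_exp A B s)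
    ((continuous_sum_exp_div A B).intervalIntegrable 0 1)).symm

theorem exists_tendsto_integral {g : ℕ → ℝ → ℝ} {C : ℝ} (hg : ∀ n, Continuous (g n))
    (hC : ∀ n, ∀ s ∈ Set.Icc (0 : ℝ) 1, |g n s| ≤ C)
    (hlim : ∀ s ∈ Set.Icc (0 : ℝ) 1, ∃ m, Tendsto (fun n => g n s) atTop (𝓝 m)) :
    ∃ m, Tendsto (fun n => ∫ s in (0 : ℝ)..1, g n s) atTop (𝓝 m) := by
  choose! f hf using hlim
  have hsub : ∀ s ∈ Set.uIoc (0 : ℝ) 1, s ∈ Set.Icc (0 : ℝ) 1 := fun s hs => by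
    rw [Set.uIoc_of_le zero_le_one] at hs
    exact ⟨hs.1.le, hs.2⟩
  exact ⟨_, intervalIntegral.tendsto_integral_filter_of_dominated_convergence (fun _ => C)
    (Eventually.of_forall fun n => (hg n).aestronglyMeasurable)
    (Eventually.of_forall fun n => Eventually.of_forall fun s hs => hC n s (hsub s hs))
    intervalIntegrable_const (Eventually.of_forall fun s hs => hf s (hsub s hs))⟩

end Analysis

/-! ### Limits of horizontal averages -/

section AverageLimit

variable {V : Type*} [DecidableEq V] {d : ℕ} {G : SimpleGraph V} [G.LocallyFinite]
  {K : Sym2 V → ℝ} {h : V → ℝ} {B : ℕ → Finset V} {θ : (Fin (d - 1) → ℤ) → V ≃ V}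

theorem HorizontalAction.exists_average_limit (H : HorizontalAction d G K h B θ)
    (hK : ∀ e, 0 ≤ K e) (b : Bool) {F : (V → Bool) → ℝ} {A : Finset V}
    (hF : DependsOn F (A : Set V)) :
    ∃ m, Tendsto (fun n => (∑ x ∈ base d n, gibbs G K h (B n) (fun _ => b)
      fun σ => F fun i => σ (θ x i)) / (base d n).card) atTop (𝓝 m) := by
  obtain ⟨m, hm⟩ := H.exists_bulk hK b hF
  obtain ⟨C, hC⟩ := exists_abs_le_of_dependsOn hF
  exact ⟨m, hm.tendsto_average fun n x _ => abs_gibbs_le _ _ _ _ _ fun σ => hC _⟩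

end AverageLimit

/-! ### Interpolation from the lattice model to two decoupled half-spaces -/

section Interpolation

variable (d : ℕ) (J δ lam : ℝ)

/-- The coefficients of the external field. -/
def coef (δ lam : ℝ) (l : ℕ) : ℝ := lam / ((l : ℝ) + 1) ^ δ

theorem coef_nonneg {δ lam : ℝ} (hlam : 0 ≤ lam) (l : ℕ) : 0 ≤ coef δ lam l :=
  div_nonneg hlam (by positivity)

theorem summable_coef {δ : ℝ} (hδ : 1 < δ) (lam : ℝ) : Summable (coef δ lam) := by
  have h1 := (summable_nat_add_iff 1).2 (Real.summable_one_div_nat_rpow.2 hδ)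
  refine (h1.mul_left lam).congr fun l => ?_
  simp only [coef]
  push_cast
  ring

theorem decayField_site (x : Fin (d - 1) → ℤ) (l : ℕ) :
    decayField d δ lam (site x l) = coef δ lam l := by
  simp [decayField, site, coef]

/-- The reflection-symmetric extension of the decaying field to the lattice. -/
def reflField (i : Lattice d) : ℝ := coef δ lam (if 1 ≤ i.2 then i.2 - 1 else -i.2).toNat

theorem reflField_pos (x : Fin (d - 1) → ℤ) (l : ℕ) :
    reflField d δ lam (x, (l : ℤ) + 1) = coef δ lam l := by
  simp [reflField]

theorem reflField_neg (x : Fin (d - 1) → ℤ) (l : ℕ) :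
    reflField d δ lam (x, -(l : ℤ)) = coef δ lam l := by
  have : ¬ 1 ≤ -(l : ℤ) := by omega
  simp [reflField, this]

/-- The interpolation between the lattice model and two decoupled half-space models. -/
def interpZ (b : Bool) (s : ℝ) (n : ℕ) : ℝ :=
  zfun (latticeGraph d) (fun e => J - s * J * cross d e) (fun i => s * reflField d δ lam i)
    (doubleBox d n) fun _ => b

/-- Minus the derivative of the interpolating Hamiltonian. -/
def interpObs (n : ℕ) (σ : Lattice d → Bool) : ℝ :=
  -(J * ∑ x ∈ base d n, spin (σ (x, 0)) * spin (σ (x, 1)))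
    + ∑ i ∈ doubleBox d n, reflField d δ lam i * spin (σ i)

theorem ham_interp {n : ℕ} (hn : 1 ≤ n) (s : ℝ) (σ : Lattice d → Bool) :
    ham (latticeGraph d) (fun e => J - s * J * cross d e) (fun i => s * reflField d δ lam i)
        (doubleBox d n) σ
      = ham (latticeGraph d) (fun _ => J) (fun _ => 0) (doubleBox d n) σ
        + s * interpObs d J δ lam n σ := by
  have h1 := sum_cross n hn fun e => (e.map fun i => spin (σ i)).mul
  simp only [Sym2.map_mk, Sym2.mul_mk] at h1
  unfold ham interpObs
  rw [← h1, mul_add, mul_neg, Finset.mul_sum, Finset.mul_sum, Finset.mul_sum]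
  simp only [sub_mul, Finset.sum_sub_distrib, zero_mul, Finset.sum_const_zero, mul_assoc]
  ring

theorem log_interpZ_sub (b : Bool) {n : ℕ} (hn : 1 ≤ n) :
    Real.log (interpZ d J δ lam b 1 n) - Real.log (interpZ d J δ lam b 0 n)
      = ∫ s in (0 : ℝ)..1, gibbs (latticeGraph d) (fun e => J - s * J * cross d e)
          (fun i => s * reflField d δ lam i) (doubleBox d n) (fun _ => b)
          (interpObs d J δ lam n) := by
  unfold interpZ gibbs
  simp only [zfun_eq_sum, wsum, ham_interp d J δ lam hn]
  exact log_sum_exp_sub _ _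

theorem continuous_gibbs_interp (b : Bool) {n : ℕ} (hn : 1 ≤ n) :
    Continuous fun s : ℝ => gibbs (latticeGraph d) (fun e => J - s * J * cross d e)
          (fun i => s * reflField d δ lam i) (doubleBox d n) (fun _ => b)
          (interpObs d J δ lam n) := by
  unfold gibbs
  simp only [zfun_eq_sum, wsum, ham_interp d J δ lam hn]
  exact continuous_sum_exp_div _ _

/-- Per wall site, the derivative splits into averages over single layers with summable weights, so
that each average can be treated by translation invariance. -/
theorem gibbs_interpObs (b : Bool) (s : ℝ) (n : ℕ) :
    let E := gibbs (latticeGraph d) (fun e => J - s * J * cross d e)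
      (fun i => s * reflField d δ lam i) (doubleBox d n) (fun _ => b)
    E (interpObs d J δ lam n) / (base d n).card
      = -(J * ((∑ x ∈ base d n, E fun σ => spin (σ (x, 0)) * spin (σ (x, 1))) / (base d n).card))
        + ∑ l ∈ Finset.range n, coef δ lam l *
          ((∑ x ∈ base d n, E fun σ => spin (σ (x, (l : ℤ) + 1))) / (base d n).card
            + (∑ x ∈ base d n, E fun σ => spin (σ (x, -(l : ℤ)))) / (base d n).card) := by
  intro E
  have h1 : E (interpObs d J δ lam n)
      = -(J * ∑ x ∈ base d n, E fun σ => spin (σ (x, 0)) * spin (σ (x, 1)))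
        + ∑ l ∈ Finset.range n, coef δ lam l *
          ((∑ x ∈ base d n, E fun σ => spin (σ (x, (l : ℤ) + 1)))
            + ∑ x ∈ base d n, E fun σ => spin (σ (x, -(l : ℤ)))) := by
    unfold interpObs
    simp only [E]
    rw [gibbs_add, gibbs_neg, gibbs_const_mul, gibbs_sum, gibbs_sum, sum_doubleBox]
    simp only [gibbs_const_mul, reflField_pos, reflField_neg, ← Finset.mul_sum, mul_add]
  rw [h1, add_div, neg_div, mul_div_assoc]
  simp only [Finset.sum_div, mul_div_assoc, add_div]

variable {d J δ lam}

theorem abs_average_le {n : ℕ} {a : (Fin (d - 1) → ℤ) → ℝ} (ha : ∀ x, |a x| ≤ 1) :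
    |(∑ x ∈ base d n, a x) / ((base d n).card : ℝ)| ≤ 1 := by
  rw [abs_div, abs_of_pos (card_base_pos n), div_le_one (card_base_pos n)]
  refine (Finset.abs_sum_le_sum_abs _ _).trans ?_
  simpa using Finset.sum_le_card_nsmul (base d n) _ 1 fun x _ => ha x

theorem dependsOn_spin {V : Type*} (i : V) :
    DependsOn (fun σ : V → Bool => spin (σ i)) (({i} : Finset V) : Set V) := fun σ τ hστ =>
  congrArg spin (hστ i (by simp))

/-- The difference of logarithms is the integral over `s ∈ [0,1]` of the expected observable. Per
wall site, this integrand converges for each `s` and is bounded uniformly in `n` and `s`. -/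
theorem exists_tendsto_interp (hJ : 0 < J) (hδ : 1 < δ) (hlam : 0 ≤ lam) (b : Bool) :
    ∃ m, Tendsto (fun n => (Real.log (interpZ d J δ lam b 1 n)
      - Real.log (interpZ d J δ lam b 0 n)) / (base d n).card) atTop (𝓝 m) := by
  set E : ℝ → ℕ → ((Lattice d → Bool) → ℝ) → ℝ := fun s n =>
    gibbs (latticeGraph d) (fun e => J - s * J * cross d e)
      (fun i => s * reflField d δ lam i) (doubleBox d n) (fun _ => b) with hE
  have hspin : ∀ s n i, |E s n fun σ => spin (σ i)| ≤ 1 := fun s n i =>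
    abs_gibbs_le _ _ _ _ _ fun σ => (abs_spin _).le
  have hspin2 : ∀ s n i j, |E s n fun σ => spin (σ i) * spin (σ j)| ≤ 1 := fun s n i j =>
    abs_gibbs_le _ _ _ _ _ fun σ => by rw [abs_mul, abs_spin, abs_spin, one_mul]
  have hlayer : ∀ s n l, |(∑ x ∈ base d n, E s n fun σ => spin (σ (x, ((l : ℕ) : ℤ) + 1)))
        / ((base d n).card : ℝ)
      + (∑ x ∈ base d n, E s n fun σ => spin (σ (x, -(l : ℤ)))) / (base d n).card| ≤ 2 :=
    fun s n l => (abs_add_le _ _).trans (by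
      have h1 := abs_average_le (n := n) fun x : Fin (d - 1) → ℤ => hspin s n (x, (l : ℤ) + 1)
      have h2 := abs_average_le (n := n) fun x : Fin (d - 1) → ℤ => hspin s n (x, -(l : ℤ))
      linarith)
  -- The index is shifted to `n + 1` because the crossing edges are all accounted for only in
  -- nonempty boxes.
  obtain ⟨m, hm⟩ := exists_tendsto_integral
    (g := fun n s => E s (n + 1) (interpObs d J δ lam (n + 1)) / (base d (n + 1)).card)
    (C := J + ∑' l, coef δ lam l * 2)
    (fun n => (continuous_gibbs_interp d J δ lam b (Nat.le_add_left 1 n)).div_const _)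
    (fun n s _ => by
      simp only [hE]
      rw [gibbs_interpObs]
      refine (abs_add_le _ _).trans (add_le_add ?_ ?_)
      · rw [abs_neg, abs_mul, abs_of_pos hJ]
        exact mul_le_of_le_one_right hJ.le (abs_average_le fun x => hspin2 s (n + 1) _ _)
      · refine (Finset.abs_sum_le_sum_abs _ _).trans ?_
        refine le_trans (Finset.sum_le_sum fun l _ => ?_)
          (((summable_coef hδ lam).mul_right 2).sum_le_tsum (Finset.range (n + 1))
            fun l _ => mul_nonneg (coef_nonneg hlam l) zero_le_two)
        rw [abs_mul, abs_of_nonneg (coef_nonneg hlam l)]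
        exact mul_le_mul_of_nonneg_left (hlayer s (n + 1) l) (coef_nonneg hlam l))
    (fun s hs => by
      -- For `s ≤ 1` the weakened couplings remain ferromagnetic, so monotonicity in the volume is
      -- available.
      have hK : ∀ e, 0 ≤ J - s * J * cross d e := fun e => by
        have h1 := cross_nonneg e
        have h2 := cross_le_one e
        have : s * cross d e ≤ 1 := mul_le_one₀ hs.2 h1 h2
        nlinarith
      have H : HorizontalAction d (latticeGraph d) (fun e => J - s * J * cross d e)
          (fun i => s * reflField d δ lam i) (doubleBox d) (latticeShift d) :=
        latticeAction (fun c => J - s * J * c) fun x i => rfl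
      have hsp : ∀ k : ℤ, ∃ m, Tendsto (fun n => (∑ x ∈ base d n, E s n fun σ => spin (σ (x, k)))
          / ((base d n).card : ℝ)) atTop (𝓝 m) := fun k => by
        obtain ⟨m, hm⟩ := H.exists_average_limit hK b
          (dependsOn_spin ((0, k) : Lattice d))
        exact ⟨m, by simpa using hm⟩
      obtain ⟨p, hp⟩ : ∃ m, Tendsto (fun n => (∑ x ∈ base d n, E s n fun σ =>
          spin (σ (x, 0)) * spin (σ (x, 1))) / ((base d n).card : ℝ)) atTop (𝓝 m) := by
        obtain ⟨m, hm⟩ := H.exists_average_limit hK b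
          (F := fun σ => spin (σ (0, 0)) * spin (σ (0, 1))) (A := {(0, 0), (0, 1)})
          fun σ τ hστ => by
            simp only
            rw [hστ (0, 0) (by simp), hστ (0, 1) (by simp)]
        exact ⟨m, by simpa using hm⟩
      choose q hq using hsp
      have hlim := ((hp.const_mul J).neg).add (tendsto_layer_sum (summable_coef hδ lam)
        (coef_nonneg hlam) (hlayer s) fun l => (hq ((l : ℤ) + 1)).add (hq (-(l : ℤ))))
      refine ⟨_, (hlim.comp (tendsto_add_atTop_nat 1)).congr fun n => ?_⟩
      simp only [hE]
      rw [gibbs_interpObs]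
      rfl)
  refine ⟨m, (tendsto_add_atTop_iff_nat 1).1 (hm.congr fun n => ?_)⟩
  rw [log_interpZ_sub d J δ lam b (Nat.le_add_left 1 n), intervalIntegral.integral_div]

end Interpolation

/-! ### The decoupled lattice model -/

section Decoupling

variable {d : ℕ}

/-- The inclusion of the half-space in the lattice. -/
def upper (d : ℕ) : HalfSpace d ↪ Lattice d := Function.Embedding.subtype _

/-- The reflection of the half-space through the hyperplane of height `1 / 2`. -/
def lower (d : ℕ) : HalfSpace d ↪ Lattice d where
  toFun i := (i.1.1, 1 - i.1.2)
  inj' i j hij := by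
    have h1 := Prod.ext_iff.1 hij
    exact Subtype.ext (Prod.ext h1.1 (by have := h1.2; simp only at this; omega))

theorem lower_apply (i : HalfSpace d) : lower d i = (i.1.1, 1 - i.1.2) := rfl

theorem upper_apply (i : HalfSpace d) : upper d i = i.1 := rfl

theorem mem_range_upper {a : Lattice d} : a ∈ Set.range (upper d) ↔ 1 ≤ a.2 :=
  ⟨by rintro ⟨i, rfl⟩; exact i.2, fun h => ⟨⟨a, h⟩, rfl⟩⟩

theorem mem_range_lower {a : Lattice d} : a ∈ Set.range (lower d) ↔ a.2 ≤ 0 := by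
  constructor
  · rintro ⟨i, rfl⟩
    have := i.2
    simp only [lower_apply]
    omega
  · intro h
    exact ⟨⟨(a.1, 1 - a.2), by simp only; omega⟩, by simp [lower_apply]⟩

theorem doubleBox_eq_union (n : ℕ) :
    doubleBox d n = (halfBox d n).map (upper d) ∪ (halfBox d n).map (lower d) := by
  ext a
  simp only [Finset.mem_union, Finset.mem_map, mem_doubleBox]
  constructor
  · rintro ⟨h1, h2, h3⟩
    by_cases h : 1 ≤ a.2
    · exact Or.inl ⟨⟨a, h⟩, mem_halfBox.2 ⟨h1, h3⟩, rfl⟩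
    · refine Or.inr ⟨⟨(a.1, 1 - a.2), by simp only; omega⟩, mem_halfBox.2 ⟨h1, by simp only; omega⟩, ?_⟩
      simp [lower_apply]
  · rintro (⟨i, hi, rfl⟩ | ⟨i, hi, rfl⟩)
    · have h1 := mem_halfBox.1 hi
      have h2 := i.2
      exact ⟨h1.1, by simp only [upper_apply]; omega, h1.2⟩
    · have h1 := mem_halfBox.1 hi
      have h2 := i.2
      simp only [lower_apply]
      exact ⟨h1.1, by omega, by omega⟩

/-- At `s = 1` crossing edges carry no coupling, so spins beyond the hyperplane exert no field.
Stated for a general embedding, to serve both the upper half and its reflection. -/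
theorem zfun_decoupled (J δ lam : ℝ) (b : Bool) (n : ℕ) (φ : HalfSpace d ↪ Lattice d)
    (hadj : ∀ i j, (latticeGraph d).Adj (φ i) (φ j) ↔ (halfGraph d).Adj i j)
    (hin : ∀ e : Sym2 (HalfSpace d), cross d (e.map φ) = 0)
    (hout : ∀ i, ∀ a ∉ Set.range φ, cross d s(φ i, a) = 1)
    (hfield : ∀ i, reflField d δ lam (φ i) = decayField d δ lam i) :
    zfun (latticeGraph d) (fun e => J - 1 * J * cross d e) (fun i => 1 * reflField d δ lam i)
        ((halfBox d n).map φ) (fun _ => b)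
      = zfun (halfGraph d) (fun _ => J) (decayField d δ lam) (halfBox d n) fun _ => b := by
  classical
  refine wsum_map (F := fun _ => 1) hadj (fun e => by rw [hin]; ring) fun i _ => ?_
  rw [hfield, Finset.sum_eq_zero, one_mul, add_zero]
  intro a ha
  rw [hout i a (Finset.mem_filter.1 ha).2]
  ring

theorem interpZ_one (J δ lam : ℝ) (b : Bool) (n : ℕ) :
    interpZ d J δ lam b 1 n
      = (zfun (halfGraph d) (fun _ => J) (decayField d δ lam) (halfBox d n) fun _ => b) ^ 2 := by
  unfold interpZ
  have hup : ∀ i : HalfSpace d, 1 ≤ (upper d i).2 := fun i => i.2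
  have hlow : ∀ i : HalfSpace d, (lower d i).2 ≤ 0 := fun i => mem_range_lower.1 ⟨i, rfl⟩
  rw [doubleBox_eq_union, zfun_union, zfun_decoupled, zfun_decoupled, sq]
  · intro i j
    change dist1 _ _ = 1 ↔ dist1 _ _ = 1
    simp only [dist1, lower_apply]
    rw [show (1 - i.1.2 - (1 - j.1.2)) = -(i.1.2 - j.1.2) by ring, abs_neg]
  · intro e
    induction e with | _ i j
    rw [Sym2.map_mk, cross_mk, if_pos (iff_of_true (hlow i) (hlow j))]
  · intro i a ha
    rw [mem_range_lower] at ha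
    rw [cross_mk, if_neg]
    exact fun h => ha (h.1 (hlow i))
  · intro i
    obtain ⟨l, hl⟩ := eq_site i
    rw [hl, decayField_site, ← reflField_neg d δ lam i.1.1 l]
    congr 1
    simp [lower_apply, site]
  · exact fun i j => Iff.rfl
  · intro e
    induction e with | _ i j
    have h1 := hup i
    have h2 := hup j
    rw [Sym2.map_mk, cross_mk, if_pos (iff_of_false (by omega) (by omega))]
  · intro i a ha
    rw [mem_range_upper] at ha
    have h1 := hup i
    rw [cross_mk, if_neg]
    exact fun h => by have := h.2 (by omega); omega
  · intro i
    obtain ⟨l, hl⟩ := eq_site i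
    rw [hl, decayField_site, ← reflField_pos d δ lam i.1.1 l]
    rfl
  · rw [Finset.disjoint_left]
    intro a ha hb
    obtain ⟨i, -, rfl⟩ := Finset.mem_map.1 ha
    obtain ⟨j, -, hj⟩ := Finset.mem_map.1 hb
    have h1 := hup i
    have h2 := hlow j
    rw [hj] at h2
    omega
  · intro a ha c hc
    obtain ⟨i, -, rfl⟩ := Finset.mem_map.1 ha
    obtain ⟨j, -, rfl⟩ := Finset.mem_map.1 hc
    have h1 := hup i
    have h2 := hlow j
    rw [cross_mk, if_neg (by omega)]
    ring

theorem interpZ_zero (J δ lam : ℝ) (b : Bool) (n : ℕ) :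
    interpZ d J δ lam b 0 n
      = partitionFn (latticeGraph d) J (fun _ => 0) (doubleBox d n) fun _ => b := by
  rw [partitionFn_eq_zfun]
  simp [interpZ]

theorem card_wall (n : ℕ) : (wall d n).card = (base d n).card := by
  simp [wall]

theorem exists_surfaceFreeEnergy_limit {J δ lam : ℝ} (hJ : 0 < J) (hδ : 1 < δ) (hlam : 0 ≤ lam)
    (b : Bool) : ∃ l : ℝ, Tendsto (surfaceFreeEnergySeq d J (decayField d δ lam) b) atTop (𝓝 l) := by
  obtain ⟨m, hm⟩ := exists_tendsto_interp (d := d) hJ hδ hlam b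
  refine ⟨-(1 / 2) * m, (hm.const_mul (-(1 / 2))).congr fun n => ?_⟩
  have h1 : interpZ d J δ lam b 1 n ≠ 0 := (zfun_pos _ _ _ _ _).ne'
  have h0 : interpZ d J δ lam b 0 n ≠ 0 := (zfun_pos _ _ _ _ _).ne'
  rw [surfaceFreeEnergySeq, ← interpZ_zero J δ lam, partitionFn_eq_zfun, ← interpZ_one,
    Real.log_div h1 h0, card_wall]
  ring

theorem exists_state_limit {J : ℝ} (hJ : 0 < J) {h : HalfSpace d → ℝ}
    (hh : ∀ x i, h (halfShift d x i) = h i) (b : Bool) (f : LocalObs (HalfSpace d)) :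
    ∃ l : ℝ, Tendsto (fun n => boxExpect d J h b n f.1) atTop (𝓝 l) := by
  obtain ⟨F, A, hF⟩ := f
  obtain ⟨m, hm⟩ := (halfAction J hh).exists_bulk (fun _ => hJ.le) b hF
  refine ⟨m, (hm.tendsto 0).congr fun n => ?_⟩
  simp [boxExpect, expect_eq_gibbs]

end Decoupling

/-! ### Comparison of partition functions with different boundary conditions -/

section Gap

variable {V : Type*} [DecidableEq V] (G : SimpleGraph V) [G.LocallyFinite] {K : Sym2 V → ℝ}

/-- The logarithm of the ratio of the partition functions with boundary conditions `η`, `η'`. -/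
def logRatio (G : SimpleGraph V) [G.LocallyFinite] (K : Sym2 V → ℝ) (h : V → ℝ) (Λ : Finset V)
    (η η' : V → Bool) : ℝ :=
  Real.log (zfun G K h Λ η) - Real.log (zfun G K h Λ η')

theorem ham_add_field (h h' : V → ℝ) (Λ : Finset V) (σ : V → Bool) :
    ham G K h' Λ σ = ham G K h Λ σ + ∑ i ∈ Λ, (h' i - h i) * spin (σ i) := by
  simp only [ham, sub_mul, Finset.sum_sub_distrib]
  ring

theorem zfun_eq_wsum_exp (h h' : V → ℝ) (Λ : Finset V) (η : V → Bool) :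
    zfun G K h' Λ η = wsum G K h Λ η fun σ => Real.exp (∑ i ∈ Λ, (h' i - h i) * spin (σ i)) := by
  rw [zfun_eq_sum, wsum]
  refine Finset.sum_congr rfl fun ω _ => ?_
  rw [ham_add_field G h h', Real.exp_add, mul_comm]

theorem monotone_sum_mul_spin {Λ : Finset V} {g : V → ℝ} (hg : ∀ i ∈ Λ, 0 ≤ g i) :
    Monotone fun σ : V → Bool => ∑ i ∈ Λ, g i * spin (σ i) := fun _ _ hστ =>
  Finset.sum_le_sum fun i hi => mul_le_mul_of_nonneg_left (spin_mono (hστ i)) (hg i hi)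

theorem log_sub_log_le {a b c e : ℝ} (ha : 0 < a) (hb : 0 < b) (hc : 0 < c) (he : 0 < e)
    (h : a / b ≤ c / e) : Real.log a - Real.log b ≤ Real.log c - Real.log e := by
  rw [← Real.log_div ha.ne' hb.ne', ← Real.log_div hc.ne' he.ne']
  exact Real.log_le_log (div_pos ha hb) h

/-- The ratio of the partition functions at `h'` and `h` is the expectation, at field `h`, of the
increasing function `exp (∑ (h' - h) σ)`; it is therefore larger for the larger boundary condition.
-/
theorem logRatio_mono (hK : ∀ e, 0 ≤ K e) {h h' : V → ℝ} {Λ : Finset V}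
    (hh : ∀ i ∈ Λ, h i ≤ h' i) {η η' : V → Bool} (hη : ∀ i ∉ Λ, η' i ≤ η i) :
    logRatio G K h Λ η η' ≤ logRatio G K h' Λ η η' := by
  have key : zfun G K h' Λ η' / zfun G K h Λ η' ≤ zfun G K h' Λ η / zfun G K h Λ η := by
    rw [zfun_eq_wsum_exp G h h', zfun_eq_wsum_exp G h h']
    exact gibbs_le_gibbs G hK (fun _ _ => le_rfl) hη (Real.exp_monotone.comp
      (monotone_sum_mul_spin fun i hi => sub_nonneg.2 (hh i hi)))
  have := log_sub_log_le (zfun_pos _ _ _ _ _) (zfun_pos _ _ _ _ _) (zfun_pos _ _ _ _ _)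
    (zfun_pos _ _ _ _ _) key
  unfold logRatio
  linarith

theorem abs_log_zfun_sub_le {h : V → ℝ} {Λ : Finset V} (hh : ∀ i ∈ Λ, 0 ≤ h i) (η : V → Bool) :
    |Real.log (zfun G K h Λ η) - Real.log (zfun G K (fun _ => 0) Λ η)| ≤ ∑ i ∈ Λ, h i := by
  have hb : ∀ σ : V → Bool, |∑ i ∈ Λ, (h i - 0) * spin (σ i)| ≤ ∑ i ∈ Λ, h i := fun σ => by
    refine (Finset.abs_sum_le_sum_abs _ _).trans (Finset.sum_le_sum fun i hi => ?_)
    rw [abs_mul, abs_spin, sub_zero, abs_of_nonneg (hh i hi), mul_one]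
  have h0 := zfun_pos G K (fun _ => 0) Λ η
  have h1 := zfun_pos G K h Λ η
  have hup : zfun G K h Λ η ≤ Real.exp (∑ i ∈ Λ, h i) * zfun G K (fun _ => 0) Λ η := by
    rw [zfun_eq_wsum_exp G (fun _ => 0) h, zfun, ← wsum_const_mul]
    refine wsum_le _ _ _ _ _ fun σ => ?_
    rw [mul_one]
    exact Real.exp_le_exp.2 (abs_le.1 (hb σ)).2
  have hlow : Real.exp (-∑ i ∈ Λ, h i) * zfun G K (fun _ => 0) Λ η ≤ zfun G K h Λ η := by
    rw [zfun_eq_wsum_exp G (fun _ => 0) h, zfun, ← wsum_const_mul]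
    refine wsum_le _ _ _ _ _ fun σ => ?_
    rw [mul_one]
    exact Real.exp_le_exp.2 (abs_le.1 (hb σ)).1
  have h2 := Real.log_le_log h1 hup
  have h3 := Real.log_le_log (by positivity) hlow
  rw [Real.log_mul (Real.exp_pos _).ne' h0.ne', Real.log_exp] at h2 h3
  rw [abs_le]
  constructor <;> linarith

theorem logRatio_le_zero_field {h : V → ℝ} {Λ : Finset V} (hh : ∀ i ∈ Λ, 0 ≤ h i)
    (η η' : V → Bool) :
    logRatio G K h Λ η η' ≤ logRatio G K (fun _ => 0) Λ η η' + 2 * ∑ i ∈ Λ, h i := by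
  have h1 := abs_le.1 (abs_log_zfun_sub_le G (K := K) hh η)
  have h2 := abs_le.1 (abs_log_zfun_sub_le G (K := K) hh η')
  unfold logRatio
  linarith

theorem gibbs_indicator {h : V → ℝ} {Λ Λ₁ : Finset V} (hΛ : Λ₁ ⊆ Λ) {η c : V → Bool}
    (hc : ∀ i ∉ Λ, c i = η i) :
    gibbs G K h Λ η (fun σ => if ∀ i ∈ Λ \ Λ₁, σ i = c i then 1 else 0)
      = Real.exp (hamRest G K h Λ Λ₁ c) * zfun G K h Λ₁ c / zfun G K h Λ η := by
  rw [gibbs, wsum_indicator G K h hΛ hc]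

theorem monotone_indicator (Λ : Finset V) :
    Monotone fun σ : V → Bool => if ∀ i ∈ Λ, σ i = true then (1 : ℝ) else 0 := by
  intro σ τ hστ
  simp only
  split_ifs with h1 h2 h2
  · exact le_rfl
  · exact absurd (fun i hi => top_le_iff.1 ((h1 i hi).ge.trans (hστ i))) h2
  · exact zero_le_one
  · exact le_rfl

/-- Freezing the spins of `Λ \ Λ₁` to `+`. -/
theorem logRatio_le_freeze (hK : ∀ e, 0 ≤ K e) {h : V → ℝ} {Λ Λ₁ : Finset V} (hΛ : Λ₁ ⊆ Λ)
    {c : V → Bool} (hc : ∀ i ∈ Λ, c i = true) (hc' : ∀ i ∉ Λ, c i = false) :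
    logRatio G K h Λ (fun _ => true) (fun _ => false)
      ≤ logRatio G K h Λ₁ (fun _ => true) c
        + (hamRest G K h Λ Λ₁ (fun _ => true) - hamRest G K h Λ Λ₁ c) := by
  have h1 := gibbs_indicator G (K := K) (h := h) hΛ (η := fun _ => true) (c := fun _ => true)
    fun _ _ => rfl
  have h2 := gibbs_indicator G (K := K) (h := h) hΛ (η := fun _ => false) (c := c) hc'
  have h3 : (fun σ : V → Bool => if ∀ i ∈ Λ \ Λ₁, σ i = c i then (1 : ℝ) else 0)
      = fun σ => if ∀ i ∈ Λ \ Λ₁, σ i = true then 1 else 0 := by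
    funext σ
    congr 1
    exact propext (forall₂_congr fun i hi => by rw [hc i (Finset.mem_sdiff.1 hi).1])
  rw [h3] at h2
  -- The event that all frozen spins are + is increasing, hence more likely under the + boundary
  -- condition. Both probabilities are ratios of partition functions.
  have h4 := gibbs_le_gibbs G hK (h := h) (h' := h) (Λ := Λ) (fun _ _ => le_rfl)
    (η := fun _ => false) (η' := fun _ => true) (fun _ _ => Bool.false_le _)
    (monotone_indicator (Λ \ Λ₁))
  rw [h1, h2] at h4
  have p1 := zfun_pos G K h Λ₁ c
  have p2 := zfun_pos G K h Λ₁ fun _ => true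
  have h5 := log_sub_log_le (by positivity) (zfun_pos _ _ _ _ _) (by positivity)
    (zfun_pos _ _ _ _ _) h4
  rw [Real.log_mul (Real.exp_pos _).ne' p1.ne', Real.log_mul (Real.exp_pos _).ne' p2.ne',
    Real.log_exp, Real.log_exp] at h5
  unfold logRatio
  linarith

/-- Comparison of volumes. -/
theorem logRatio_le_of_subset (hK : ∀ e, 0 ≤ K e) {h : V → ℝ} {Λ Λ₁ : Finset V} (hΛ : Λ₁ ⊆ Λ)
    (hh : ∀ i ∈ Λ, 0 ≤ h i) :
    logRatio G K h Λ (fun _ => true) (fun _ => false)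
      ≤ logRatio G K h Λ₁ (fun _ => true) (fun _ => false) + 2 * ∑ i ∈ Λ \ Λ₁, h i := by
  have h1 := gibbs_indicator G (K := K) (h := h) hΛ (η := fun _ => true) (c := fun _ => true)
    fun _ _ => rfl
  have h2 := gibbs_indicator G (K := K) (h := h) hΛ (η := fun _ => false) (c := fun _ => false)
    fun _ _ => rfl
  -- By spin flip, the probability of all - under the - boundary condition is that of all + under
  -- the + boundary condition with field `-h`, and `-h ≤ h`.
  have h3 := gibbs_flip G K h Λ (fun _ => true)
    fun σ => if ∀ i ∈ Λ \ Λ₁, σ i = false then (1 : ℝ) else 0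
  simp only [Bool.not_true, Bool.not_eq_false'] at h3
  have h4 := gibbs_le_gibbs G hK (h := fun i => -h i) (h' := h) (Λ := Λ)
    (fun i hi => by have := hh i hi; linarith)
    (η := fun _ => true) (η' := fun _ => true) (fun _ _ => le_rfl) (monotone_indicator (Λ \ Λ₁))
  rw [← h3, h1, h2] at h4
  have p1 := zfun_pos G K h Λ₁ fun _ => false
  have p2 := zfun_pos G K h Λ₁ fun _ => true
  have h5 := log_sub_log_le (by positivity) (zfun_pos _ _ _ _ _) (by positivity)
    (zfun_pos _ _ _ _ _) h4
  rw [Real.log_mul (Real.exp_pos _).ne' p1.ne', Real.log_mul (Real.exp_pos _).ne' p2.ne',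
    Real.log_exp, Real.log_exp] at h5
  have h6 : hamRest G K h Λ Λ₁ (fun _ => true) - hamRest G K h Λ Λ₁ (fun _ => false)
      = 2 * ∑ i ∈ Λ \ Λ₁, h i := by
    unfold hamRest
    have : ∀ e : Sym2 V, (e.map fun _ => spin true).mul = (e.map fun _ => spin false).mul := by
      intro e
      induction e with | _ a b
      norm_num [spin, Sym2.mul_mk]
    simp only [this]
    simp only [spin, if_true, Bool.false_eq_true, if_false, mul_one, mul_neg,
      Finset.sum_neg_distrib]
    ring
  unfold logRatio
  linarith

theorem card_touchingEdges_le {D : ℕ} (hD : ∀ i, G.degree i ≤ D) (S : Finset V) :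
    (touchingEdges G S).card ≤ S.card * D :=
  Finset.card_biUnion_le_card_mul _ _ _ fun i _ => by
    rw [SimpleGraph.card_incidenceFinset_eq_degree]; exact hD i

/-- The two configurations agree on `Λ`, so only the edges leaving `Λ` from `Λ \ Λ₁` matter. Each
costs at most `2 * J`, and its inner endpoint is in `S`. -/
theorem hamRest_sub_le {J : ℝ} (hJ : 0 ≤ J) {D : ℕ} (hD : ∀ i, G.degree i ≤ D) {h : V → ℝ}
    {Λ Λ₁ S : Finset V} {c : V → Bool} (hc : ∀ i ∈ Λ, c i = true)
    (hS : ∀ i ∈ Λ \ Λ₁, ∀ j ∉ Λ, G.Adj i j → i ∈ S) :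
    hamRest G (fun _ => J) h Λ Λ₁ (fun _ => true) - hamRest G (fun _ => J) h Λ Λ₁ c
      ≤ 2 * J * (S.card * D) := by
  have h1 : ∑ i ∈ Λ \ Λ₁, h i * spin true = ∑ i ∈ Λ \ Λ₁, h i * spin (c i) :=
    Finset.sum_congr rfl fun i hi => by rw [hc i (Finset.mem_sdiff.1 hi).1]
  unfold hamRest
  rw [h1, add_sub_add_right_eq_sub, ← Finset.sum_sub_distrib]
  have h2 : ∀ e ∈ touchingEdges G Λ \ touchingEdges G Λ₁,
      J * (e.map fun _ => spin true).mul - J * (e.map fun i => spin (c i)).mul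
        ≤ if e ∈ touchingEdges G S then 2 * J else 0 := by
    intro e he
    induction e with | _ a b
    simp only [Finset.mem_sdiff, mem_touchingEdges, Sym2.map_mk, Sym2.mul_mk] at he ⊢
    have hle : J * (spin true * spin true) - J * (spin (c a) * spin (c b)) ≤ 2 * J := by
      cases c a <;> cases c b <;> norm_num [spin] <;> linarith
    split_ifs with hin
    · exact hle
    · have ha : a ∈ Λ := by
        by_contra ha
        have hb := he.1.2.resolve_left ha
        exact hin (mem_touchingEdges.2 ⟨he.1.1, Or.inr (hS b (Finset.mem_sdiff.2
          ⟨hb, fun h => he.2 ⟨he.1.1, Or.inr h⟩⟩) a ha he.1.1.symm)⟩)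
      have hb : b ∈ Λ := by
        by_contra hb
        exact hin (mem_touchingEdges.2 ⟨he.1.1, Or.inl (hS a (Finset.mem_sdiff.2
          ⟨ha, fun h => he.2 ⟨he.1.1, Or.inl h⟩⟩) b hb he.1.1)⟩)
      rw [hc a ha, hc b hb, sub_self]
  refine (Finset.sum_le_sum h2).trans ?_
  rw [← Finset.sum_filter, Finset.sum_const, nsmul_eq_mul, mul_comm]
  refine mul_le_mul_of_nonneg_left ?_ (by linarith)
  have h3 : {e ∈ touchingEdges G Λ \ touchingEdges G Λ₁ | e ∈ touchingEdges G S}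
      ⊆ touchingEdges G S := fun e he => (Finset.mem_filter.1 he).2
  exact_mod_cast (Finset.card_le_card h3).trans (card_touchingEdges_le G hD S)

end Gap

/-! ### The wall free energy is bounded by its value at `lam = J` -/

section Shift

variable {d : ℕ}

/-- The box `[-n, n]^{d-1} × [1, m]` of the half-space. -/
def slab (d n m : ℕ) : Finset (HalfSpace d) :=
  Finset.subtype (fun x : Lattice d => 1 ≤ x.2) (base d n ×ˢ Finset.Icc (1 : ℤ) m)

theorem mem_slab {n m : ℕ} {a : HalfSpace d} :
    a ∈ slab d n m ↔ a.1.1 ∈ base d n ∧ a.1.2 ≤ m := by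
  have := a.2
  simp [slab, this]

theorem halfBox_eq_slab (n : ℕ) : halfBox d n = slab d n n := rfl

theorem sum_slab (n m : ℕ) (g : HalfSpace d → ℝ) :
    ∑ i ∈ slab d n m, g i = ∑ l ∈ Finset.range m, ∑ x ∈ base d n, g (site x l) := by
  set g' : Lattice d → ℝ := fun a => if ha : 1 ≤ a.2 then g ⟨a, ha⟩ else 0 with hg'
  have h1 : ∑ i ∈ slab d n m, g i = ∑ a ∈ base d n ×ˢ Finset.Icc (1 : ℤ) m, g' a := by
    rw [← Finset.sum_subtype_of_mem g' (p := fun a : Lattice d => 1 ≤ a.2)]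
    · exact Finset.sum_congr rfl fun i _ => by rw [hg']; simp only [dif_pos i.2]
    · intro a ha
      exact (Finset.mem_Icc.1 (Finset.mem_product.1 ha).2).1
  rw [h1, Finset.sum_product_right, sum_Icc_one]
  refine Finset.sum_congr rfl fun l _ => Finset.sum_congr rfl fun x _ => ?_
  rw [hg']
  exact dif_pos (site x l).2

theorem card_slab (n m : ℕ) : (slab d n m).card = m * (base d n).card := by
  have h1 := sum_slab (d := d) n m fun _ => 1
  simp only [Finset.sum_const, nsmul_eq_mul, mul_one, Finset.card_range] at h1
  exact_mod_cast h1

theorem slab_subset {n n' m m' : ℕ} (hn : n ≤ n') (hm : m ≤ m') : slab d n m ⊆ slab d n' m' :=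
  fun a ha => mem_slab.2 ⟨base_mono hn (mem_slab.1 ha).1,
    (mem_slab.1 ha).2.trans (by exact_mod_cast hm)⟩

theorem half_degree_le (i : HalfSpace d) :
    (halfGraph d).degree i ≤ (base d 1 ×ˢ Finset.Icc (-1 : ℤ) 1).card := by
  refine Finset.card_le_card_of_injOn (fun j : HalfSpace d => j.1 - i.1) (fun j hj => ?_) fun j _ j' _ h => ?_
  · have hadj : (halfGraph d).Adj i j := by simpa using hj
    obtain ⟨h1, h2, -⟩ := abs_sub_le_of_adj (a := i.1) (b := j.1) hadj
    have h3 := abs_le.1 h2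
    refine Finset.mem_coe.2 (Finset.mem_product.2 ⟨mem_base.2 fun k => ?_, Finset.mem_Icc.2 ?_⟩)
    · have := abs_le.1 (h1 k)
      simp only [Prod.fst_sub, Pi.sub_apply]
      push_cast
      omega
    · simp only [Prod.snd_sub]; omega
  · exact Subtype.ext (sub_left_injective h)

/-- The vertical translation of the half-space by `k`. -/
def raise (d k : ℕ) : HalfSpace d ↪ HalfSpace d where
  toFun i := ⟨(i.1.1, i.1.2 + k), by have := i.2; simp only; omega⟩
  inj' i j hij := by
    have h1 := Prod.ext_iff.1 (Subtype.ext_iff.1 hij)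
    exact Subtype.ext (Prod.ext h1.1 (by have := h1.2; simp only at this; omega))

theorem raise_val (k : ℕ) (i : HalfSpace d) : (raise d k i).1 = (i.1.1, i.1.2 + (k : ℤ)) := rfl

theorem mem_range_raise {k : ℕ} {a : HalfSpace d} : a ∈ Set.range (raise d k) ↔ (k : ℤ) < a.1.2 := by
  constructor
  · rintro ⟨i, rfl⟩
    have := i.2
    rw [raise_val]
    simp only
    omega
  · intro h
    exact ⟨⟨(a.1.1, a.1.2 - k), by simp only; omega⟩, Subtype.ext (by rw [raise_val]; simp)⟩

theorem raise_site (k : ℕ) (x : Fin (d - 1) → ℤ) (l : ℕ) :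
    raise d k (site x l) = site x (l + k) :=
  Subtype.ext (by rw [raise_val]; simp only [site]; push_cast; congr 1; ring)

/-- The field `J` on the wall. -/
def wallField (d : ℕ) (J : ℝ) (i : HalfSpace d) : ℝ := if i.1.2 = 1 then J else 0

theorem wallField_site (J : ℝ) (x : Fin (d - 1) → ℤ) (l : ℕ) :
    wallField d J (site x l) = if l = 0 then J else 0 := by
  simp [wallField, site]

theorem sum_slab_wallField (J : ℝ) {n m : ℕ} (hm : 1 ≤ m) :
    ∑ i ∈ slab d n m, wallField d J i = J * (base d n).card := by
  rw [sum_slab]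
  simp only [wallField_site]
  rw [Finset.sum_eq_single_of_mem 0 (Finset.mem_range.2 hm) fun l _ hl => by simp [hl]]
  simp [mul_comm]

/-- The configuration which is `+` in `halfBox d n` and `-` outside. -/
def plusIn (d n : ℕ) (i : HalfSpace d) : Bool := decide (i ∈ halfBox d n)

/-- A site of height `k + 1` has exactly one neighbour at height at most `k`, namely the site below
it, where `c` is +. Its effect is a field `J` on what becomes the wall after translation by `k`. -/
theorem zfun_raise (J : ℝ) {n k : ℕ} (hk : 1 ≤ k) (hkn : k ≤ n) {c : HalfSpace d → Bool} {b : Bool}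
    (hc : ∀ i ∈ halfBox d n, c i = true) (hc' : ∀ i ∉ halfBox d n, c i = b) :
    zfun (halfGraph d) (fun _ => J) (fun _ => 0) ((slab d n (n - k)).map (raise d k)) c
      = zfun (halfGraph d) (fun _ => J) (wallField d J) (slab d n (n - k)) fun _ => b := by
  classical
  have hadj : ∀ i j, (halfGraph d).Adj (raise d k i) (raise d k j) ↔ (halfGraph d).Adj i j := by
    intro i j
    change dist1 _ _ = 1 ↔ dist1 _ _ = 1
    simp [dist1, raise_val]
  have hmem : ∀ i : HalfSpace d, i ∉ slab d n (n - k) → raise d k i ∉ halfBox d n := by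
    intro i hi hr
    rw [mem_halfBox, raise_val] at hr
    rw [mem_slab] at hi
    exact hi ⟨hr.1, by have := hr.2; simp only at this; omega⟩
  have h1 := wsum_map (η := c) (K := fun _ => J) (K' := fun _ => J) (h' := fun _ => 0)
    (h := wallField d J) (Λ := slab d n (n - k)) (F := fun _ => 1) hadj (fun _ => rfl) ?_
  · unfold zfun
    rw [h1]
    simp only [wsum]
    simp only [glue_congr (η := fun i => c (raise d k i)) (η' := fun _ => b)
      fun i hi => hc' _ (hmem i hi)]
  · intro i hi
    rw [mem_slab] at hi
    rw [zero_add, wallField]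
    split_ifs with hone
    · have hbelow : (1 : ℤ) ≤ ((i.1.1, (k : ℤ)) : Lattice d).2 := by simp only; omega
      rw [Finset.sum_eq_single_of_mem ⟨(i.1.1, (k : ℤ)), hbelow⟩]
      · have hin : (⟨(i.1.1, (k : ℤ)), hbelow⟩ : HalfSpace d) ∈ halfBox d n :=
          mem_halfBox.2 ⟨hi.1, by simp only; omega⟩
        rw [hc _ hin]
        simp [spin]
      · rw [Finset.mem_filter, SimpleGraph.mem_neighborFinset, mem_range_raise]
        refine ⟨?_, by simp⟩
        change (latticeGraph d).Adj _ _
        rw [raise_val, hone]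
        exact adj_vertical _ (by norm_num)
      · intro j hj hne
        exfalso
        rw [Finset.mem_filter, SimpleGraph.mem_neighborFinset, mem_range_raise] at hj
        have hadj' : (latticeGraph d).Adj j.1 (raise d k i).1 := hj.1.symm
        have h2 := (eq_of_adj_of_le_of_lt hadj' (k := k) (by omega)
          (by rw [raise_val]; simp only; omega)).1
        exact hne (Subtype.ext h2)
    · symm
      refine Finset.sum_eq_zero fun j hj => ?_
      exfalso
      rw [Finset.mem_filter, SimpleGraph.mem_neighborFinset, mem_range_raise] at hj
      have hadj' : (latticeGraph d).Adj j.1 (raise d k i).1 := hj.1.symm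
      have h2 := (eq_of_adj_of_le_of_lt hadj' (k := k) (by omega)
          (by have := i.2; rw [raise_val]; simp only; omega)).2
      rw [raise_val] at h2
      have h3 := (Prod.ext_iff.1 h2).2
      simp only at h3
      omega

/-- The logarithm of `Z_n^+ / Z_n^-` for the field `lam / i_d ^ δ`. -/
def boxRatio (d : ℕ) (J δ lam : ℝ) (n : ℕ) : ℝ :=
  logRatio (halfGraph d) (fun _ => J) (decayField d δ lam) (halfBox d n)
    (fun _ => true) fun _ => false

theorem decayField_nonneg {δ lam : ℝ} (hlam : 0 ≤ lam) (i : HalfSpace d) :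
    0 ≤ decayField d δ lam i := by
  obtain ⟨l, hl⟩ := eq_site i
  rw [hl, decayField_site]
  exact coef_nonneg hlam l

/-- After freezing the lowest `k` layers to +, dropping the field above them, and translating down,
one has a wall field `J` in a slab of height `n - k`. Cutting the slab to `halfBox d (n - k)` costs
`2 * J` per lost column, and the wall field is at most the decaying field of strength `J`, which
equals `J` on the wall. The three errors are lateral, tail and lateral; only the tail is of the
order of the wall. -/
theorem boxRatio_le {J δ lam : ℝ} (hJ : 0 < J) (hδ : 1 < δ) (hlam : 0 ≤ lam) {n k : ℕ} (hk : 1 ≤ k)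
    (hkn : k < n) :
    boxRatio d J δ lam n ≤ boxRatio d J δ J (n - k)
      + 2 * J * ((base d n).card - (base d (n - k)).card)
      + 2 * (base d n).card * ∑' l, coef δ lam (l + k)
      + 2 * J * (k * ((base d n).card - (base d (n - 1)).card)
        * (base d 1 ×ˢ Finset.Icc (-1 : ℤ) 1).card) := by
  have hK : ∀ e : Sym2 (HalfSpace d), 0 ≤ (fun _ => J) e := fun _ => hJ.le
  set Λ := halfBox d n with hΛ
  set Λ₁ := (slab d n (n - k)).map (raise d k) with hΛ₁
  have hsub : Λ₁ ⊆ Λ := by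
    intro a ha
    obtain ⟨i, hi, rfl⟩ := Finset.mem_map.1 ha
    rw [mem_slab] at hi
    rw [hΛ, mem_halfBox, raise_val]
    exact ⟨hi.1, by simp only; omega⟩
  have hc : ∀ i ∈ Λ, plusIn d n i = true := fun i hi => by simp [plusIn, ← hΛ, hi]
  have hc' : ∀ i ∉ Λ, plusIn d n i = false := fun i hi => by simp [plusIn, ← hΛ, hi]
  have hnn : ∀ i : HalfSpace d, 0 ≤ decayField d δ lam i := decayField_nonneg hlam
  -- freezing the layers of height at most `k`
  have h1 := logRatio_le_freeze (halfGraph d) hK (h := decayField d δ lam) hsub hc hc'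
  -- As `k < n`, the frozen layers do not meet the top of the box, so edges leave it only through
  -- the lateral faces.
  have h2 := hamRest_sub_le (halfGraph d) hJ.le half_degree_le (h := decayField d δ lam) (Λ := Λ) (Λ₁ := Λ₁)
    (S := slab d n k \ slab d (n - 1) k) hc (by
      intro i hi j hj hadj
      rw [Finset.mem_sdiff, hΛ, mem_halfBox] at hi
      have hik : i.1.2 ≤ k := by
        by_contra hik
        obtain ⟨a, rfl⟩ := mem_range_raise.2 (not_le.1 hik)
        refine hi.2 (Finset.mem_map_of_mem _ (mem_slab.2 ⟨hi.1.1, ?_⟩))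
        have := hi.1.2
        rw [raise_val] at this
        simp only at this
        omega
      refine Finset.mem_sdiff.2 ⟨mem_slab.2 ⟨hi.1.1, hik⟩, fun hin => hj ?_⟩
      rw [mem_slab] at hin
      obtain ⟨g1, g2, -⟩ := abs_sub_le_of_adj (a := i.1) (b := j.1) hadj
      have g3 := abs_le.1 g2
      refine mem_halfBox.2 ⟨mem_base.2 fun t => ?_, by omega⟩
      have g4 := mem_base.1 hin.1 t
      have g5 := abs_le.1 (g1 t)
      omega)
  rw [Finset.card_sdiff_of_subset (slab_subset (Nat.sub_le _ _) le_rfl), card_slab, card_slab,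
    ← Nat.mul_sub, Nat.cast_mul, Nat.cast_sub (Finset.card_le_card (base_mono (Nat.sub_le _ _)))]
    at h2
  -- removing the field
  have h3 := logRatio_le_zero_field (halfGraph d) (K := fun _ => J) (Λ := Λ₁) (fun i _ => hnn i)
    (fun _ => true) (plusIn d n)
  have h4 : ∑ i ∈ Λ₁, decayField d δ lam i
      ≤ (base d n).card * ∑' l, coef δ lam (l + k) := by
    rw [hΛ₁, Finset.sum_map, sum_slab]
    simp only [raise_site, decayField_site, Finset.sum_const, nsmul_eq_mul, ← Finset.mul_sum]
    refine mul_le_mul_of_nonneg_left ?_ (card_base_pos n).le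
    exact ((summable_nat_add_iff k).2 (summable_coef hδ lam)).sum_le_tsum _
      fun l _ => coef_nonneg hlam _
  -- vertical translation
  have h5 : logRatio (halfGraph d) (fun _ => J) (fun _ => 0) Λ₁ (fun _ => true) (plusIn d n)
      = logRatio (halfGraph d) (fun _ => J) (wallField d J) (slab d n (n - k))
        (fun _ => true) fun _ => false := by
    unfold logRatio
    rw [zfun_raise J hk hkn.le (c := plusIn d n) hc hc', zfun_raise J hk hkn.le (b := true)
      (c := fun _ => true) (fun _ _ => rfl) fun _ _ => rfl]
  have hwall : ∀ i : HalfSpace d, 0 ≤ wallField d J i := fun i => by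
    unfold wallField; split_ifs; exacts [hJ.le, le_rfl]
  have hss : halfBox d (n - k) ⊆ slab d n (n - k) := slab_subset (Nat.sub_le _ _) le_rfl
  have h6 := logRatio_le_of_subset (halfGraph d) hK hss fun i _ => hwall i
  have h7 : ∑ i ∈ slab d n (n - k) \ halfBox d (n - k), wallField d J i
      = J * ((base d n).card - (base d (n - k)).card) := by
    have := Finset.sum_sdiff (f := wallField d J) hss
    rw [halfBox_eq_slab, sum_slab_wallField J (by omega), sum_slab_wallField J (by omega)] at this
    rw [halfBox_eq_slab]
    linarith
  have h8 : logRatio (halfGraph d) (fun _ => J) (wallField d J) (halfBox d (n - k)) (fun _ => true)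
      (fun _ => false) ≤ boxRatio d J δ J (n - k) := by
    refine logRatio_mono (halfGraph d) hK (fun i _ => ?_) fun _ _ => Bool.false_le _
    obtain ⟨l, hl⟩ := eq_site i
    rw [hl, wallField_site, decayField_site]
    split_ifs with h0
    · simp [h0, coef]
    · exact coef_nonneg hJ.le l
  unfold boxRatio at h8 ⊢
  linarith

end Shift

/-! ### The wall free energy and its derivative -/

section Wall

variable {d : ℕ} {J δ lam : ℝ}

/-- At zero field Q^+ = Q^- by spin flip, so the bulk normalisation cancels; the square cancels the
factor 2 in front of the wall. -/
theorem tendsto_boxRatio (hJ : 0 < J) (hδ : 1 < δ) (hlam : 0 ≤ lam) :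
    Tendsto (fun n => boxRatio d J δ lam n / (base d n).card) atTop
      (𝓝 (wallFreeEnergy d J (decayField d δ lam))) := by
  have h1 : ∀ b, Tendsto (surfaceFreeEnergySeq d J (decayField d δ lam) b) atTop
      (𝓝 (surfaceFreeEnergy d J (decayField d δ lam) b)) := fun b =>
    tendsto_nhds_limUnder (exists_surfaceFreeEnergy_limit hJ hδ hlam b)
  refine ((h1 false).sub (h1 true)).congr fun n => ?_
  have hQ : zfun (latticeGraph d) (fun _ => J) (fun _ => 0) (doubleBox d n) (fun _ => false)
      = zfun (latticeGraph d) (fun _ => J) (fun _ => 0) (doubleBox d n) fun _ => true := by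
    simpa using zfun_flip (latticeGraph d) (fun _ => J) (fun _ => 0) (doubleBox d n) fun _ => true
  have hq : zfun (latticeGraph d) (fun _ => J) (fun _ => 0) (doubleBox d n) (fun _ => true) ≠ 0 :=
    (zfun_pos _ _ _ _ _).ne'
  have hz : ∀ b, zfun (halfGraph d) (fun _ => J) (decayField d δ lam) (halfBox d n)
      (fun _ => b) ≠ 0 := fun b => (zfun_pos _ _ _ _ _).ne'
  simp only [surfaceFreeEnergySeq, partitionFn_eq_zfun]
  rw [hQ, Real.log_div (pow_ne_zero 2 (hz false)) hq, Real.log_div (pow_ne_zero 2 (hz true)) hq,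
    Real.log_pow, Real.log_pow, card_wall, boxRatio, logRatio]
  have := card_base_pos (d := d) n
  field_simp
  push_cast
  ring

theorem wallFreeEnergy_mono (hJ : 0 < J) (hδ : 1 < δ) {s : ℝ} (hs : 0 ≤ s) (hsl : s ≤ lam) :
    wallFreeEnergy d J (decayField d δ s) ≤ wallFreeEnergy d J (decayField d δ lam) := by
  refine le_of_tendsto_of_tendsto' (tendsto_boxRatio hJ hδ hs)
    (tendsto_boxRatio hJ hδ (hs.trans hsl)) fun n => ?_
  refine div_le_div_of_nonneg_right ?_ (card_base_pos n).le
  refine logRatio_mono _ (fun _ => hJ.le) (fun i _ => ?_) fun _ _ => Bool.false_le _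
  have h1 := decayField_nonneg (δ := δ) zero_le_one i
  simp only [decayField] at h1 ⊢
  exact div_le_div_of_nonneg_right hsl (by simpa using h1)

/-- In `boxRatio_le`, first `n → ∞` with `k` fixed removes the lateral errors, then `k → ∞` removes
the tail of the convergent series. -/
theorem wallFreeEnergy_le (hJ : 0 < J) (hδ : 1 < δ) (hlam : 0 ≤ lam) :
    wallFreeEnergy d J (decayField d δ lam) ≤ wallFreeEnergy d J (decayField d δ J) := by
  have hk : ∀ k : ℕ, 1 ≤ k → wallFreeEnergy d J (decayField d δ lam)
      ≤ wallFreeEnergy d J (decayField d δ J) + 2 * ∑' l, coef δ lam (l + k) := by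
    intro k hk
    set D : ℝ := ((base d 1 ×ˢ Finset.Icc (-1 : ℤ) 1).card : ℝ)
    have hr : ∀ j : ℕ, Tendsto (fun n => ((base d (n - j)).card : ℝ) / (base d n).card) atTop
      (𝓝 1) := tendsto_card_base_div
    have h1 : Tendsto (fun n => boxRatio d J δ J (n - k) / (base d (n - k)).card) atTop
        (𝓝 (wallFreeEnergy d J (decayField d δ J))) :=
      (tendsto_boxRatio hJ hδ hJ.le).comp (tendsto_sub_atTop_nat k)
    have h2 := (((h1.mul (hr k)).add (((hr k).const_sub 1).const_mul (2 * J))).add_const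
      (2 * ∑' l, coef δ lam (l + k))).add (((hr 1).const_sub 1).const_mul (2 * J * k * D))
    simp only [mul_one, sub_self, mul_zero, add_zero] at h2
    refine le_of_tendsto_of_tendsto (tendsto_boxRatio hJ hδ hlam) h2 ?_
    filter_upwards [eventually_gt_atTop k] with n hn
    have h3 := boxRatio_le (d := d) hJ hδ hlam hk hn
    have p1 := card_base_pos (d := d) n
    have p2 := card_base_pos (d := d) (n - k)
    rw [div_le_iff₀ p1]
    refine h3.trans_eq ?_
    field_simp
    ring
  have hlim : Tendsto (fun k : ℕ => wallFreeEnergy d J (decayField d δ J)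
      + 2 * ∑' l, coef δ lam (l + k)) atTop (𝓝 (wallFreeEnergy d J (decayField d δ J) + 2 * 0)) :=
    ((tendsto_sum_nat_add (coef δ lam)).const_mul 2).const_add _
  rw [mul_zero, add_zero] at hlim
  exact ge_of_tendsto hlim ((eventually_ge_atTop 1).mono hk)

theorem mem_maxSet_self (hJ : 0 < J) (hδ : 1 < δ) : J ∈ maxSet d J δ :=
  ⟨hJ.le, fun _ hs => wallFreeEnergy_le hJ hδ hs⟩

/-- The difference of the magnetisations at `i` with the two boundary conditions. -/
def magGap (d : ℕ) (J δ lam : ℝ) (n : ℕ) (i : HalfSpace d) : ℝ :=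
  gibbs (halfGraph d) (fun _ => J) (decayField d δ lam) (halfBox d n) (fun _ => true)
      (fun σ => spin (σ i))
    - gibbs (halfGraph d) (fun _ => J) (decayField d δ lam) (halfBox d n) (fun _ => false)
      fun σ => spin (σ i)

theorem magGap_nonneg (hJ : 0 < J) (n : ℕ) (i : HalfSpace d) : 0 ≤ magGap d J δ lam n i :=
  sub_nonneg.2 (gibbs_le_gibbs _ (fun _ => hJ.le) (fun _ _ => le_rfl) (fun _ _ => Bool.false_le _)
    fun _ _ hστ => spin_mono (hστ i))

theorem decayField_eq_mul (lam : ℝ) (i : HalfSpace d) :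
    decayField d δ lam i = lam * decayField d δ 1 i := by
  simp only [decayField]; ring

theorem magGap_anti (hJ : 0 < J) {s : ℝ} (hs : 0 ≤ s) (hsl : s ≤ lam) (n : ℕ) (i : HalfSpace d) :
    magGap d J δ lam n i ≤ magGap d J δ s n i :=
  magnetization_gap_anti _ (fun _ => hJ.le) (fun i _ => decayField_nonneg hs i)
    (fun i _ => by
      rw [decayField_eq_mul, decayField_eq_mul lam]
      exact mul_le_mul_of_nonneg_right hsl (decayField_nonneg zero_le_one i)) i

/-- The derivative of `boxRatio` with respect to the strength of the field. -/
def totalGap (d : ℕ) (J δ lam : ℝ) (n : ℕ) : ℝ :=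
  ∑ i ∈ halfBox d n, decayField d δ 1 i * magGap d J δ lam n i

/-- A nonincreasing derivative: this is the concavity of `boxRatio` in the field strength. -/
theorem totalGap_anti (hJ : 0 < J) {s : ℝ} (hs : 0 ≤ s) (hsl : s ≤ lam) (n : ℕ) :
    totalGap d J δ lam n ≤ totalGap d J δ s n :=
  Finset.sum_le_sum fun i _ =>
    mul_le_mul_of_nonneg_left (magGap_anti hJ hs hsl n i) (decayField_nonneg zero_le_one i)

theorem hasDerivAt_boxRatio (n : ℕ) :
    HasDerivAt (fun s => boxRatio d J δ s n) (totalGap d J δ lam n) lam := by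
  set B : (HalfSpace d → Bool) → ℝ := fun σ => ∑ i ∈ halfBox d n, decayField d δ 1 i * spin (σ i)
    with hB
  have hham : ∀ s σ, ham (halfGraph d) (fun _ => J) (decayField d δ s) (halfBox d n) σ
      = ham (halfGraph d) (fun _ => J) (fun _ => 0) (halfBox d n) σ + s * B σ := fun s σ => by
    rw [ham_add_field (halfGraph d) (fun _ => 0) (decayField d δ s), hB, Finset.mul_sum]
    congr 1
    refine Finset.sum_congr rfl fun i _ => ?_
    rw [decayField_eq_mul]; ring
  have hder : ∀ b, HasDerivAt
      (fun s => Real.log (zfun (halfGraph d) (fun _ => J) (decayField d δ s) (halfBox d n)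
        fun _ => b))
      (gibbs (halfGraph d) (fun _ => J) (decayField d δ lam) (halfBox d n) (fun _ => b) B) lam := by
    intro b
    unfold gibbs
    simp only [zfun_eq_sum, wsum, hham]
    exact hasDerivAt_log_sum_exp _ _ _
  have h1 := (hder true).sub (hder false)
  simp only [hB, gibbs_sum, gibbs_const_mul, ← Finset.sum_sub_distrib, ← mul_sub] at h1
  exact h1

theorem boxRatio_slope (n : ℕ) {s : ℝ} (hsl : s < lam) : ∃ c ∈ Set.Ioo s lam,
    boxRatio d J δ lam n - boxRatio d J δ s n = totalGap d J δ c n * (lam - s) := by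
  obtain ⟨c, hc, h⟩ := exists_hasDerivAt_eq_slope (fun s => boxRatio d J δ s n)
    (fun s => totalGap d J δ s n) hsl
    (fun x _ => (hasDerivAt_boxRatio n).continuousAt.continuousWithinAt)
    fun x _ => hasDerivAt_boxRatio n
  refine ⟨c, hc, ?_⟩
  rw [h, div_mul_cancel₀]
  exact (sub_pos.2 hsl).ne'

/-- One of the two tangent-line inequalities for a concave function. They survive the limit in `n`,
so derivative and limit need not be interchanged. -/
theorem totalGap_mul_le (hJ : 0 < J) (n : ℕ) {s : ℝ} (hs : 0 ≤ s) (hsl : s < lam) :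
    totalGap d J δ lam n * (lam - s) ≤ boxRatio d J δ lam n - boxRatio d J δ s n := by
  obtain ⟨c, hc, h⟩ := boxRatio_slope (d := d) (J := J) (δ := δ) n hsl
  rw [h]
  exact mul_le_mul_of_nonneg_right (totalGap_anti hJ (hs.trans hc.1.le) hc.2.le n)
    (sub_pos.2 hsl).le

theorem le_totalGap_mul (hJ : 0 < J) (n : ℕ) {s : ℝ} (hs : 0 ≤ s) (hsl : s < lam) :
    boxRatio d J δ lam n - boxRatio d J δ s n ≤ totalGap d J δ s n * (lam - s) := by
  obtain ⟨c, hc, h⟩ := boxRatio_slope (d := d) (J := J) (δ := δ) n hsl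
  rw [h]
  exact mul_le_mul_of_nonneg_right (totalGap_anti hJ hs hc.1.le n) (sub_pos.2 hsl).le

theorem exists_magGap_bulk (hJ : 0 < J) (l : ℕ) :
    ∃ m, BulkTendsto d (fun n x => magGap d J δ lam n (site x l)) m := by
  have H : HorizontalAction d (halfGraph d) (fun _ => J) (decayField d δ lam) (halfBox d)
    (halfShift d) := halfAction J fun x i => rfl
  have hx : ∀ x, halfShift d x (site 0 l) = site x l := fun x => by
    simp [site]
  obtain ⟨m, hm⟩ := H.exists_bulk (fun _ => hJ.le) true (dependsOn_spin (site 0 l))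
  obtain ⟨m', hm'⟩ := H.exists_bulk (fun _ => hJ.le) false (dependsOn_spin (site 0 l))
  refine ⟨m - m', ?_⟩
  have := hm.sub hm'
  simp only [hx] at this
  exact this

theorem abs_magGap_le (n : ℕ) (i : HalfSpace d) : |magGap d J δ lam n i| ≤ 2 := by
  refine (abs_sub _ _).trans ?_
  have h1 := abs_gibbs_le (halfGraph d) (fun _ => J) (decayField d δ lam) (halfBox d n)
    (fun _ => true) (F := fun σ => spin (σ i)) fun σ => (abs_spin (σ i)).le
  have h2 := abs_gibbs_le (halfGraph d) (fun _ => J) (decayField d δ lam) (halfBox d n)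
    (fun _ => false) (F := fun σ => spin (σ i)) fun σ => (abs_spin (σ i)).le
  linarith

theorem tendsto_totalGap (hδ : 1 < δ) {m : ℕ → ℝ}
    (hm : ∀ l, BulkTendsto d (fun n x => magGap d J δ lam n (site x l)) (m l)) :
    Tendsto (fun n => totalGap d J δ lam n / (base d n).card) atTop
      (𝓝 (∑' l, coef δ 1 l * m l)) := by
  have h1 := tendsto_layer_sum (summable_coef hδ 1) (coef_nonneg zero_le_one)
    (A := fun n l => (∑ x ∈ base d n, magGap d J δ lam n (site x l)) / (base d n).card)
    (m := m) (C := 2) (fun n l => by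
      rw [abs_div, abs_of_pos (card_base_pos n), div_le_iff₀ (card_base_pos n)]
      refine (Finset.abs_sum_le_sum_abs _ _).trans ?_
      refine (Finset.sum_le_card_nsmul _ _ 2 fun x _ => abs_magGap_le n _).trans_eq ?_
      rw [nsmul_eq_mul, mul_comm])
    fun l => (hm l).tendsto_average fun n x _ => abs_magGap_le n _
  refine h1.congr fun n => ?_
  rw [totalGap, halfBox_eq_slab, sum_slab, Finset.sum_div]
  simp only [decayField_site, ← Finset.mul_sum, mul_div_assoc]

/-- The magnetisation gap vanishes in the thermodynamic limit. -/
def GapVanishes (d : ℕ) (J δ lam : ℝ) : Prop :=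
  ∀ i : HalfSpace d, Tendsto (fun n => magGap d J δ lam n i) atTop (𝓝 0)

/-- To the left of `lam`, monotonicity suffices. To the right, the tangent at `lam` has slope
tending to 0 per wall site, so concavity prevents any increase. -/
theorem GapVanishes.mem_maxSet (hJ : 0 < J) (hδ : 1 < δ) (hlam : 0 ≤ lam)
    (h : GapVanishes d J δ lam) : lam ∈ maxSet d J δ := by
  refine ⟨hlam, fun s hs => ?_⟩
  change wallFreeEnergy d J (decayField d δ s) ≤ wallFreeEnergy d J (decayField d δ lam)
  rcases le_or_gt s lam with hsl | hsl
  · exact wallFreeEnergy_mono hJ hδ hs hsl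
  choose m hm using fun l => exists_magGap_bulk (d := d) (δ := δ) (lam := lam) hJ l
  have hm0 : ∀ l, m l = 0 := fun l => tendsto_nhds_unique ((hm l).tendsto 0) (h _)
  have h1 := tendsto_totalGap hδ hm
  simp only [hm0, mul_zero, tsum_zero] at h1
  have h2 := h1.mul_const (s - lam)
  rw [zero_mul] at h2
  have h3 := (tendsto_boxRatio (d := d) hJ hδ hs).sub (tendsto_boxRatio (d := d) hJ hδ hlam)
  have h4 := le_of_tendsto_of_tendsto' h3 h2 fun n => by
    rw [← sub_div, div_mul_eq_mul_div]
    exact div_le_div_of_nonneg_right (le_totalGap_mul hJ n hlam hsl) (card_base_pos n).le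
  linarith

/-- The slope at `lam` is at most that of the chord from `s`, which is nonpositive in the limit by
maximality. The limiting slope is a series of nonnegative terms with positive weights, so the gap
vanishes in every layer. -/
theorem gapVanishes_of_lt (hJ : 0 < J) (hδ : 1 < δ) {s : ℝ} (hs : s ∈ maxSet d J δ) (hsl : s < lam) :
    GapVanishes d J δ lam := by
  choose m hm using fun l => exists_magGap_bulk (d := d) (δ := δ) (lam := lam) hJ l
  have hlam : 0 ≤ lam := hs.1.trans hsl.le
  have h1 := (tendsto_totalGap hδ hm).mul_const (lam - s)
  have h3 := (tendsto_boxRatio (d := d) hJ hδ hlam).sub (tendsto_boxRatio (d := d) hJ hδ hs.1)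
  have h4 := le_of_tendsto_of_tendsto' h1 h3 fun n => by
    rw [← sub_div, div_mul_eq_mul_div]
    exact div_le_div_of_nonneg_right (totalGap_mul_le hJ n hs.1 hsl) (card_base_pos n).le
  have h5 : wallFreeEnergy d J (decayField d δ lam) ≤ wallFreeEnergy d J (decayField d δ s) :=
    hs.2 (Set.mem_Ici.2 hlam)
  have hm0 : ∀ l, 0 ≤ m l := fun l =>
    ge_of_tendsto' ((hm l).tendsto 0) fun n => magGap_nonneg hJ n _
  have hm2 : ∀ l, m l ≤ 2 := fun l =>
    le_of_tendsto' ((hm l).tendsto 0) fun n => (abs_le.1 (abs_magGap_le n _)).2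
  have hsum : Summable fun l => coef δ 1 l * m l :=
    Summable.of_nonneg_of_le (fun l => mul_nonneg (coef_nonneg zero_le_one l) (hm0 l))
      (fun l => mul_le_mul_of_nonneg_left (hm2 l) (coef_nonneg zero_le_one l))
      ((summable_coef hδ 1).mul_right 2)
  have hnn : ∀ l, 0 ≤ coef δ 1 l * m l := fun l => mul_nonneg (coef_nonneg zero_le_one l) (hm0 l)
  have h6 : ∑' l, coef δ 1 l * m l = 0 := by
    refine le_antisymm ?_ (tsum_nonneg hnn)
    by_contra hpos
    have := mul_pos (not_le.1 hpos) (sub_pos.2 hsl)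
    linarith
  have h7 := (hasSum_zero_iff_of_nonneg hnn).1 (h6 ▸ hsum.hasSum)
  intro i
  obtain ⟨l, hl⟩ := eq_site i
  have h8 : coef δ 1 l * m l = 0 := congrFun h7 l
  have h9 : 0 < coef δ 1 l := div_pos one_pos (by positivity)
  have h10 : m l = 0 := (mul_eq_zero.1 h8).resolve_left h9.ne'
  have := (hm l).tendsto i.1.1
  rwa [h10, ← hl] at this

end Wall

/-! ### Infinite-volume Gibbs measures -/

section DLR

variable {V : Type*} [DecidableEq V]

theorem continuous_of_dependsOn {F : (V → Bool) → ℝ} {A : Finset V}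
    (hF : DependsOn F (A : Set V)) : Continuous F := by
  have h1 : F = (fun ω : A → Bool => F (glue A (fun _ => true) ω)) ∘ fun σ (i : A) => σ i := by
    funext σ
    exact hF fun i hi => (glue_mem (Finset.mem_coe.1 hi) _ fun i : A => σ i).symm
  rw [h1]
  exact continuous_of_discreteTopology.comp (by fun_prop)

/-- The interaction has finite range: only `A` and the neighbours of `Λ` matter. Hence the DLR
kernel maps local functions to local, thus continuous, functions. -/
theorem exists_dependsOn_gibbs (G : SimpleGraph V) [G.LocallyFinite] (K : Sym2 V → ℝ)
    (h : V → ℝ) (Λ : Finset V) {F : (V → Bool) → ℝ} {A : Finset V}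
    (hF : DependsOn F (A : Set V)) :
    ∃ A' : Finset V, DependsOn (fun η => gibbs G K h Λ η F) (A' : Set V) := by
  refine ⟨A ∪ Λ.biUnion fun i => G.neighborFinset i, fun η η' hη => ?_⟩
  have hval : ∀ (ω : Λ → Bool) (i : V), (i ∈ Λ ∨ η i = η' i) → glue Λ η ω i = glue Λ η' ω i := by
    intro ω i hi
    by_cases h1 : i ∈ Λ
    · rw [glue_mem h1, glue_mem h1]
    · rw [glue_notMem h1, glue_notMem h1]; exact hi.resolve_left h1
  have hnbr : ∀ i j, j ∈ Λ → G.Adj j i → η i = η' i := fun i j hj hij =>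
    hη i (Finset.mem_coe.2 (Finset.mem_union_right _ (Finset.mem_biUnion.2
      ⟨j, hj, (G.mem_neighborFinset j i).2 hij⟩)))
  have hham : ∀ ω : Λ → Bool, ham G K h Λ (glue Λ η ω) = ham G K h Λ (glue Λ η' ω) := by
    intro ω
    unfold ham
    congr 1
    · refine Finset.sum_congr rfl fun e he => ?_
      induction e with | _ a b
      obtain ⟨hab, hin⟩ := mem_touchingEdges.1 he
      rw [edge_mul_congr (hval ω a _) (hval ω b _)]
      · exact hin.imp id fun hb => hnbr a b hb hab.symm
      · exact hin.symm.imp id fun ha => hnbr b a ha hab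
    · exact Finset.sum_congr rfl fun i hi => by rw [hval ω i (Or.inl hi)]
  have hFω : ∀ ω : Λ → Bool, F (glue Λ η ω) = F (glue Λ η' ω) := fun ω =>
    hF fun i hi => hval ω i (Or.inr (hη i (Finset.mem_coe.2 (Finset.mem_union_left _ hi))))
  simp only [gibbs, zfun, wsum, hham, hFω]

/-- The expectations with arbitrary boundary conditions are controlled by the magnetisations. -/
theorem abs_gibbs_sub_le (G : SimpleGraph V) [G.LocallyFinite] {K : Sym2 V → ℝ}
    (hK : ∀ e, 0 ≤ K e) (h : V → ℝ) (Λ : Finset V) (η : V → Bool) {F : (V → Bool) → ℝ}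
    {A : Finset V} {c : ℝ} (hc0 : 0 ≤ c)
    (hadd : Monotone fun σ : V → Bool => c * ∑ i ∈ A, spin (σ i) + F σ)
    (hsub : Monotone fun σ : V → Bool => c * ∑ i ∈ A, spin (σ i) - F σ) :
    |gibbs G K h Λ (fun _ => true) F - gibbs G K h Λ η F|
      ≤ c * ∑ i ∈ A, (gibbs G K h Λ (fun _ => true) (fun σ => spin (σ i))
        - gibbs G K h Λ (fun _ => false) fun σ => spin (σ i)) := by
  have h1 := gibbs_le_gibbs G hK (h := h) (h' := h) (Λ := Λ) (fun _ _ => le_rfl) (η := η)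
    (η' := fun _ => true) (fun _ _ => Bool.le_true _) hadd
  have h2 := gibbs_le_gibbs G hK (h := h) (h' := h) (Λ := Λ) (fun _ _ => le_rfl) (η := η)
    (η' := fun _ => true) (fun _ _ => Bool.le_true _) hsub
  have h3 : ∀ i ∈ A, gibbs G K h Λ (fun _ => false) (fun σ => spin (σ i))
      ≤ gibbs G K h Λ η (fun σ => spin (σ i)) := fun i _ =>
    gibbs_le_gibbs G hK (fun _ _ => le_rfl) (fun _ _ => Bool.false_le _)
      fun _ _ hστ => spin_mono (hστ i)
  have h4 := mul_le_mul_of_nonneg_left (Finset.sum_le_sum h3) hc0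
  simp only [gibbs_add, gibbs_sub, gibbs_const_mul, gibbs_sum] at h1 h2
  rw [Finset.sum_sub_distrib, mul_sub, abs_le]
  constructor <;> linarith

variable [Countable V]

/-- The finite-volume Gibbs measure. -/
def boxMeasure (G : SimpleGraph V) [G.LocallyFinite] (K : Sym2 V → ℝ) (h : V → ℝ) (Λ : Finset V)
    (η : V → Bool) : Measure (V → Bool) :=
  ∑ ω : Λ → Bool, ENNReal.ofReal (Real.exp (ham G K h Λ (glue Λ η ω)) / zfun G K h Λ η)
    • Measure.dirac (glue Λ η ω)

theorem isProbabilityMeasure_boxMeasure (G : SimpleGraph V) [G.LocallyFinite] (K : Sym2 V → ℝ)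
    (h : V → ℝ) (Λ : Finset V) (η : V → Bool) :
    IsProbabilityMeasure (boxMeasure G K h Λ η) := by
  constructor
  have hz := zfun_pos G K h Λ η
  simp only [boxMeasure, Measure.coe_finsetSum, Finset.sum_apply, Measure.smul_apply,
    measure_univ, smul_eq_mul, mul_one]
  rw [← ENNReal.ofReal_sum_of_nonneg fun ω _ => by positivity, ← Finset.sum_div, ← zfun_eq_sum,
    div_self hz.ne', ENNReal.ofReal_one]

theorem integral_boxMeasure (G : SimpleGraph V) [G.LocallyFinite] (K : Sym2 V → ℝ)
    (h : V → ℝ) (Λ : Finset V) (η : V → Bool) (F : (V → Bool) → ℝ) :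
    ∫ σ, F σ ∂(boxMeasure G K h Λ η) = gibbs G K h Λ η F := by
  have hz := zfun_pos G K h Λ η
  rw [boxMeasure, integral_finsetSum_measure fun ω _ =>
    (integrable_dirac (by simp)).smul_measure ENNReal.ofReal_ne_top]
  rw [gibbs, wsum, Finset.sum_div]
  refine Finset.sum_congr rfl fun ω _ => ?_
  rw [integral_smul_measure, integral_dirac, ENNReal.toReal_ofReal (by positivity), smul_eq_mul]
  ring

theorem probabilityMeasure_ext {μ ν : ProbabilityMeasure (V → Bool)}
    (h : ∀ f : LocalObs V, ∫ σ, f.1 σ ∂(μ : Measure (V → Bool))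
      = ∫ σ, f.1 σ ∂(ν : Measure (V → Bool))) : μ = ν := by
  refine Subtype.ext ?_
  change (μ : Measure (V → Bool)) = (ν : Measure (V → Bool))
  refine ext_of_generate_finite (measurableCylinders fun _ : V => Bool)
    generateFrom_measurableCylinders.symm isPiSystem_measurableCylinders (fun s hs => ?_)
    (by simp)
  have hms : MeasurableSet s := MeasurableSet.of_mem_measurableCylinders hs
  obtain ⟨A, S, -, hAS⟩ := (mem_measurableCylinders s).1 hs
  have hdep : DependsOn (s.indicator fun _ => (1 : ℝ)) (A : Set V) := by
    intro σ τ hστ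
    have h1 : A.restrict σ = A.restrict τ := funext fun i => hστ i i.2
    have h2 : σ ∈ s ↔ τ ∈ s := by
      rw [hAS, mem_cylinder, mem_cylinder, h1]
    by_cases h3 : σ ∈ s
    · rw [Set.indicator_of_mem h3, Set.indicator_of_mem (h2.1 h3)]
    · rw [Set.indicator_of_notMem h3, Set.indicator_of_notMem fun h4 => h3 (h2.2 h4)]
  have h1 := h ⟨_, A, hdep⟩
  simp only at h1
  rw [integral_indicator_const _ hms, integral_indicator_const _ hms] at h1
  simp only [smul_eq_mul, mul_one] at h1
  exact (measureReal_eq_measureReal_iff).1 h1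

theorem integrable_local (μ : ProbabilityMeasure (V → Bool)) {F : (V → Bool) → ℝ} {A : Finset V}
    (hF : DependsOn F (A : Set V)) : Integrable F (μ : Measure (V → Bool)) := by
  obtain ⟨C, hC⟩ := exists_abs_le_of_dependsOn hF
  exact Integrable.of_bound (continuous_of_dependsOn hF).aestronglyMeasurable C
    (Eventually.of_forall hC)

/-- A limit of finite-volume expectations defines a Gibbs measure. -/
theorem exists_isGibbs (G : SimpleGraph V) [G.LocallyFinite] (J : ℝ) (h : V → ℝ)
    (B : ℕ → Finset V) (hB : ∀ Λ : Finset V, ∀ᶠ n in atTop, Λ ⊆ B n) (η : V → Bool) :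
    ∃ μ : ProbabilityMeasure (V → Bool), IsGibbs G J h μ := by
  set ν : ℕ → ProbabilityMeasure (V → Bool) := fun n =>
    ⟨boxMeasure G (fun _ => J) h (B n) η, isProbabilityMeasure_boxMeasure _ _ _ _ _⟩ with hν
  set U : Ultrafilter ℕ := hyperfilter ℕ
  -- The space of probability measures on the compact space `V → Bool` is compact; a limit along an
  -- ultrafilter needs no subsequence.
  obtain ⟨μ, -, hμ⟩ := isCompact_univ.ultrafilter_le_nhds (U.map ν) (by simp)
  have hlim : Tendsto ν (U : Filter ℕ) (𝓝 μ) := hμ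
  have hU : (U : Filter ℕ) ≤ atTop := Nat.hyperfilter_le_atTop
  rw [ProbabilityMeasure.tendsto_iff_forall_integral_tendsto] at hlim
  have hloc : ∀ {F : (V → Bool) → ℝ} {A : Finset V}, DependsOn F (A : Set V) →
      Tendsto (fun n => gibbs G (fun _ => J) h (B n) η F) (U : Filter ℕ)
        (𝓝 (∫ σ, F σ ∂(μ : Measure (V → Bool)))) := by
    intro F A hF
    obtain ⟨C, hC⟩ := exists_abs_le_of_dependsOn hF
    have := hlim (BoundedContinuousFunction.ofNormedAddCommGroup F (continuous_of_dependsOn hF) C hC)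
    simpa only [BoundedContinuousFunction.coe_ofNormedAddCommGroup, hν, ProbabilityMeasure.coe_mk,
      integral_boxMeasure] using this
  refine ⟨μ, fun Λ f => ?_⟩
  obtain ⟨F, A, hF⟩ := f
  obtain ⟨A', hA'⟩ := exists_dependsOn_gibbs G (fun _ => J) h Λ hF
  simp only [expect_eq_gibbs]
  -- By consistency the two sequences of expectations coincide as soon as the box contains `Λ`.
  refine tendsto_nhds_unique (hloc hF) ((hloc hA').congr' ?_)
  filter_upwards [hU (hB Λ)] with n hn
  exact gibbs_gibbs G (fun _ => J) h hn η F

/-- Gibbs measures are unique when the magnetisation gap vanishes. -/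
theorem isGibbs_integral_eq (G : SimpleGraph V) [G.LocallyFinite] {J : ℝ} (hJ : 0 ≤ J)
    (h : V → ℝ) (B : ℕ → Finset V)
    (hgap : ∀ i, Tendsto (fun n => gibbs G (fun _ => J) h (B n) (fun _ => true)
        (fun σ => spin (σ i)) - gibbs G (fun _ => J) h (B n) (fun _ => false)
          fun σ => spin (σ i)) atTop (𝓝 0))
    {μ : ProbabilityMeasure (V → Bool)} (hμ : IsGibbs G J h μ) (f : LocalObs V) :
    Tendsto (fun n => gibbs G (fun _ => J) h (B n) (fun _ => true) f.1) atTop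
      (𝓝 (∫ σ, f.1 σ ∂(μ : Measure (V → Bool)))) := by
  obtain ⟨F, A, hF⟩ := f
  obtain ⟨c, hc0, hadd, hsub⟩ := exists_monotone_add_sub hF
  rw [tendsto_iff_norm_sub_tendsto_zero]
  have hlim : Tendsto (fun n => c * ∑ i ∈ A, (gibbs G (fun _ => J) h (B n) (fun _ => true)
      (fun σ => spin (σ i)) - gibbs G (fun _ => J) h (B n) (fun _ => false)
        fun σ => spin (σ i))) atTop (𝓝 0) := by
    simpa using (tendsto_finsetSum A fun i _ => hgap i).const_mul c
  refine squeeze_zero (fun _ => norm_nonneg _) (fun n => ?_) hlim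
  obtain ⟨A', hA'⟩ := exists_dependsOn_gibbs G (fun _ => J) h (B n) hF
  have h1 := hμ (B n) ⟨F, A, hF⟩
  simp only [expect_eq_gibbs] at h1
  -- The DLR equation in `B n` makes the integral an average over boundary conditions, each within
  -- the magnetisation gap bound of the + one.
  have h2 : gibbs G (fun _ => J) h (B n) (fun _ => true) F - ∫ σ, F σ ∂(μ : Measure (V → Bool))
      = ∫ η, (gibbs G (fun _ => J) h (B n) (fun _ => true) F - gibbs G (fun _ => J) h (B n) η F)
        ∂(μ : Measure (V → Bool)) := by
    rw [integral_sub (integrable_const _) (integrable_local μ hA'), h1]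
    simp
  simp only
  rw [h2]
  refine (norm_integral_le_of_norm_le_const (Eventually.of_forall fun η =>
    abs_gibbs_sub_le G (fun _ => hJ) h (B n) η hc0 hadd hsub)).trans_eq ?_
  simp

end DLR

/-! ### Equality of the two states -/

section States

variable {d : ℕ} {J δ lam : ℝ}

theorem exists_decay_state_limit (hJ : 0 < J) (lam : ℝ) (b : Bool)
    (f : LocalObs (HalfSpace d)) :
    ∃ l : ℝ, Tendsto (fun n => boxExpect d J (decayField d δ lam) b n f.1) atTop (𝓝 l) :=
  exists_state_limit hJ (fun _ _ => rfl) b f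

theorem tendsto_state (hJ : 0 < J) (lam : ℝ) (b : Bool) (f : LocalObs (HalfSpace d)) :
    Tendsto (fun n => gibbs (halfGraph d) (fun _ => J) (decayField d δ lam) (halfBox d n)
      (fun _ => b) f.1) atTop (𝓝 (state d J (decayField d δ lam) b f)) := by
  have h1 := tendsto_nhds_limUnder (exists_decay_state_limit (δ := δ) hJ lam b f)
  exact h1.congr fun n => expect_eq_gibbs _ _ _ _ _ _

theorem gapVanishes_iff (hJ : 0 < J) :
    GapVanishes d J δ lam ↔
      state d J (decayField d δ lam) true = state d J (decayField d δ lam) false := by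
  constructor
  · intro h
    funext f
    have h1 := (tendsto_state (δ := δ) hJ lam true f).sub (tendsto_state (δ := δ) hJ lam false f)
    obtain ⟨F, A, hF⟩ := f
    obtain ⟨c, hc0, hadd, hsub⟩ := exists_monotone_add_sub hF
    have hlim : Tendsto (fun n => c * ∑ i ∈ A, magGap d J δ lam n i) atTop (𝓝 0) := by
      simpa using (tendsto_finsetSum A fun i _ => h i).const_mul c
    have h2 := squeeze_zero (fun _ => abs_nonneg _) (fun n => abs_gibbs_sub_le (halfGraph d)
      (fun _ => hJ.le) (decayField d δ lam) (halfBox d n) (fun _ => false) hc0 hadd hsub) hlim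
    have h3 := tendsto_nhds_unique h1 ((tendsto_zero_iff_abs_tendsto_zero _).2 h2)
    exact sub_eq_zero.1 h3
  · intro h i
    have h1 := (tendsto_state (δ := δ) hJ lam true ⟨_, {i}, dependsOn_spin i⟩).sub
      (tendsto_state (δ := δ) hJ lam false ⟨_, {i}, dependsOn_spin i⟩)
    rwa [h, sub_self] at h1

theorem eventually_subset_halfBox (Λ : Finset (HalfSpace d)) :
    ∀ᶠ n in atTop, Λ ⊆ halfBox d n := by
  have h1 : ∀ i : HalfSpace d, ∀ᶠ n in atTop, i ∈ halfBox d n := fun i => by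
    refine eventually_atTop.2 ⟨(∑ j, (i.1.1 j).natAbs) + i.1.2.natAbs, fun n hn => ?_⟩
    refine mem_halfBox.2 ⟨mem_base.2 fun j => ?_, by omega⟩
    have := Finset.single_le_sum (f := fun j => (i.1.1 j).natAbs) (fun _ _ => Nat.zero_le _)
      (Finset.mem_univ j)
    omega
  exact (Finset.eventually_all Λ).2 fun i _ => h1 i

end States

end SemiInfIsing

end

/-! ### The main theorem -/

theorem mainTheorem3 (d : ℕ) (hd : 1 ≤ d) (J : ℝ) (hJ : 0 < J) (δ : ℝ) (hδ : 1 < δ) :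
    -- the limits that define the two states exist
    (∀ lam : ℝ, 0 ≤ lam → ∀ (b : Bool) (f : SemiInfIsing.LocalObs (SemiInfIsing.HalfSpace d)),
      ∃ l : ℝ, Filter.Tendsto
        (fun n => SemiInfIsing.boxExpect d J (SemiInfIsing.decayField d δ lam) b n f.1)
        Filter.atTop (nhds l)) ∧
    -- the limits that define the free surface energies exist
    (∀ lam : ℝ, 0 ≤ lam → ∀ b : Bool,
      ∃ l : ℝ, Filter.Tendsto
        (SemiInfIsing.surfaceFreeEnergySeq d J (SemiInfIsing.decayField d δ lam) b)
        Filter.atTop (nhds l)) ∧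
    -- the wall free energy reaches its maximum
    (SemiInfIsing.maxSet d J δ).Nonempty ∧
    -- phase transition below the critical value
    (∀ lam : ℝ, 0 ≤ lam → lam < SemiInfIsing.lambdaBar d J δ →
      SemiInfIsing.state d J (SemiInfIsing.decayField d δ lam) true
        ≠ SemiInfIsing.state d J (SemiInfIsing.decayField d δ lam) false) ∧
    -- uniqueness above the critical value
    (∀ lam : ℝ, SemiInfIsing.lambdaBar d J δ < lam →
      SemiInfIsing.state d J (SemiInfIsing.decayField d δ lam) true
        = SemiInfIsing.state d J (SemiInfIsing.decayField d δ lam) false ∧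
      ∃! μ : MeasureTheory.ProbabilityMeasure (SemiInfIsing.HalfSpace d → Bool),
        SemiInfIsing.IsGibbs (SemiInfIsing.halfGraph d) J
          (SemiInfIsing.decayField d δ lam) μ) := by
  refine ⟨fun lam _ b f => SemiInfIsing.exists_decay_state_limit hJ lam b f,
    fun lam hlam b => SemiInfIsing.exists_surfaceFreeEnergy_limit hJ hδ hlam b,
    ⟨J, SemiInfIsing.mem_maxSet_self hJ hδ⟩, fun lam hlam hlt heq => ?_, fun lam hlt => ?_⟩
  -- Equal states would make `lam` a maximum point lying below the infimum of all maximum points.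
  · have h1 := ((SemiInfIsing.gapVanishes_iff hJ).2 heq).mem_maxSet hJ hδ hlam
    exact absurd (csInf_le ⟨0, fun s hs => hs.1⟩ h1) (not_le.2 hlt)
  -- Some maximum point lies strictly below `lam`; whether the infimum is itself attained is
  -- irrelevant.
  · obtain ⟨s, hs, hsl⟩ := exists_lt_of_csInf_lt ⟨J, SemiInfIsing.mem_maxSet_self hJ hδ⟩ hlt
    have hgap := SemiInfIsing.gapVanishes_of_lt hJ hδ hs hsl
    refine ⟨(SemiInfIsing.gapVanishes_iff hJ).1 hgap, ?_⟩
    obtain ⟨μ, hμ⟩ := SemiInfIsing.exists_isGibbs (SemiInfIsing.halfGraph d) J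
      (SemiInfIsing.decayField d δ lam) (SemiInfIsing.halfBox d)
      SemiInfIsing.eventually_subset_halfBox fun _ => true
    refine ⟨μ, hμ, fun ν hν => SemiInfIsing.probabilityMeasure_ext fun f => ?_⟩
    exact tendsto_nhds_unique
      (SemiInfIsing.isGibbs_integral_eq _ hJ.le _ (SemiInfIsing.halfBox d) hgap hν f)
      (SemiInfIsing.isGibbs_integral_eq _ hJ.le _ (SemiInfIsing.halfBox d) hgap hμ f)
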